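/- Theorem 4.1. Let $f:[0,1]\to[0,1]$ be continuous, let $n\ge 1$ and let $I\subset[0,1]$ be an $n$-periodic interval, i.e. a non-degenerate closed interval such that $I,fI,\dots,f^{n-1}I$ are pairwise disjoint and $f^nI=I$. For a set $A$ write $\mathrm{orb}\,A=\bigcup_{i\ge 0}f^iA$, and put $M=\mathrm{orb}\,I$. Let $$B=B(M,f)=\{x\in M:\ \overline{\mathrm{orb}\,U}=M\ \text{for every relative neighbourhood } U \text{ of } x \text{ in } M\},$$ and assume that $B$ is infinite (then $B$ is called a basic set). Terminology. If $K$ is an invariant set of a map $F$ and $S\subset K$ is invariant, then a continuous monotone map $\phi:K\to N$ (non-decreasing, with connected point preimages) almost conjugates $F|S$ to $g:N\to N$ if $\phi\circ F=g\circ\phi$ on $K$, $\phi(S)=N$, and for every $y\in N$ the interior (in $[0,1]$) of $\phi^{-1}(y)$ is disjoint from $S$ and $1\le \mathrm{card}(\phi^{-1}(y)\cap S)\le 2$. The map $F|S$ is transitive if for any non-empty relatively open $U,V\subset S$ some iterate of $U$ meets $V$. A map $g:[0,1]\to[0,1]$ is mixing if for any non-empty open $U,V$ all sufficiently high iterates of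 $U$ meet $V$. Then: 1. $f|B$ is almost conjugate, by a monotone map $\phi:M\to M'$, to a transitive continuous map $g:M'\to M'$, where $M'=\bigcup_{i\ge 0} g^iI'\subset[0,1]$ for some $n$-periodic interval $I'$ of $g$ and $\phi(I)=I'$ (so $M'$ is an interval if $n=1$); 2. $B$ is closed, invariant ($fB=B$) and perfect; 3. $f|B$ is transitive; moreover $B$ is a maximal limit set: $B=\omega(x)$ for some $x\in B$, and $\omega(z)=B$ whenever $z\in[0,1]$ and $\omega(z)\supset B$ (here $\omega(x)$ is the set of limit points of the sequence $(f^ix)_{i\ge 0}$); 4. the topological entropy satisfies $h(f|B)\ge (\ln 2)/(2n)$; 5. $B\subset\overline{\mathrm{Per}\,f}$, where $\mathrm{Per}\,f$ is the set of periodic points of $f$; 6. there are a non-degenerate closed interval $J\subset I$, an integer $k=n$ or $k=2n$, with $J=I$ if $k=n$, such that the set $\widetilde B=\overline{\mathrm{int}\,J\cap B}$ satisfies $f^kJ=J$, $f^k\widetilde B=\widetilde B$, the set $f^i\widetilde B\cap f^j\widetilde B$ contains at most one point for $0\le i<j<k$, $\bigcup_{i=0}^{k-1}f^i\widetilde B=B$,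 and $f^k|\widetilde B$ is almost conjugate, by a monotone map $\phi:J\to[0,1]$, to a mixing continuous map $g:[0,1]\to[0,1]$. -/

import Mathlib

open Set Filter Topology

namespace IntervalDynamics

/-- The forward orbit `⋃_{i ≥ 0} fⁱ(A)` of a set `A`. -/
def orb {X : Type*} (f : X → X) (A : Set X) : Set X :=
  ⋃ i : ℕ, f^[i] '' A

/-- The `ω`-limit set of the point `x` under iteration of `f`. -/
def omegaSet {X : Type*} [TopologicalSpace X] (f : X → X) (x : X) : Set X :=
  omegaLimit atTop (fun (m : ℕ) (y : X) => f^[m] y) {x}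

/-- `I` is a non-degenerate closed interval. -/
def IsClosedInterval {X : Type*} [Preorder X] (I : Set X) : Prop :=
  ∃ a b : X, a < b ∧ I = Icc a b

/-- `I` is an `n`-periodic interval of `f`: a non-degenerate closed interval such that
`I, f I, …, fⁿ⁻¹ I` are pairwise disjoint and `fⁿ I = I`, where `n ≥ 1`. -/
structure IsPeriodicInterval {X : Type*} [Preorder X] (f : X → X) (n : ℕ) (I : Set X) : Prop where
  pos : 0 < n
  interval : IsClosedInterval I
  disjoint : ∀ i j : ℕ, i < j → j < n → Disjoint (f^[i] '' I) (f^[j] '' I)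
  image_eq : f^[n] '' I = I

/-- The set `B(M, f)` of all `x ∈ M` such that the orbit of every relative neighbourhood of `x`
in `M` is dense in `M` (its closure is `M`). When `M` is the orbit of a periodic interval and
this set is infinite, it is called a basic set. -/
def basicSet {X : Type*} [TopologicalSpace X] (f : X → X) (M : Set X) : Set X :=
  {x ∈ M | ∀ U ∈ 𝓝 x, closure (orb f (U ∩ M)) = M}

/-- Topological transitivity of the restriction of `f` to the invariant set `K`: any non-empty
relatively open subset of `K` has an iterate meeting any other one. -/
def IsTransitiveOn {X : Type*} [TopologicalSpace X] (f : X → X) (K : Set X) : Prop :=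
  MapsTo f K K ∧
    ∀ U V : Set X, IsOpen U → IsOpen V → (U ∩ K).Nonempty → (V ∩ K).Nonempty →
      ∃ m : ℕ, (f^[m] '' (U ∩ K) ∩ V).Nonempty

/-- Topological mixing of `g`: for all non-empty open `U`, `V`, all sufficiently high iterates
of `U` meet `V`. -/
def IsMixing {X : Type*} [TopologicalSpace X] (g : X → X) : Prop :=
  ∀ U V : Set X, IsOpen U → IsOpen V → U.Nonempty → V.Nonempty →
    ∃ N : ℕ, ∀ m : ℕ, N ≤ m → (g^[m] '' U ∩ V).Nonempty

/-- The monotone map `φ : K → N` almost conjugates `f|F` to `g : N → N`, where `F ⊆ K` and `K`, `F`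
are invariant under `f`: it semiconjugates `f|K` to `g`, maps `F` onto `N`, its fibres are
connected, no point of `F` is interior to a fibre, and every fibre contains one or two points
of `F`. -/
structure AlmostConjugates {X Y : Type*} [TopologicalSpace X] [Preorder X]
    [TopologicalSpace Y] [Preorder Y]
    (φ : X → Y) (f : X → X) (K F : Set X) (g : Y → Y) (N : Set Y) : Prop where
  subset : F ⊆ K
  mapsTo_domain : MapsTo f K K
  mapsTo_subset : MapsTo f F F
  continuousOn : ContinuousOn φ K
  monotoneOn : MonotoneOn φ K
  mapsTo : MapsTo φ K N
  semiconj : ∀ x ∈ K, φ (f x) = g (φ x)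
  image_eq : φ '' F = N
  fibre_connected : ∀ y ∈ N, IsConnected (K ∩ φ ⁻¹' {y})
  fibre_interior : ∀ y ∈ N, interior (K ∩ φ ⁻¹' {y}) ∩ F = ∅
  fibre_card : ∀ y ∈ N, 1 ≤ (F ∩ φ ⁻¹' {y}).encard ∧ (F ∩ φ ⁻¹' {y}).encard ≤ 2

end IntervalDynamics

namespace IntervalDynamics

/-! `DenseOrb` says that the orbit of a set is dense in `M`; `B` consists of the points of `M` all
of whose relative neighbourhoods have this property. The starting observation is that if two
iterates of an interval meet, its orbit is a finite union of intervals and has finite frontier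
(`frontier_orb_finite`). The infinite set `B` does not fit into such a frontier. Hence, when an
interval with dense orbit is cut in two, one of the pieces still has a dense orbit
(`denseOrb_or_of_union`). By compactness such an interval meets `B`, and in fact in infinitely many
points (`inter_Icc_infinite`). It follows that `B` is perfect and mapped onto itself, and that `f`
sends gaps of `B` into gaps of `B`. The frontier argument also shows that a limit set containing `B`
equals `B`.

The distribution function `φ` of a suitable atomless measure collapses exactly the gaps of `B`
inside `M` (`exists_monotone_collapse`). As gaps go into gaps, `f` descends to a continuous map `g`
on `φ '' M`, which is transitive because `φ '' B = φ '' M`. Transitivity lifts back to `B` through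
small saturated intervals. Transitivity on `B` gives periodic points, since returns to an interval
in both directions force one, and Baire's theorem gives a point of `B` with limit set `B`.

For mixing and entropy, the return map `g^[n]` on the interval `φ '' I` is rescaled to a transitive
map of the unit interval. Either all iterates of such a map are transitive, and it is mixing, or it
exchanges the two sides of a fixed point (`totally_or_swap`). In the first case `J = I` and `k = n`.
In the second case `k = 2 * n` and `J` lies over the right half, whose return map fixes an end and
so cannot exchange halves again. A transitive map with two fixed points has a horseshoe
(`exists_horseshoe`). This applies to the square of the return map in the first case and to the
return map of the half in the second, so both times a horseshoe appears after `2 * n` steps of `f`,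
and its itineraries are realised in `B`. -/

/-! ### Frontiers of unions of intervals; subintervals with prescribed image. -/

/-- A frontier point cannot have points of `S` on both sides, so it is the infimum or the supremum
of `S`. -/
theorem frontier_finite_of_ordConnected {α : Type*} [LinearOrder α] [TopologicalSpace α]
    [OrderTopology α] {S : Set α} (h : S.OrdConnected) : (frontier S).Finite := by
  have hsub : frontier S ⊆ {x ∈ closure S | ∀ s ∈ S, x ≤ s} ∪ {x ∈ closure S | ∀ s ∈ S, s ≤ x} := by
    intro x hx
    by_contra hcon
    simp only [mem_union, mem_ofPred_eq, not_or, not_and, not_forall, not_le] at hcon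
    obtain ⟨a, ha, hax⟩ := hcon.1 hx.1
    obtain ⟨b, hb, hbx⟩ := hcon.2 hx.1
    exact hx.2 (mem_interior.2 ⟨Ioo a b, fun y hy => h.out ha hb ⟨hy.1.le, hy.2.le⟩, isOpen_Ioo,
      hax, hbx⟩)
  refine (Set.Finite.union (Set.Subsingleton.finite ?_) (Set.Subsingleton.finite ?_)).subset hsub
  · intro x hx y hy
    have hx' : IsGLB S x := isGLB_of_mem_closure hx.2 hx.1
    have hy' : IsGLB S y := isGLB_of_mem_closure hy.2 hy.1
    exact hx'.unique hy'
  · intro x hx y hy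
    have hx' : IsLUB S x := isLUB_of_mem_closure hx.2 hx.1
    have hy' : IsLUB S y := isLUB_of_mem_closure hy.2 hy.1
    exact hx'.unique hy'

theorem frontier_sUnion_finite {α : Type*} [LinearOrder α] [TopologicalSpace α]
    [OrderTopology α] {F : Set (Set α)} (hF : F.Finite) (h : ∀ S ∈ F, S.OrdConnected) :
    (frontier (⋃₀ F)).Finite := by
  induction F, hF using Set.Finite.induction_on with
  | empty => simp
  | @insert S F _ _ ih =>
    rw [sUnion_insert]
    refine (Set.Finite.union (frontier_finite_of_ordConnected (h S (mem_insert _ _)))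
      (ih fun T hT => h T (mem_insert_of_mem _ hT))).subset ?_
    refine (frontier_union_subset _ _).trans ?_
    exact union_subset_union inter_subset_left inter_subset_right

theorem inter_frontier_nonempty {α : Type*} [TopologicalSpace α] {K S : Set α}
    (hK : IsPreconnected K) (h1 : (K ∩ S).Nonempty) (h2 : ¬ K ⊆ S) :
    (K ∩ frontier S).Nonempty := by
  by_contra hcon
  rw [not_nonempty_iff_eq_empty] at hcon
  obtain ⟨x, hxK, hxS⟩ := h1
  obtain ⟨y, hyK, hyS⟩ := not_subset.1 h2
  have key : ∀ z ∈ K, z ∈ interior S ∨ z ∈ (closure S)ᶜ := by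
    intro z hz
    by_contra hc
    simp only [not_or, mem_compl_iff, not_not] at hc
    exact (hcon.subset ⟨hz, hc.2, hc.1⟩ : z ∈ (∅ : Set α))
  obtain ⟨z, -, hz1, hz2⟩ := hK (interior S) (closure S)ᶜ isOpen_interior isClosed_closure.isOpen_compl
    key ⟨x, hxK, (key x hxK).resolve_right fun h => h (subset_closure hxS)⟩
    ⟨y, hyK, (key y hyK).resolve_left fun h => hyS (interior_subset h)⟩
  exact hz2 (subset_closure (interior_subset hz1))

/-- A closed interval inside the image of a closed interval is the exact image of a closed
subinterval. -/
theorem exists_Icc_image_eq {h : unitInterval → unitInterval} {a b c d : unitInterval}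
    (hh : ContinuousOn h (Icc a b)) (hcd : c ≤ d) (hsub : Icc c d ⊆ h '' Icc a b) :
    ∃ u v, u ≤ v ∧ Icc u v ⊆ Icc a b ∧ h '' Icc u v = Icc c d := by
  obtain ⟨α₀, hα₀, hα₀c⟩ := hsub (left_mem_Icc.2 hcd)
  obtain ⟨β₀, hβ₀, hβ₀d⟩ := hsub (right_mem_Icc.2 hcd)
  have hcl : ∀ e : unitInterval, IsCompact (Icc a b ∩ h ⁻¹' {e}) := fun e =>
    (hh.preimage_isClosed_of_isClosed isClosed_Icc isClosed_singleton).isCompact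
  -- Choose preimages of `c` and `d` at minimal distance: a value outside `Icc c d` taken between
  -- them would, by the intermediate value theorem, produce a closer pair.
  obtain ⟨⟨α, β⟩, ⟨hα, hβ⟩, hmin⟩ := ((hcl c).prod (hcl d)).exists_isMinOn
    ⟨(α₀, β₀), ⟨hα₀, hα₀c⟩, ⟨hβ₀, hβ₀d⟩⟩
    (f := fun p => dist p.1 p.2) continuous_dist.continuousOn
  obtain ⟨hαI, hαc⟩ := hα
  obtain ⟨hβI, hβd⟩ := hβ
  simp only [mem_preimage, mem_singleton_iff] at hαc hβd
  have hm : ∀ x ∈ Icc a b, ∀ y ∈ Icc a b, h x = c → h y = d → dist α β ≤ dist x y := by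
    intro x hx y hy hxc hyd
    exact hmin (a := (x, y)) ⟨⟨hx, hxc⟩, ⟨hy, hyd⟩⟩
  have hdist : ∀ x y : unitInterval, x ≤ y → dist x y = (y : ℝ) - x := by
    intro x y hxy
    rw [Subtype.dist_eq, Real.dist_eq, abs_sub_comm, abs_of_nonneg (sub_nonneg.2 (show (x : ℝ) ≤ y from hxy))]
  have lt_coe : ∀ {x y : unitInterval}, x < y → (x : ℝ) < y := fun h => h
  rcases le_total α β with hab | hab
  · have hs : Icc α β ⊆ Icc a b := Icc_subset_Icc hαI.1 hβI.2
    refine ⟨α, β, hab, hs, Subset.antisymm ?_ ?_⟩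
    · rintro _ ⟨t, ht, rfl⟩
      by_contra hcon
      rw [mem_Icc, not_and_or, not_le, not_le] at hcon
      rcases hcon with hlt | hlt
      · have ht' : α < t := lt_of_le_of_ne ht.1 (by rintro rfl; exact hlt.ne hαc)
        obtain ⟨s, hs', hsc⟩ := intermediate_value_Icc ht.2
          (hh.mono ((Icc_subset_Icc_left ht.1).trans hs)) (show c ∈ Icc (h t) (h β) from
            ⟨hlt.le, hβd ▸ hcd⟩)
        have := hm s (hs ⟨ht.1.trans hs'.1, hs'.2⟩) β hβI hsc hβd
        rw [hdist _ _ hab, hdist _ _ hs'.2] at this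
        have := lt_coe (ht'.trans_le hs'.1)
        linarith
      · have ht' : t < β := lt_of_le_of_ne ht.2 (by rintro rfl; exact hlt.ne hβd.symm)
        obtain ⟨s, hs', hsc⟩ := intermediate_value_Icc ht.1
          (hh.mono ((Icc_subset_Icc_right ht.2).trans hs)) (show d ∈ Icc (h α) (h t) from
            ⟨hαc ▸ hcd, hlt.le⟩)
        have := hm α hαI s (hs ⟨hs'.1, hs'.2.trans ht.2⟩) hαc hsc
        rw [hdist _ _ hab, hdist _ _ hs'.1] at this
        have := lt_coe (hs'.2.trans_lt ht')
        linarith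
    · have := intermediate_value_Icc hab (hh.mono hs)
      rwa [hαc, hβd] at this
  · have hs : Icc β α ⊆ Icc a b := Icc_subset_Icc hβI.1 hαI.2
    refine ⟨β, α, hab, hs, Subset.antisymm ?_ ?_⟩
    · rintro _ ⟨t, ht, rfl⟩
      by_contra hcon
      rw [mem_Icc, not_and_or, not_le, not_le] at hcon
      rcases hcon with hlt | hlt
      · have ht' : t < α := lt_of_le_of_ne ht.2 (by rintro rfl; exact hlt.ne hαc)
        obtain ⟨s, hs', hsc⟩ := intermediate_value_Icc' ht.1
          (hh.mono ((Icc_subset_Icc_right ht.2).trans hs)) (show c ∈ Icc (h t) (h β) from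
            ⟨hlt.le, hβd ▸ hcd⟩)
        have := hm s (hs ⟨hs'.1, hs'.2.trans ht.2⟩) β hβI hsc hβd
        rw [dist_comm, hdist _ _ hab, dist_comm, hdist _ _ hs'.1] at this
        have := lt_coe (hs'.2.trans_lt ht')
        linarith
      · have ht' : β < t := lt_of_le_of_ne ht.1 (by rintro rfl; exact hlt.ne hβd.symm)
        obtain ⟨s, hs', hsc⟩ := intermediate_value_Icc' ht.2
          (hh.mono ((Icc_subset_Icc_left ht.1).trans hs)) (show d ∈ Icc (h α) (h t) from
            ⟨hαc ▸ hcd, hlt.le⟩)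
        have := hm α hαI s (hs ⟨ht.1.trans hs'.1, hs'.2⟩) hαc hsc
        rw [dist_comm, hdist _ _ hab, dist_comm, hdist _ _ hs'.2] at this
        have := lt_coe (ht'.trans_le hs'.1)
        linarith
    · have := intermediate_value_Icc' hab (hh.mono hs)
      rwa [hαc, hβd] at this

/-- A neighbourhood of a point of a non-degenerate interval contains a non-degenerate
subinterval which is a neighbourhood of the point relative to the interval. -/
theorem exists_Icc_subset_of_mem_nhds {a b x : unitInterval} (hab : a < b) (hx : x ∈ Icc a b)
    {U : Set unitInterval} (hU : U ∈ 𝓝 x) :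
    ∃ u v, u < v ∧ x ∈ Icc u v ∧ Icc u v ⊆ Icc a b ∩ U ∧ (a < u → u < x) ∧ (v < b → x < v) := by
  have hl : ∃ u, a ≤ u ∧ u ≤ x ∧ Icc u x ⊆ U ∧ (a < x → u < x) := by
    rcases hx.1.eq_or_lt with rfl | h
    · exact ⟨a, le_rfl, le_rfl, by simpa using mem_of_mem_nhds hU, fun h => absurd h (lt_irrefl _)⟩
    · obtain ⟨l, hl, hlU⟩ := exists_Ioc_subset_of_mem_nhds' hU h
      obtain ⟨u, hu1, hu2⟩ := exists_between hl.2
      exact ⟨u, hl.1.trans hu1.le, hu2.le, fun t ht => hlU ⟨hu1.trans_le ht.1, ht.2⟩, fun _ => hu2⟩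
  have hr : ∃ v, v ≤ b ∧ x ≤ v ∧ Icc x v ⊆ U ∧ (x < b → x < v) := by
    rcases hx.2.eq_or_lt with rfl | h
    · exact ⟨x, le_rfl, le_rfl, by simpa using mem_of_mem_nhds hU, fun h => absurd h (lt_irrefl _)⟩
    · obtain ⟨l, hl, hlU⟩ := exists_Ico_subset_of_mem_nhds' hU h
      obtain ⟨u, hu1, hu2⟩ := exists_between hl.1
      exact ⟨u, hu2.le.trans hl.2, hu1.le, fun t ht => hlU ⟨ht.1, ht.2.trans_lt hu2⟩, fun _ => hu1⟩
  obtain ⟨u, hu1, hu2, hu3, hu4⟩ := hl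
  obtain ⟨v, hv1, hv2, hv3, hv4⟩ := hr
  refine ⟨u, v, ?_, ⟨hu2, hv2⟩, ?_, fun h => hu4 (h.trans_le hu2), fun h => hv4 (hv2.trans_lt h)⟩
  · rcases hx.1.eq_or_lt with rfl | h
    · exact hu2.trans_lt (hv4 hab)
    · exact (hu4 h).trans_le hv2
  · intro t ht
    refine ⟨⟨hu1.trans ht.1, ht.2.trans hv1⟩, ?_⟩
    rcases le_total t x with h | h
    · exact hu3 ⟨ht.1, h⟩
    · exact hv3 ⟨h, ht.2⟩

/-! ### Orbits of sets and of connected sets. -/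

theorem iterate_image_comp {X : Type*} (f : X → X) (i j : ℕ) (A : Set X) :
    f^[i] '' (f^[j] '' A) = f^[i + j] '' A := by
  rw [← image_comp, ← Function.iterate_add]


theorem mem_orb {X : Type*} {f : X → X} {A : Set X} {x : X} :
    x ∈ orb f A ↔ ∃ i, ∃ a ∈ A, f^[i] a = x := by
  simp [orb]

theorem orb_mono {X : Type*} {f : X → X} {A A' : Set X} (h : A ⊆ A') : orb f A ⊆ orb f A' :=
  iUnion_mono fun _ => image_mono h

theorem subset_orb {X : Type*} {f : X → X} {A : Set X} : A ⊆ orb f A :=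
  fun x hx => mem_orb.2 ⟨0, x, hx, rfl⟩

theorem image_iterate_subset_orb {X : Type*} {f : X → X} {A : Set X} (i : ℕ) :
    f^[i] '' A ⊆ orb f A :=
  subset_iUnion (fun i => f^[i] '' A) i

theorem orb_subset {X : Type*} {f : X → X} {A C : Set X} (h : A ⊆ C) (hC : MapsTo f C C) :
    orb f A ⊆ C := by
  refine iUnion_subset fun i => ?_
  rintro _ ⟨a, ha, rfl⟩
  exact hC.iterate i (h ha)

theorem mapsTo_orb {X : Type*} {f : X → X} {A : Set X} : MapsTo f (orb f A) (orb f A) := by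
  intro x hx
  obtain ⟨i, a, ha, rfl⟩ := mem_orb.1 hx
  exact mem_orb.2 ⟨i + 1, a, ha, Function.iterate_succ_apply' _ _ _⟩

theorem orb_image_iterate_subset {X : Type*} {f : X → X} {A : Set X} (i : ℕ) :
    orb f (f^[i] '' A) ⊆ orb f A :=
  orb_subset (image_iterate_subset_orb i) mapsTo_orb

theorem orb_union {X : Type*} {f : X → X} {A A' : Set X} :
    orb f (A ∪ A') = orb f A ∪ orb f A' := by
  simp only [orb, image_union, iUnion_union_distrib]

theorem mapsTo_closure_orb {X : Type*} [TopologicalSpace X] {f : X → X} (hf : Continuous f)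
    {A : Set X} : MapsTo f (closure (orb f A)) (closure (orb f A)) :=
  mapsTo_orb.closure hf

/-- The orbit of `K` is dense in `M`. -/
def DenseOrb {X : Type*} [TopologicalSpace X] (f : X → X) (M K : Set X) : Prop :=
  M ⊆ closure (orb f K)

theorem DenseOrb.mono {X : Type*} [TopologicalSpace X] {f : X → X} {M K K' : Set X}
    (h : DenseOrb f M K) (hK : K ⊆ K') : DenseOrb f M K' :=
  h.trans (closure_mono (orb_mono hK))

theorem DenseOrb.of_image_iterate {X : Type*} [TopologicalSpace X] {f : X → X} {M K : Set X}
    (i : ℕ) (h : DenseOrb f M (f^[i] '' K)) : DenseOrb f M K :=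
  h.trans (closure_mono (orb_image_iterate_subset i))

/-- If two iterates of a connected set meet, then its orbit is a finite union of intervals, hence
has finite frontier. -/
theorem frontier_orb_finite {f : unitInterval → unitInterval} (hf : Continuous f)
    {K : Set unitInterval} (hK : IsPreconnected K) {i j : ℕ} (hij : i < j)
    (hne : (f^[i] '' K ∩ f^[j] '' K).Nonempty) : (frontier (orb f K)).Finite := by
  obtain ⟨m, hm, rfl⟩ : ∃ m, 0 < m ∧ j = m + i := ⟨j - i, by omega, by omega⟩
  have hpre : ∀ r, IsPreconnected (f^[r] '' K) := fun r =>
    hK.image _ (hf.iterate r).continuousOn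
  -- Iterates of `K` whose indices are at least `i` and differ by `m` form a chain of meeting
  -- connected sets. The orbit is the union of the first `i` iterates and of these `m` connected
  -- chains.
  set W : ℕ → Set unitInterval := fun r => ⋃ s : ℕ, f^[r + s * m + i] '' K with hW
  have hWpre : ∀ r, IsPreconnected (W r) := by
    intro r
    refine IsPreconnected.iUnion_of_chain (fun s => hpre _) fun s => ?_
    obtain ⟨_, ⟨x, hx, rfl⟩, ⟨y, hy, hyx⟩⟩ := hne
    refine ⟨f^[r + s * m + i] x, ⟨x, hx, rfl⟩, ⟨y, hy, ?_⟩⟩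
    rw [Order.succ_eq_add_one, show r + (s + 1) * m + i = (r + s * m) + (m + i) by ring,
      Function.iterate_add_apply, hyx, ← Function.iterate_add_apply]
  set F : Set (Set unitInterval) := (fun r => f^[r] '' K) '' Iio i ∪ W '' Iio m with hFdef
  have hF : F.Finite := ((finite_Iio i).image _).union ((finite_Iio m).image _)
  have horb : orb f K = ⋃₀ F := by
    apply Subset.antisymm
    · refine iUnion_subset fun r => ?_
      rcases lt_or_ge r i with h | h
      · exact subset_sUnion_of_mem (Or.inl ⟨r, h, rfl⟩)
      · refine Subset.trans ?_ (subset_sUnion_of_mem (Or.inr ⟨(r - i) % m, Nat.mod_lt _ hm, rfl⟩))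
        have : r = (r - i) % m + (r - i) / m * m + i := by
          have := Nat.mod_add_div' (r - i) m
          omega
        conv_lhs => rw [this]
        exact subset_iUnion (fun s => f^[(r - i) % m + s * m + i] '' K) ((r - i) / m)
    · refine sUnion_subset ?_
      rintro _ (⟨r, -, rfl⟩ | ⟨r, -, rfl⟩)
      · exact image_iterate_subset_orb r
      · exact iUnion_subset fun s => image_iterate_subset_orb _
  rw [horb]
  refine frontier_sUnion_finite hF ?_
  rintro _ (⟨r, -, rfl⟩ | ⟨r, -, rfl⟩)
  · exact (hpre r).ordConnected
  · exact (hWpre r).ordConnected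

/-! ### Intervals with dense orbit under bisection. -/

/-- The properties of the orbit `M` of a periodic interval and of its infinite basic set `B` that
govern the dynamics of `f` on `B`. -/
structure IntervalCycle (f : unitInterval → unitInterval) (M B : Set unitInterval) : Prop where
  cont : Continuous f
  closed : IsClosed M
  image_eq : f '' M = M
  loc : ∀ x ∈ M, ∃ a b, a < b ∧ x ∈ Icc a b ∧ Icc a b ⊆ M ∧ Icc a b ∈ 𝓝[M] x
  lift : ∀ c d, c ≤ d → Icc c d ⊆ M → ∃ u v, u ≤ v ∧ Icc u v ⊆ M ∧ f '' Icc u v = Icc c d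
  eq_basicSet : B = basicSet f M
  infinite : B.Infinite

namespace IntervalCycle

variable {f : unitInterval → unitInterval} {M B : Set unitInterval}

theorem mapsTo (h : IntervalCycle f M B) : MapsTo f M M := by
  intro x hx
  rw [← h.image_eq]
  exact mem_image_of_mem f hx

theorem subset (h : IntervalCycle f M B) : B ⊆ M := by
  rw [h.eq_basicSet]
  exact fun x hx => hx.1

theorem iterate_image_eq (h : IntervalCycle f M B) (i : ℕ) : f^[i] '' M = M := by
  induction i with
  | zero => simp
  | succ i ih => rw [Function.iterate_succ, image_comp, h.image_eq, ih]

theorem denseOrb_of_mem_nhdsWithin (h : IntervalCycle f M B) {x : unitInterval} (hx : x ∈ B)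
    {K : Set unitInterval} (hK : K ∈ 𝓝[M] x) : DenseOrb f M K := by
  rw [h.eq_basicSet] at hx
  obtain ⟨U, hU, hUK⟩ := mem_nhdsWithin_iff_exists_mem_nhds_inter.1 hK
  have := hx.2 U hU
  exact this.symm.subset.trans (closure_mono (orb_mono hUK))

theorem mem_of_forall_denseOrb (h : IntervalCycle f M B) {x : unitInterval} (hx : x ∈ M)
    (hU : ∀ U ∈ 𝓝 x, DenseOrb f M (U ∩ M)) : x ∈ B := by
  rw [h.eq_basicSet]
  refine ⟨hx, fun U hUx => Subset.antisymm ?_ (hU U hUx)⟩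
  exact closure_minimal (orb_subset inter_subset_right h.mapsTo) h.closed

theorem notMem_nhdsWithin (h : IntervalCycle f M B) {A : Set unitInterval} (hA : IsClosed A)
    (hfA : MapsTo f A A) (hMA : ¬ M ⊆ A) {x : unitInterval} (hx : x ∈ B) : A ∉ 𝓝[M] x := by
  intro hmem
  apply hMA
  exact (h.denseOrb_of_mem_nhdsWithin hx hmem).trans
    (closure_minimal (orb_subset Subset.rfl hfA) hA)

theorem exists_iterate_inter (h : IntervalCycle f M B) {K V : Set unitInterval}
    (hK : DenseOrb f M K) (hV : IsOpen V) (hVM : (V ∩ M).Nonempty) (N : ℕ) :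
    ∃ i ≥ N, (f^[i] '' K ∩ V).Nonempty := by
  obtain ⟨y, hyV, hyM⟩ := hVM
  -- Pulling the target point back `N` steps inside `M` forces the hitting time to be at least `N`.
  rw [← h.iterate_image_eq N] at hyM
  obtain ⟨x, hxM, rfl⟩ := hyM
  have := mem_closure_iff.1 (hK hxM) _ (hV.preimage (h.cont.iterate N)) hyV
  obtain ⟨z, hzV, hz⟩ := this
  obtain ⟨i, a, ha, rfl⟩ := mem_orb.1 hz
  refine ⟨N + i, by omega, f^[N + i] a, mem_image_of_mem _ ha, ?_⟩
  rw [Function.iterate_add_apply]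
  exact hzV

theorem isPreconnected_iterate (h : IntervalCycle f M B) {K : Set unitInterval}
    (hK : IsPreconnected K) (i : ℕ) : IsPreconnected (f^[i] '' K) :=
  hK.image _ (h.cont.iterate i).continuousOn

/-- Density makes an iterate of `K` return to the interior of `K`, so the orbit has finite frontier;
what it misses of `M` lies in that frontier. -/
theorem diff_orb_finite (h : IntervalCycle f M B) {K : Set unitInterval} (hKM : K ⊆ M)
    (hK : IsPreconnected K) (hint : (interior K).Nonempty) (hd : DenseOrb f M K) :
    (M \ orb f K).Finite := by
  obtain ⟨x, hx⟩ := hint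
  obtain ⟨i, hi, y, hy, hyK⟩ := h.exists_iterate_inter hd isOpen_interior
    ⟨x, hx, hKM (interior_subset hx)⟩ 1
  have := frontier_orb_finite h.cont hK (i := 0) (j := i) hi
    ⟨y, by simpa using interior_subset hyK, hy⟩
  refine this.subset fun z hz => ⟨hd hz.1, fun hz' => hz.2 (interior_subset hz')⟩

/-- If two sets have orbits which are not dense but jointly dense, the first being connected with
two meeting iterates, then the basic set is finite. -/
theorem not_return_of_union (h : IntervalCycle f M B) {K K' : Set unitInterval}
    (hK : IsPreconnected K) (hd : DenseOrb f M (K ∪ K')) (h1 : ¬ DenseOrb f M K)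
    (h2 : ¬ DenseOrb f M K') {i j : ℕ} (hij : i < j) :
    Disjoint (f^[i] '' K) (f^[j] '' K) := by
  rw [disjoint_iff_inter_eq_empty, ← not_nonempty_iff_eq_empty]
  intro hne
  -- A point of `B` outside the closure of the orbit of `K` is relatively interior to the closure of
  -- the orbit of `K'`. Either this or a point of `B` interior to the orbit of `K` would make one of
  -- the two orbits dense. So `B` lies in the finite frontier.
  refine h.infinite ((frontier_orb_finite h.cont hK hij hne).subset ?_)
  intro b hb
  rw [DenseOrb, orb_union, closure_union] at hd
  refine ⟨?_, fun hint => ?_⟩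
  · by_contra hbc
    refine h.notMem_nhdsWithin isClosed_closure (mapsTo_closure_orb h.cont) h2 hb ?_
    rw [mem_nhdsWithin]
    refine ⟨_, isClosed_closure.isOpen_compl, hbc, ?_⟩
    rintro z ⟨hz, hzM⟩
    exact (hd hzM).resolve_left hz
  · refine h.notMem_nhdsWithin isClosed_closure (mapsTo_closure_orb h.cont) h1 hb ?_
    exact mem_nhdsWithin_of_mem_nhds
      (mem_of_superset (isOpen_interior.mem_nhds hint) (interior_subset.trans subset_closure))

/-- Iterates of `K` never return to `K`, so the iterates entering its interior at arbitrarily late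
times are those of `K'`. Each of them not contained in `K` meets the frontier of `K`. That frontier
is finite, so two iterates of `K'` would share a point, against `not_return_of_union`. -/
theorem exists_iterate_subset_of_union (h : IntervalCycle f M B) {K K' : Set unitInterval}
    (hKM : K ⊆ M) (hK : IsPreconnected K) (hK' : IsPreconnected K')
    (hint : (interior K).Nonempty) (hd : DenseOrb f M (K ∪ K')) (h1 : ¬ DenseOrb f M K)
    (h2 : ¬ DenseOrb f M K') : ∃ j ≥ 1, f^[j] '' K' ⊆ K := by
  by_contra! hcon
  obtain ⟨x, hx⟩ := hint
  have hmeet : ∀ N, ∃ j ≥ N, 1 ≤ j ∧ (f^[j] '' K' ∩ frontier K).Nonempty := by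
    intro N
    obtain ⟨j, hj, y, hy, hyK⟩ := h.exists_iterate_inter hd isOpen_interior
      ⟨x, hx, hKM (interior_subset hx)⟩ (N + 1)
    have hyK' : y ∈ f^[j] '' K' := by
      rw [image_union] at hy
      refine hy.resolve_left fun hyj => ?_
      exact (h.not_return_of_union hK hd h1 h2 (i := 0) (j := j) (by omega)).le_bot
        ⟨by simpa using interior_subset hyK, hyj⟩
    exact ⟨j, by omega, by omega, inter_frontier_nonempty (h.isPreconnected_iterate hK' j)
      ⟨y, hyK', interior_subset hyK⟩ (hcon j (by omega))⟩
  have hinf : {j | (f^[j] '' K' ∩ frontier K).Nonempty}.Infinite := by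
    rw [Set.infinite_iff_exists_gt]
    intro N
    obtain ⟨j, hj, -, hj'⟩ := hmeet (N + 1)
    exact ⟨j, hj', by omega⟩
  choose! p hp using fun j (hj : (f^[j] '' K' ∩ frontier K).Nonempty) => hj
  obtain ⟨i, hi, j, hj, hij, heq⟩ := hinf.exists_ne_map_eq_of_mapsTo
    (f := p) (t := frontier K) (fun j hj => (hp j hj).2) (frontier_finite_of_ordConnected
      hK.ordConnected)
  have hd' : DenseOrb f M (K' ∪ K) := by rwa [union_comm]
  rcases lt_or_gt_of_ne hij with hlt | hlt
  · exact (h.not_return_of_union hK' hd' h2 h1 hlt).le_bot ⟨(hp i hi).1, heq ▸ (hp j hj).1⟩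
  · exact (h.not_return_of_union hK' hd' h2 h1 hlt).le_bot ⟨(hp j hj).1, heq ▸ (hp i hi).1⟩

/-- If the union of two intervals has a dense orbit, then so has one of them. -/
theorem denseOrb_or_of_union (h : IntervalCycle f M B) {K K' : Set unitInterval}
    (hKM : K ⊆ M) (hKM' : K' ⊆ M) (hK : IsPreconnected K) (hK' : IsPreconnected K')
    (hint : (interior K).Nonempty) (hint' : (interior K').Nonempty)
    (hd : DenseOrb f M (K ∪ K')) : DenseOrb f M K ∨ DenseOrb f M K' := by
  by_contra! hcon
  obtain ⟨h1, h2⟩ := hcon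
  obtain ⟨j, hj, hjK⟩ := h.exists_iterate_subset_of_union hKM hK hK' hint hd h1 h2
  obtain ⟨m, hm, hmK⟩ := h.exists_iterate_subset_of_union hKM' hK' hK hint'
    (by rwa [union_comm]) h2 h1
  -- Going from `K` into `K'` and back into `K` is a return of `K`, which is excluded.
  have hsub : f^[j + m] '' K ⊆ K := by
    rw [← iterate_image_comp]
    exact (image_mono hmK).trans hjK
  obtain ⟨x, hx⟩ := hint
  have hxK := interior_subset hx
  exact (h.not_return_of_union hK hd h1 h2 (i := 0) (j := j + m) (by omega)).le_bot
    ⟨by simpa using hsub (mem_image_of_mem _ hxK), mem_image_of_mem _ hxK⟩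

theorem denseOrb_Icc_split (h : IntervalCycle f M B) {a b c : unitInterval} (hab : a ≤ b)
    (hbc : b ≤ c) (hac : a < c) (hM : Icc a c ⊆ M) (hd : DenseOrb f M (Icc a c)) :
    (a < b ∧ DenseOrb f M (Icc a b)) ∨ (b < c ∧ DenseOrb f M (Icc b c)) := by
  rcases hab.eq_or_lt with rfl | hab
  · exact Or.inr ⟨hac, hd⟩
  rcases hbc.eq_or_lt with rfl | hbc
  · exact Or.inl ⟨hac, hd⟩
  have hint : ∀ {u v : unitInterval}, u < v → (interior (Icc u v)).Nonempty := by
    intro u v huv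
    obtain ⟨w, hw⟩ := exists_between huv
    exact ⟨w, mem_interior.2 ⟨Ioo u v, Ioo_subset_Icc_self, isOpen_Ioo, hw⟩⟩
  rw [← Icc_union_Icc_eq_Icc hab.le hbc.le] at hd
  rcases h.denseOrb_or_of_union ((Icc_subset_Icc_right hbc.le).trans hM)
    ((Icc_subset_Icc_left hab.le).trans hM) isPreconnected_Icc isPreconnected_Icc
    (hint hab) (hint hbc) hd with h' | h'
  · exact Or.inl ⟨hab, h'⟩
  · exact Or.inr ⟨hbc, h'⟩

end IntervalCycle

theorem interior_Icc_nonempty {a b : unitInterval} (hab : a < b) :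
    (interior (Icc a b)).Nonempty := by
  obtain ⟨w, hw⟩ := exists_between hab
  exact ⟨w, mem_interior.2 ⟨Ioo a b, Ioo_subset_Icc_self, isOpen_Ioo, hw⟩⟩

/-! ### Points of the basic set in an interval with dense orbit. -/

namespace IntervalCycle

variable {f : unitInterval → unitInterval} {M B : Set unitInterval}

/-- An interval with dense orbit contains a point of the basic set. -/
theorem inter_Icc_nonempty (h : IntervalCycle f M B) {a b : unitInterval} (hab : a < b)
    (hM : Icc a b ⊆ M) (hd : DenseOrb f M (Icc a b)) : (B ∩ Icc a b).Nonempty := by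
  by_contra hcon
  have hloc : ∀ x ∈ Icc a b, ∃ U, IsOpen U ∧ x ∈ U ∧ ¬ DenseOrb f M (U ∩ M) := by
    intro x hx
    by_contra! hU
    refine hcon ⟨x, h.mem_of_forall_denseOrb (hM hx) fun U hUx => ?_, hx⟩
    obtain ⟨V, hVU, hV, hxV⟩ := mem_nhds_iff.1 hUx
    exact (hU V hV hxV).mono (inter_subset_inter_left _ hVU)
  -- The complement of `Icc a b` is admitted as a member so that the whole unit interval is covered.
  let ι := {U : Set unitInterval // IsOpen U ∧ (U = (Icc a b)ᶜ ∨ ¬ DenseOrb f M (U ∩ M))}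
  obtain ⟨t, ht0, htm, ⟨N, hN⟩, ht⟩ := exists_monotone_Icc_subset_open_cover_unitInterval
    (c := fun U : ι => U.1) (fun U => U.2.1) (by
      intro x _
      by_cases hx : x ∈ Icc a b
      · obtain ⟨U, hU, hxU, hUd⟩ := hloc x hx
        exact mem_iUnion.2 ⟨⟨U, hU, Or.inr hUd⟩, hxU⟩
      · exact mem_iUnion.2 ⟨⟨_, isClosed_Icc.isOpen_compl, Or.inl rfl⟩, hx⟩)
  -- The subdivision `t` of the unit interval is clamped to `Icc a b`. By bisection, density of the
  -- orbit would descend to a single cell, which lies in one member of the cover.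
  set s : ℕ → unitInterval := fun k => max a (min b (t k)) with hs
  have hsa : ∀ k, a ≤ s k := fun k => le_max_left _ _
  have hsb : ∀ k, s k ≤ b := fun k => max_le hab.le (min_le_left _ _)
  have hsm : ∀ k, s k ≤ s (k + 1) := fun k =>
    max_le_max le_rfl (min_le_min le_rfl (htm (Nat.le_succ k)))
  have key : ∀ k, ¬ (a < s k ∧ DenseOrb f M (Icc a (s k))) := by
    intro k
    induction k with
    | zero =>
      rintro ⟨h0, -⟩
      have h1 : s 0 ≤ a := max_le le_rfl ((min_le_right _ _).trans (ht0.trans_le unitInterval.nonneg'))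
      exact h0.not_ge h1
    | succ k ih =>
      rintro ⟨h0, hd'⟩
      rcases h.denseOrb_Icc_split (hsa k) (hsm k) h0 ((Icc_subset_Icc_right (hsb _)).trans hM) hd'
        with h1 | ⟨hlt, hdk⟩
      · exact ih h1
      · obtain ⟨⟨U, hUo, hU⟩, hUs⟩ := ht k
        have h1 : t k ≤ s k := by
          by_contra hc
          rw [not_le] at hc
          have : b < t k := by
            by_contra hb
            rw [not_lt] at hb
            exact hc.not_ge (le_max_of_le_right (le_min hb le_rfl))
          have : s k = b := by simp [hs, this.le, hab.le]
          exact (hsb (k + 1)).not_gt (this ▸ hlt)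
        have h2 : s (k + 1) ≤ t (k + 1) := by
          have : s (k + 1) = min b (t (k + 1)) :=
            max_eq_right (by
              by_contra hc
              rw [not_le] at hc
              exact h0.ne' (max_eq_left hc.le))
          exact this.trans_le (min_le_right _ _)
        have hsub : Icc (s k) (s (k + 1)) ⊆ U := (Icc_subset_Icc h1 h2).trans hUs
        rcases hU with rfl | hU
        · exact hsub (left_mem_Icc.2 hlt.le) ⟨hsa k, hsb k⟩
        · exact hU (hdk.mono (subset_inter hsub ((Icc_subset_Icc (hsa k) (hsb _)).trans hM)))
  refine key N ?_
  have : s N = b := by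
    have : t N = 1 := hN N le_rfl
    simp [hs, this, unitInterval.le_one', hab.le]
  rw [this]
  exact ⟨hab, hd⟩

theorem denseOrb_image (h : IntervalCycle f M B) {K : Set unitInterval} (hd : DenseOrb f M K) :
    DenseOrb f M (f '' K) := by
  have h1 : M ⊆ f '' closure (orb f K) := h.image_eq ▸ image_mono hd
  refine h1.trans ((image_closure_subset_closure_image h.cont).trans (closure_mono ?_))
  rintro _ ⟨x, hx, rfl⟩
  obtain ⟨i, a, ha, rfl⟩ := mem_orb.1 hx
  refine mem_orb.2 ⟨i, f a, mem_image_of_mem _ ha, ?_⟩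
  rw [← Function.iterate_succ_apply, Function.iterate_succ_apply']

theorem mapsTo_basic (h : IntervalCycle f M B) : MapsTo f B B := by
  intro x hx
  refine h.mem_of_forall_denseOrb (h.mapsTo (h.subset hx)) fun U hU => ?_
  have : f ⁻¹' U ∩ M ∈ 𝓝[M] x :=
    inter_mem (mem_nhdsWithin_of_mem_nhds (h.cont.continuousAt hU)) self_mem_nhdsWithin
  refine (h.denseOrb_image (h.denseOrb_of_mem_nhdsWithin hx this)).mono ?_
  rintro _ ⟨y, ⟨hyU, hyM⟩, rfl⟩
  exact ⟨hyU, h.mapsTo hyM⟩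

/-- A subinterval with dense orbit must contain `x`, the only point of `B` available. So bisection
discards the two end pieces, which miss `x`, and keeps the middle one. -/
theorem exists_small_of_inter_eq_singleton (h : IntervalCycle f M B) {a b x : unitInterval}
    (hab : a < b) (hM : Icc a b ⊆ M) (hd : DenseOrb f M (Icc a b)) (hx : B ∩ Icc a b = {x})
    {N : Set unitInterval} (hN : N ∈ 𝓝 x) :
    ∃ u v, u < v ∧ x ∈ Icc u v ∧ Icc u v ⊆ Icc a b ∩ N ∧ DenseOrb f M (Icc u v) := by
  have hxm : x ∈ B ∩ Icc a b := hx ▸ mem_singleton x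
  obtain ⟨u, v, huv, hxuv, hsub, hu, hv⟩ := exists_Icc_subset_of_mem_nhds hab hxm.2 hN
  have hau : a ≤ u := (hsub (left_mem_Icc.2 huv.le)).1.1
  have hvb : v ≤ b := (hsub (right_mem_Icc.2 huv.le)).1.2
  have huniq : ∀ {c d : unitInterval}, c < d → Icc c d ⊆ Icc a b → DenseOrb f M (Icc c d) →
      x ∈ Icc c d := by
    intro c d hcd hs hdc
    obtain ⟨y, hyB, hy⟩ := h.inter_Icc_nonempty hcd (hs.trans hM) hdc
    have : y ∈ B ∩ Icc a b := ⟨hyB, hs hy⟩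
    rw [hx, mem_singleton_iff] at this
    exact this ▸ hy
  refine ⟨u, v, huv, hxuv, hsub, ?_⟩
  have h1 : u < b ∧ DenseOrb f M (Icc u b) := by
    rcases h.denseOrb_Icc_split hau (huv.le.trans hvb) hab hM hd with ⟨h1, h2⟩ | h1
    · exact absurd (huniq h1 (Icc_subset_Icc_right (huv.le.trans hvb)) h2).2 (hu h1).not_ge
    · exact h1
  rcases h.denseOrb_Icc_split huv.le hvb h1.1 ((Icc_subset_Icc_left hau).trans hM) h1.2 with
    ⟨-, h2⟩ | ⟨h2, h3⟩
  · exact h2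
  · exact absurd (huniq h2 (Icc_subset_Icc_left (hau.trans huv.le)) h3).1 (hv h2).not_ge

/-- If `x` is the only point of the basic set in an interval with dense orbit, then the image of
`x` is the only point of the basic set interior to an iterate of this interval. -/
theorem eq_iterate_of_strict_between (h : IntervalCycle f M B) {a b x : unitInterval}
    (hM : Icc a b ⊆ M) (hx : B ∩ Icc a b = {x}) {i : ℕ} {s z t : unitInterval}
    (hs : s ∈ f^[i] '' Icc a b) (ht : t ∈ f^[i] '' Icc a b) (hz : z ∈ B) (hsz : s < z)
    (hzt : z < t) : z = f^[i] x := by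
  by_contra hne
  obtain ⟨c, d, hcd, hzcd, hsub, hc, hd⟩ := exists_Icc_subset_of_mem_nhds (hsz.trans hzt)
    ⟨hsz.le, hzt.le⟩ (isOpen_compl_singleton.mem_nhds hne : {f^[i] x}ᶜ ∈ 𝓝 z)
  have hsc : s ≤ c := (hsub (left_mem_Icc.2 hcd.le)).1.1
  have hdt : d ≤ t := (hsub (right_mem_Icc.2 hcd.le)).1.2
  have hcz : c < z := by
    rcases hsc.eq_or_lt with rfl | h'
    · exact hsz
    · exact hc h'
  have hzd : z < d := by
    rcases hdt.eq_or_lt with rfl | h'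
    · exact hzt
    · exact hd h'
  have hdense : DenseOrb f M (Icc c d) :=
    h.denseOrb_of_mem_nhdsWithin hz (mem_nhdsWithin_of_mem_nhds (Icc_mem_nhds hcz hzd))
  have himg : Icc c d ⊆ f^[i] '' Icc a b :=
    (Icc_subset_Icc hsc hdt).trans
      ((h.isPreconnected_iterate isPreconnected_Icc i).ordConnected.out hs ht)
  -- The subinterval mapped exactly onto `Icc c d` inherits a dense orbit, hence contains a point of
  -- `B`, namely `x`. Then `f^[i] x` would lie in `Icc c d`, which was chosen to avoid it.
  obtain ⟨u, v, huv, huvab, heq⟩ := exists_Icc_image_eq (h.cont.iterate i).continuousOn hcd.le himg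
  have huv' : u < v := by
    refine lt_of_le_of_ne huv ?_
    rintro rfl
    rw [Icc_self, image_singleton] at heq
    have h1 : c ∈ ({f^[i] u} : Set unitInterval) := heq ▸ left_mem_Icc.2 hcd.le
    have h2 : d ∈ ({f^[i] u} : Set unitInterval) := heq ▸ right_mem_Icc.2 hcd.le
    rw [mem_singleton_iff] at h1 h2
    exact hcd.ne (h1.trans h2.symm)
  obtain ⟨y, hyB, hy⟩ := h.inter_Icc_nonempty huv' (huvab.trans hM)
    (DenseOrb.of_image_iterate i (heq ▸ hdense))
  have hyx : y ∈ B ∩ Icc a b := ⟨hyB, huvab hy⟩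
  rw [hx, mem_singleton_iff] at hyx
  subst hyx
  have : f^[i] y ∈ Icc c d := heq ▸ mem_image_of_mem _ hy
  exact (hsub this).2 rfl

/-- By `eq_iterate_of_strict_between`, an iterate of the interval has no point of `B` strictly
inside except possibly the iterate of `x`. As the orbit of the interval misses only finitely many
points of `M`, this contradicts either the return of tiny intervals around `x` (infinite orbit of
`x`) or the infinity of `B` (finite orbit). -/
theorem not_inter_eq_singleton (h : IntervalCycle f M B) {a b x : unitInterval}
    (hab : a < b) (hM : Icc a b ⊆ M) (hd : DenseOrb f M (Icc a b)) :
    B ∩ Icc a b ≠ {x} := by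
  intro hx
  have hxm : x ∈ B ∩ Icc a b := hx ▸ mem_singleton x
  have hxB : ∀ i, f^[i] x ∈ B := fun i => h.mapsTo_basic.iterate i hxm.1
  by_cases hinj : Function.Injective fun i => f^[i] x
  -- `F` collects the times at which the iterate of `x` is outside `Icc a b` but separated from one
  -- of its points by no point of `B`. On each side only the nearest iterate qualifies, so `F` has
  -- at most two elements.
  · set F : Set ℕ := {m | f^[m] x ∉ Icc a b ∧ ∃ s ∈ Icc a b, ∀ z ∈ B,
      ¬ (s < z ∧ z < f^[m] x) ∧ ¬ (f^[m] x < z ∧ z < s)} with hF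
    have hFfin : F.Finite := by
      have : F ⊆ {m ∈ F | b < f^[m] x} ∪ {m ∈ F | f^[m] x < a} := by
        intro m hm
        have := hm.1
        rw [mem_Icc, not_and_or, not_le, not_le] at this
        exact this.symm.imp (fun h => ⟨hm, h⟩) (fun h => ⟨hm, h⟩)
      refine (Set.Finite.union (Set.Subsingleton.finite ?_) (Set.Subsingleton.finite ?_)).subset this
      · have : ∀ m m', m ∈ F → m' ∈ F → b < f^[m] x → ¬ f^[m] x < f^[m'] x := by
          rintro m m' hm ⟨-, s', hs', hm'⟩ hb hlt
          exact (hm' _ (hxB m)).1 ⟨hs'.2.trans_lt hb, hlt⟩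
        intro m hm m' hm'
        exact hinj (le_antisymm (not_lt.1 (this _ _ hm'.1 hm.1 hm'.2))
          (not_lt.1 (this _ _ hm.1 hm'.1 hm.2)))
      · have : ∀ m m', m ∈ F → m' ∈ F → f^[m] x < a → ¬ f^[m'] x < f^[m] x := by
          rintro m m' hm ⟨-, s', hs', hm'⟩ hb hlt
          exact (hm' _ (hxB m)).2 ⟨hlt, hb.trans_le hs'.1⟩
        intro m hm m' hm'
        exact hinj (le_antisymm (not_lt.1 (this _ _ hm.1 hm'.1 hm.2))
          (not_lt.1 (this _ _ hm'.1 hm.1 hm'.2)))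
    -- An interval around `x` inside `N₀`, with dense orbit, must cover some point of `Icc a b \ N₀`
    -- at a time `m`. That time is forced into `F`, while the interval is also chosen so small that
    -- its images at times in `F` avoid `Icc a b`.
    obtain ⟨N₀, hN₀, hN₀inf⟩ : ∃ N₀ ∈ 𝓝 x, (Icc a b \ N₀).Infinite := by
      rcases hxm.2.2.lt_or_eq with hlt | rfl
      · obtain ⟨w, hw1, hw2⟩ := exists_between hlt
        refine ⟨Iio w, Iio_mem_nhds hw1, (Icc_infinite hw2).mono ?_⟩
        exact fun t ht => ⟨⟨(hxm.2.1.trans hw1.le).trans ht.1, ht.2⟩, not_lt.2 ht.1⟩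
      · obtain ⟨w, hw1, hw2⟩ := exists_between hab
        refine ⟨Ioi w, Ioi_mem_nhds hw2, (Icc_infinite hw1).mono ?_⟩
        exact fun t ht => ⟨⟨ht.1, ht.2.trans hw2.le⟩, not_lt.2 ht.2⟩
    have hN : N₀ ∩ ⋂ m ∈ F, {y | f^[m] y ∉ Icc a b} ∈ 𝓝 x := by
      refine inter_mem hN₀ ((biInter_mem hFfin).2 fun m hm => ?_)
      exact (isClosed_Icc.isOpen_compl.preimage (h.cont.iterate m)).mem_nhds hm.1
    obtain ⟨u, v, huv, hxuv, hsub, hduv⟩ := h.exists_small_of_inter_eq_singleton hab hM hd hx hN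
    have hfin := h.diff_orb_finite (K := Icc u v) (fun t ht => hM (hsub ht).1) isPreconnected_Icc
      (interior_Icc_nonempty huv) hduv
    obtain ⟨s, ⟨hsab, hsN⟩, hs⟩ := (hN₀inf.sdiff hfin).nonempty
    have hsorb : s ∈ orb f (Icc u v) := by
      by_contra hc
      exact hs ⟨hM hsab, hc⟩
    obtain ⟨m, t, ht, rfl⟩ := mem_orb.1 hsorb
    have hm0 : m ≠ 0 := by
      rintro rfl
      exact hsN (hsub ht).2.1
    have hxmI : f^[m] x ∉ Icc a b := by
      intro hc
      have : f^[m] x ∈ B ∩ Icc a b := ⟨hxB m, hc⟩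
      rw [hx, mem_singleton_iff] at this
      exact hm0 (hinj (a₁ := m) (a₂ := 0) this)
    have hmF : m ∈ F := by
      refine ⟨hxmI, _, hsab, fun z hz => ⟨?_, ?_⟩⟩
      · rintro ⟨h1, h2⟩
        exact h2.ne (h.eq_iterate_of_strict_between hM hx
          (mem_image_of_mem _ (hsub ht).1) (mem_image_of_mem _ hxm.2) hz h1 h2)
      · rintro ⟨h1, h2⟩
        exact h1.ne' (h.eq_iterate_of_strict_between hM hx
          (mem_image_of_mem _ hxm.2) (mem_image_of_mem _ (hsub ht).1) hz h1 h2)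
    exact mem_iInter₂.1 (hsub ht).2.2 m hmF hsab
  · have hR : (range fun i => f^[i] x).Finite := by
      obtain ⟨i, j, hij, hne⟩ : ∃ i j, f^[i] x = f^[j] x ∧ i ≠ j := by
        simpa [Function.Injective] using hinj
      wlog hlt : i < j generalizing i j
      · exact this j i hij.symm hne.symm (lt_of_le_of_ne (not_lt.1 hlt) hne.symm)
      refine ((finite_Iio j).image fun i => f^[i] x).subset ?_
      rintro _ ⟨k, rfl⟩
      induction k using Nat.strong_induction_on with
      | _ k ih =>
        rcases lt_or_ge k j with hk | hk
        · exact ⟨k, hk, rfl⟩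
        · have : f^[k] x = f^[k - (j - i)] x := by
            rw [show k = (k - j) + j by omega, Function.iterate_add_apply, ← hij,
              ← Function.iterate_add_apply]
            congr 2
            omega
          simp only [this]
          exact ih _ (by omega)
    have hfin := h.diff_orb_finite hM isPreconnected_Icc (interior_Icc_nonempty hab) hd
    -- Up to finitely many points, `B` is covered by the iterates of the interval, grouped by the
    -- point `y` of the finite orbit of `x` that they contain. Each group holds, besides `y`, at
    -- most one point of `B` on either side of `y`.
    refine h.infinite ((hfin.union (hR.biUnion (t := fun y =>
      B ∩ ⋃ i ∈ {i | f^[i] x = y}, f^[i] '' Icc a b) ?_)).subset ?_)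
    · intro y _
      set T := B ∩ ⋃ i ∈ {i | f^[i] x = y}, f^[i] '' Icc a b with hT
      have hbet : ∀ z ∈ T, ∀ z' ∈ B, z' ≠ y → ¬ (z < z' ∧ z' < y) ∧ ¬ (y < z' ∧ z' < z) := by
        rintro z ⟨hzB, hz⟩ z' hz' hne
        obtain ⟨i, hi, hzi⟩ := mem_iUnion₂.1 hz
        change f^[i] x = y at hi
        have hy : y ∈ f^[i] '' Icc a b := ⟨x, hxm.2, hi⟩
        refine ⟨fun hc => hne ?_, fun hc => hne ?_⟩
        · rw [h.eq_iterate_of_strict_between hM hx hzi hy hz' hc.1 hc.2, hi]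
        · rw [h.eq_iterate_of_strict_between hM hx hy hzi hz' hc.1 hc.2, hi]
      have : T ⊆ {y} ∪ ({z ∈ T | z < y} ∪ {z ∈ T | y < z}) := by
        intro z hz
        rcases lt_trichotomy z y with h1 | h1 | h1
        · exact Or.inr (Or.inl ⟨hz, h1⟩)
        · exact Or.inl h1
        · exact Or.inr (Or.inr ⟨hz, h1⟩)
      refine (Set.Finite.union (finite_singleton y) (Set.Finite.union
        (Set.Subsingleton.finite ?_) (Set.Subsingleton.finite ?_))).subset this
      · intro z hz z' hz'
        exact le_antisymm (not_lt.1 fun hlt => (hbet z' hz'.1 z hz.1.1 hz.2.ne).1 ⟨hlt, hz.2⟩)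
          (not_lt.1 fun hlt => (hbet z hz.1 z' hz'.1.1 hz'.2.ne).1 ⟨hlt, hz'.2⟩)
      · intro z hz z' hz'
        exact le_antisymm (not_lt.1 fun hlt => (hbet z hz.1 z' hz'.1.1 hz'.2.ne').2 ⟨hz'.2, hlt⟩)
          (not_lt.1 fun hlt => (hbet z' hz'.1 z hz.1.1 hz.2.ne').2 ⟨hz.2, hlt⟩)
    · intro z hz
      by_cases hzo : z ∈ orb f (Icc a b)
      · obtain ⟨i, t, ht, rfl⟩ := mem_orb.1 hzo
        exact Or.inr (mem_iUnion₂.2 ⟨f^[i] x, mem_range_self i, hz,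
          mem_iUnion₂.2 ⟨i, rfl, mem_image_of_mem _ ht⟩⟩)
      · exact Or.inl ⟨h.subset hz, hzo⟩

/-- An interval with dense orbit contains infinitely many points of the basic set. -/
theorem inter_Icc_infinite (h : IntervalCycle f M B) {a b : unitInterval} (hab : a < b)
    (hM : Icc a b ⊆ M) (hd : DenseOrb f M (Icc a b)) : (B ∩ Icc a b).Infinite := by
  intro hfin
  induction hk : (B ∩ Icc a b).ncard using Nat.strong_induction_on generalizing a b with
  | _ k ih =>
    obtain ⟨x, hx⟩ := h.inter_Icc_nonempty hab hM hd
    -- Cutting between two points of `B` would leave a piece with dense orbit and fewer points of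
    -- `B`, against the induction hypothesis.
    have hlt : ∀ x ∈ B ∩ Icc a b, ∀ y ∈ B ∩ Icc a b, ¬ x < y := by
      intro x hx y hy hxy
      obtain ⟨w, hw1, hw2⟩ := exists_between hxy
      have haw : a < w := hx.2.1.trans_lt hw1
      have hwb : w < b := hw2.trans_le hy.2.2
      rcases h.denseOrb_Icc_split haw.le hwb.le hab hM hd with ⟨-, h1⟩ | ⟨-, h1⟩
      · have hss : B ∩ Icc a w ⊂ B ∩ Icc a b :=
          ssubset_of_subset_of_ne (inter_subset_inter_right _ (Icc_subset_Icc_right hwb.le))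
            fun he => (he.symm.subset hy).2.2.not_gt hw2
        exact ih _ (hk ▸ ncard_lt_ncard hss hfin) haw ((Icc_subset_Icc_right hwb.le).trans hM) h1
          (hfin.subset hss.subset) rfl
      · have hss : B ∩ Icc w b ⊂ B ∩ Icc a b :=
          ssubset_of_subset_of_ne (inter_subset_inter_right _ (Icc_subset_Icc_left haw.le))
            fun he => (he.symm.subset hx).2.1.not_gt hw1
        exact ih _ (hk ▸ ncard_lt_ncard hss hfin) hwb ((Icc_subset_Icc_left haw.le).trans hM) h1
          (hfin.subset hss.subset) rfl
    refine h.not_inter_eq_singleton (x := x) hab hM hd (Subset.antisymm ?_ ?_)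
    · intro y hy
      exact le_antisymm (not_lt.1 (hlt x hx y hy)) (not_lt.1 (hlt y hy x hx))
    · rintro _ rfl
      exact hx

end IntervalCycle

/-! ### Returns and periodic points; topology and limit sets of the basic set. -/

/-- If an interval contains no periodic point, all returns to it go in the same direction. -/
theorem exists_periodic_of_returns {h : unitInterval → unitInterval} (hc : Continuous h)
    {U : Set unitInterval} (hU : U.OrdConnected) {x y : unitInterval} {m k : ℕ} (hm : 0 < m)
    (hk : 0 < k) (hx : x ∈ U) (hmx : h^[m] x ∈ U) (hxm : x < h^[m] x) (hy : y ∈ U)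
    (hky : h^[k] y ∈ U) (hyk : h^[k] y < y) : ∃ z ∈ U, ∃ r > 0, h^[r] z = z := by
  by_contra! hno
  -- Without periodic points in `U`, the sign of `h^[r] t - t` is constant on `U` for each `r`.
  have hup : ∀ r > 0, ∀ s ∈ U, s < h^[r] s → ∀ t ∈ U, t < h^[r] t := by
    intro r hr s hs hlt t ht
    by_contra hle
    obtain ⟨z, hz, hz'⟩ := hU.isPreconnected.intermediate_value₂ hs ht continuousOn_id
      (hc.iterate r).continuousOn hlt.le (not_lt.1 hle)
    exact hno z hz r hr hz'.symm
  have hdn : ∀ r > 0, ∀ s ∈ U, h^[r] s < s → ∀ t ∈ U, h^[r] t < t := by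
    intro r hr s hs hlt t ht
    by_contra hle
    obtain ⟨z, hz, hz'⟩ := hU.isPreconnected.intermediate_value₂ hs ht
      (hc.iterate r).continuousOn continuousOn_id hlt.le (not_lt.1 hle)
    exact hno z hz r hr hz'
  have hup' : ∀ j, x < h^[m * (j + 1)] x := by
    intro j
    induction j with
    | zero => simpa using hxm
    | succ j ih =>
      have := hup _ (by positivity) x hx ih _ hmx
      rw [← Function.iterate_add_apply] at this
      exact hxm.trans this
  have hdn' : ∀ j, h^[k * (j + 1)] y < y := by
    intro j
    induction j with
    | zero => simpa using hyk
    | succ j ih =>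
      have := hdn _ (by positivity) y hy ih _ hky
      rw [← Function.iterate_add_apply] at this
      exact this.trans hyk
  obtain ⟨m, rfl⟩ := Nat.exists_eq_add_of_le' hm
  obtain ⟨k, rfl⟩ := Nat.exists_eq_add_of_le' hk
  -- At the product of the two return times, `x` has moved up and `y` has moved down, against the
  -- constancy of sign.
  have h1 := hup' k
  have h2 := hup _ (by positivity) x hx h1 y hy
  have h3 := hdn' m
  rw [mul_comm] at h3
  exact lt_asymm h2 h3

namespace IntervalCycle

variable {f : unitInterval → unitInterval} {M B : Set unitInterval}

theorem exists_Icc_nhds (h : IntervalCycle f M B) {x : unitInterval} (hx : x ∈ M)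
    {U : Set unitInterval} (hU : U ∈ 𝓝 x) :
    ∃ u v, u < v ∧ x ∈ Icc u v ∧ Icc u v ⊆ M ∩ U ∧ Icc u v ∈ 𝓝[M] x := by
  obtain ⟨a, b, hab, hxab, habM, hnhds⟩ := h.loc x hx
  obtain ⟨u, v, huv, hxuv, hsub, hu, hv⟩ := exists_Icc_subset_of_mem_nhds hab hxab hU
  refine ⟨u, v, huv, hxuv, fun t ht => ⟨habM (hsub ht).1, (hsub ht).2⟩, ?_⟩
  have h1 : ∀ᶠ t in 𝓝[M] x, a < u → u < t := by
    by_cases hau : a < u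
    · exact mem_nhdsWithin_of_mem_nhds (mem_of_superset (Ioi_mem_nhds (hu hau)) fun t ht _ => ht)
    · exact Eventually.of_forall fun t hc => absurd hc hau
  have h2 : ∀ᶠ t in 𝓝[M] x, v < b → t < v := by
    by_cases hvb : v < b
    · exact mem_nhdsWithin_of_mem_nhds (mem_of_superset (Iio_mem_nhds (hv hvb)) fun t ht _ => ht)
    · exact Eventually.of_forall fun t hc => absurd hc hvb
  filter_upwards [h1, h2, hnhds] with t ht1 ht2 ht3
  constructor
  · rcases lt_or_ge a u with hau | hau
    · exact (ht1 hau).le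
    · exact hau.trans ht3.1
  · rcases lt_or_ge v b with hvb | hvb
    · exact (ht2 hvb).le
    · exact ht3.2.trans hvb

theorem inter_nhds_infinite (h : IntervalCycle f M B) {x : unitInterval} (hx : x ∈ B)
    {U : Set unitInterval} (hU : U ∈ 𝓝 x) : (B ∩ U).Infinite := by
  obtain ⟨u, v, huv, -, hsub, hnhds⟩ := h.exists_Icc_nhds (h.subset hx) hU
  exact (h.inter_Icc_infinite huv (fun t ht => (hsub ht).1)
    (h.denseOrb_of_mem_nhdsWithin hx hnhds)).mono
    (inter_subset_inter_right _ fun t ht => (hsub ht).2)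

theorem isClosed_basic (h : IntervalCycle f M B) : IsClosed B := by
  refine isClosed_of_closure_subset fun x hx => ?_
  refine h.mem_of_forall_denseOrb (closure_minimal h.subset h.closed hx) fun U hU => ?_
  obtain ⟨V, hVU, hV, hxV⟩ := mem_nhds_iff.1 hU
  obtain ⟨b, hbV, hb⟩ := mem_closure_iff.1 hx V hV hxV
  refine (h.denseOrb_of_mem_nhdsWithin hb (K := V ∩ M) ?_).mono (inter_subset_inter_left _ hVU)
  exact inter_mem (mem_nhdsWithin_of_mem_nhds (hV.mem_nhds hbV)) self_mem_nhdsWithin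

theorem perfect_basic (h : IntervalCycle f M B) : Perfect B := by
  refine ⟨h.isClosed_basic, preperfect_iff_nhds.2 fun x hx U hU => ?_⟩
  obtain ⟨y, ⟨hyB, hyU⟩, hyx⟩ := (h.inter_nhds_infinite hx hU).exists_notMem_finite
    (finite_singleton x)
  exact ⟨y, ⟨hyU, hyB⟩, hyx⟩

/-- The image is compact, so density suffices: a small interval at a point of `B` lifts through `f`
to an interval of `M` with dense orbit, and this contains a point of `B`. -/
theorem image_basic (h : IntervalCycle f M B) : f '' B = B := by
  refine Subset.antisymm h.mapsTo_basic.image_subset fun y hy => ?_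
  have hcl : IsClosed (f '' B) := (h.isClosed_basic.isCompact.image h.cont).isClosed
  rw [← hcl.closure_eq, mem_closure_iff_nhds]
  intro U hU
  obtain ⟨c, d, hcd, -, hsub, hnhds⟩ := h.exists_Icc_nhds (h.subset hy) hU
  obtain ⟨u, v, huv, huvM, himg⟩ := h.lift c d hcd.le fun t ht => (hsub ht).1
  have huv' : u < v := by
    refine lt_of_le_of_ne huv ?_
    rintro rfl
    rw [Icc_self, image_singleton] at himg
    have h1 : c ∈ ({f u} : Set unitInterval) := himg ▸ left_mem_Icc.2 hcd.le
    have h2 : d ∈ ({f u} : Set unitInterval) := himg ▸ right_mem_Icc.2 hcd.le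
    rw [mem_singleton_iff] at h1 h2
    exact hcd.ne (h1.trans h2.symm)
  have hd : DenseOrb f M (Icc u v) := DenseOrb.of_image_iterate 1
    (by rw [Function.iterate_one, himg]; exact h.denseOrb_of_mem_nhdsWithin hy hnhds)
  obtain ⟨b, hbB, hb⟩ := h.inter_Icc_nonempty huv' huvM hd
  exact ⟨f b, (hsub (himg ▸ mem_image_of_mem f hb)).2, b, hbB, rfl⟩

theorem iterate_image_basic (h : IntervalCycle f M B) (i : ℕ) : f^[i] '' B = B := by
  induction i with
  | zero => simp
  | succ i ih => rw [Function.iterate_succ, image_comp, h.image_basic, ih]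

/-- The image of an interval without interior points in the basic set has no interior points in
the basic set. -/
theorem image_gap (h : IntervalCycle f M B) {u v : unitInterval} (huv : u ≤ v)
    (hM : Icc u v ⊆ M) (hgap : Ioo u v ∩ B = ∅) {s t : unitInterval} (hs : s ∈ f '' Icc u v)
    (ht : t ∈ f '' Icc u v) : Ioo s t ∩ B = ∅ := by
  rw [← not_nonempty_iff_eq_empty]
  rintro ⟨z, ⟨hsz, hzt⟩, hz⟩
  have himg : Icc s t ⊆ f '' Icc u v :=
    (isPreconnected_Icc.image f h.cont.continuousOn).ordConnected.out hs ht
  -- A point of `B` interior to the image makes the orbit of `Icc u v` dense, so that a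
  -- non-degenerate `Icc u v` would contain infinitely many points of `B`.
  have hd : DenseOrb f M (Icc u v) := DenseOrb.of_image_iterate 1 (by
    rw [Function.iterate_one]
    exact (h.denseOrb_of_mem_nhdsWithin hz
      (mem_nhdsWithin_of_mem_nhds (Icc_mem_nhds hsz hzt))).mono himg)
  rcases huv.eq_or_lt with rfl | huv
  · rw [Icc_self, image_singleton, mem_singleton_iff] at hs ht
    exact (hsz.trans hzt).ne (hs.trans ht.symm)
  · refine h.inter_Icc_infinite huv hM hd ((toFinite {u, v}).subset ?_)
    rintro x ⟨hxB, hx⟩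
    by_contra hne
    simp only [mem_insert_iff, mem_singleton_iff, not_or] at hne
    exact (hgap.subset ⟨⟨lt_of_le_of_ne hx.1 (Ne.symm hne.1), lt_of_le_of_ne hx.2 hne.2⟩, hxB⟩ :
      x ∈ (∅ : Set unitInterval))

/-- The orbit of `z` ends up in `M`. A limit point outside `B` would have a small interval with
non-dense orbit, to which the orbit of `z` returns. The orbit of that interval then has finite
frontier and contains a tail of the orbit of `z`, so its closure contains `B`. No point of `B` is
interior to it, so `B` would be finite. -/
theorem omegaSet_eq_of_subset (h : IntervalCycle f M B) {z : unitInterval}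
    (hz : B ⊆ omegaSet f z) : omegaSet f z = B := by
  have hfreq : ∀ y ∈ omegaSet f z, ∀ U ∈ 𝓝 y, ∃ᶠ m in atTop, f^[m] z ∈ U := by
    intro y hy U hU
    have := (mem_omegaLimit_iff_frequently _ _ _ _).1 hy U hU
    refine this.mono fun m hm => ?_
    obtain ⟨_, rfl, hm⟩ := hm
    exact hm
  obtain ⟨b, hb⟩ := h.infinite.nonempty
  obtain ⟨u, v, huv, -, hsub, hnhds⟩ := h.exists_Icc_nhds (h.subset hb) univ_mem
  obtain ⟨c, ⟨hcB, hc⟩, hcne⟩ := (h.inter_Icc_infinite huv (fun t ht => (hsub ht).1)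
    (h.denseOrb_of_mem_nhdsWithin hb hnhds)).exists_notMem_finite (toFinite {u, v})
  simp only [mem_insert_iff, mem_singleton_iff, not_or] at hcne
  obtain ⟨i₀, hi₀⟩ := (hfreq c (hz hcB) (Icc u v) (Icc_mem_nhds
    (lt_of_le_of_ne hc.1 (Ne.symm hcne.1)) (lt_of_le_of_ne hc.2 hcne.2))).exists
  have hev : ∀ m ≥ i₀, f^[m] z ∈ M := by
    intro m hm
    rw [show m = (m - i₀) + i₀ by omega, Function.iterate_add_apply]
    exact h.mapsTo.iterate _ (hsub hi₀).1
  refine Subset.antisymm (fun y hy => ?_) hz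
  have hyM : y ∈ M := by
    by_contra hyM
    obtain ⟨m, hm, hm'⟩ := ((hfreq y hy _ (h.closed.isOpen_compl.mem_nhds hyM)).and_eventually
      (eventually_ge_atTop i₀)).exists
    exact hm (hev m hm')
  by_contra hyB
  obtain ⟨U, hU, hUd⟩ : ∃ U ∈ 𝓝 y, ¬ DenseOrb f M (U ∩ M) := by
    by_contra! hcon
    exact hyB (h.mem_of_forall_denseOrb hyM hcon)
  obtain ⟨u', v', huv', -, hsub', hnhds'⟩ := h.exists_Icc_nhds hyM hU
  have hnd : ¬ DenseOrb f M (Icc u' v') := fun hd =>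
    hUd (hd.mono fun t ht => ⟨(hsub' ht).2, (hsub' ht).1⟩)
  obtain ⟨V, hV, hVsub⟩ := mem_nhdsWithin_iff_exists_mem_nhds_inter.1 hnhds'
  have hret : ∀ N, ∃ m ≥ N, f^[m] z ∈ Icc u' v' := by
    intro N
    obtain ⟨m, hm, hm'⟩ := ((hfreq y hy _ hV).and_eventually
      (eventually_ge_atTop (max i₀ N))).exists
    exact ⟨m, (le_max_right _ _).trans hm', hVsub ⟨hm, hev m ((le_max_left _ _).trans hm')⟩⟩
  obtain ⟨i, -, hi⟩ := hret 0
  obtain ⟨j, hij, hj⟩ := hret (i + 1)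
  have hfin := frontier_orb_finite h.cont (K := Icc u' v') isPreconnected_Icc (i := 0) (j := j - i)
    (by omega) ⟨f^[j] z, by simpa using hj, f^[i] z, hi, by
      rw [← Function.iterate_add_apply]; congr 2; omega⟩
  refine h.infinite (hfin.subset fun b hb => ⟨?_, fun hint => ?_⟩)
  · rw [mem_closure_iff_nhds]
    intro W hW
    obtain ⟨m, hm, hm'⟩ := ((hfreq b (hz hb) W hW).and_eventually (eventually_ge_atTop i)).exists
    refine ⟨_, hm, mem_orb.2 ⟨m - i, _, hi, ?_⟩⟩
    rw [← Function.iterate_add_apply]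
    congr 2
    omega
  · refine h.notMem_nhdsWithin isClosed_closure (mapsTo_closure_orb h.cont) hnd hb ?_
    exact mem_nhdsWithin_of_mem_nhds
      (mem_of_superset (isOpen_interior.mem_nhds hint) (interior_subset.trans subset_closure))

/-- Periodic points are dense in the basic set as soon as the basic set is transitive. -/
theorem subset_closure_periodicPts (h : IntervalCycle f M B) (ht : IsTransitiveOn f B) :
    B ⊆ closure (Function.periodicPts f) := by
  intro x hx
  rw [mem_closure_iff_nhds]
  intro U hU
  obtain ⟨W, hW, hWU, hWc⟩ : ∃ W ∈ 𝓝 x, W ⊆ U ∧ W.OrdConnected := by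
    obtain ⟨u, v, -, -, hsub, hu, hv⟩ :=
      exists_Icc_subset_of_mem_nhds (a := 0) (b := 1) zero_lt_one ⟨unitInterval.nonneg',
        unitInterval.le_one'⟩ hU
    refine ⟨Icc u v, ?_, fun t ht => (hsub ht).2, ordConnected_Icc⟩
    have h1 : ∀ᶠ t in 𝓝 x, u ≤ t := by
      by_cases h0 : 0 < u
      · exact (eventually_gt_nhds (hu h0)).mono fun t ht => ht.le
      · exact Eventually.of_forall fun t => (not_lt.1 h0).trans unitInterval.nonneg'
    have h2 : ∀ᶠ t in 𝓝 x, t ≤ v := by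
      by_cases h0 : v < 1
      · exact (eventually_lt_nhds (hv h0)).mono fun t ht => ht.le
      · exact Eventually.of_forall fun t => unitInterval.le_one'.trans (not_lt.1 h0)
    filter_upwards [h1, h2] with t ht1 ht2 using ⟨ht1, ht2⟩
  obtain ⟨O, hOW, hO, hxO⟩ := mem_nhds_iff.1 hW
  have hinf := h.inter_nhds_infinite hx (hO.mem_nhds hxO)
  obtain ⟨y, ⟨hyB, hyO⟩⟩ := hinf.nonempty
  obtain ⟨y', ⟨hyB', hyO'⟩, hne⟩ := hinf.exists_notMem_finite (finite_singleton y)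
  wlog hlt : y < y' generalizing y y'
  · exact this y' hyB' hyO' y (fun hc => hne (Eq.symm hc)) hyB hyO
      (lt_of_le_of_ne (not_lt.1 hlt) hne)
  obtain ⟨w, hw1, hw2⟩ := exists_between hlt
  -- Disjointness excludes time zero. Applied to the parts of `O` left and right of `w`, in both
  -- orders, this gives returns in both directions.
  have key : ∀ V V' : Set unitInterval, Disjoint V V' → IsOpen V → IsOpen V' → (V ∩ B).Nonempty →
      (V' ∩ B).Nonempty → ∃ m > 0, ∃ t ∈ V, f^[m] t ∈ V' := by
    intro V V' hd hV hV' hne hne'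
    obtain ⟨m, _, ⟨t, ⟨htV, -⟩, rfl⟩, htV'⟩ := ht.2 V V' hV hV' hne hne'
    refine ⟨m, Nat.pos_of_ne_zero ?_, t, htV, htV'⟩
    rintro rfl
    exact hd.le_bot ⟨htV, htV'⟩
  have hdis : Disjoint (O ∩ Iio w) (O ∩ Ioi w) :=
    (Iio_disjoint_Ioi_of_le le_rfl).mono inter_subset_right inter_subset_right
  obtain ⟨m, hm, t, htV, htV'⟩ := key _ _ hdis (hO.inter isOpen_Iio) (hO.inter isOpen_Ioi)
    ⟨y, ⟨hyO, hw1⟩, hyB⟩ ⟨y', ⟨hyO', hw2⟩, hyB'⟩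
  obtain ⟨k, hk, s, hsV, hsV'⟩ := key _ _ hdis.symm (hO.inter isOpen_Ioi) (hO.inter isOpen_Iio)
    ⟨y', ⟨hyO', hw2⟩, hyB'⟩ ⟨y, ⟨hyO, hw1⟩, hyB⟩
  obtain ⟨z, hz, r, hr, hrz⟩ := exists_periodic_of_returns h.cont hWc hm hk (hOW htV.1)
    (hOW htV'.1) (lt_trans htV.2 htV'.2) (hOW hsV.1) (hOW hsV'.1) (lt_trans hsV'.2 hsV.2)
  exact ⟨z, hWU hz, Function.mk_mem_periodicPts hr hrz⟩

end IntervalCycle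

/-! ### Monotone maps collapsing the gaps of a perfect set. -/

/-- A non-empty perfect set is an uncountable standard Borel space, hence Borel isomorphic to the
unit interval; Lebesgue measure is carried over. -/
theorem exists_noAtoms_of_perfect {C : Set unitInterval} (hC : Perfect C) (hne : C.Nonempty) :
    ∃ ν : MeasureTheory.Measure unitInterval, ν univ = 1 ∧ (∀ x, ν {x} = 0) ∧ ν Cᶜ = 0 := by
  have hunc : ∀ {C : Set unitInterval}, Perfect C → C.Nonempty → ¬ Countable C := by
    intro C hC hne hcount
    obtain ⟨e, he, -, hinj⟩ := hC.exists_nat_bool_injection hne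
    have : Countable (ℕ → Bool) := by
      refine Function.Injective.countable (f := fun x => (⟨e x, he (mem_range_self x)⟩ : C)) ?_
      intro x y hxy
      exact hinj (Subtype.ext_iff.1 hxy)
    have h1 := (Cardinal.mk_le_aleph0_iff (α := ℕ → Bool)).2 this
    rw [← Cardinal.power_def, Cardinal.mk_bool, Cardinal.mk_nat] at h1
    exact (Cardinal.cantor _).not_ge h1
  have h01 : ¬ Countable unitInterval := by
    intro hc
    have h1 := (Cardinal.mk_le_aleph0_iff (α := unitInterval)).2 hc
    rw [unitInterval, Cardinal.mk_Icc_real zero_lt_one] at h1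
    exact Cardinal.aleph0_lt_continuum.not_ge h1
  have : StandardBorelSpace C := hC.closed.measurableSet.standardBorel
  let e : unitInterval ≃ᵐ C := PolishSpace.measurableEquivOfNotCountable h01 (hunc hC hne)
  have hm : Measurable fun t => (e t : unitInterval) := measurable_subtype_coe.comp e.measurable
  refine ⟨MeasureTheory.volume.map fun t => (e t : unitInterval), ?_, fun x => ?_, ?_⟩
  · rw [MeasureTheory.Measure.map_apply hm MeasurableSet.univ]
    simp
  · rw [MeasureTheory.Measure.map_apply hm (measurableSet_singleton x)]
    refine Set.Subsingleton.measure_zero ?_ _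
    intro s hs t ht
    exact e.injective (Subtype.ext (hs.trans ht.symm))
  · rw [MeasureTheory.Measure.map_apply hm hC.closed.measurableSet.compl]
    have : (fun t => (e t : unitInterval)) ⁻¹' Cᶜ = ∅ := by
      ext t
      simp
    rw [this, MeasureTheory.measure_empty]

/-- The distribution function of a suitable atomless measure collapses exactly the intervals
complementary to a perfect set. -/
theorem exists_monotone_collapse {P : Set unitInterval} (hP : Perfect P) :
    ∃ φ : unitInterval → unitInterval, Continuous φ ∧ Monotone φ ∧
      ∀ x y, x ≤ y → (φ x = φ y ↔ Ioo x y ∩ P = ∅) := by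
  classical
  obtain ⟨b, hbc, -, hb⟩ := TopologicalSpace.exists_countable_basis unitInterval
  have hbne : b.Nonempty := by
    obtain ⟨v, hv, -⟩ := hb.exists_subset_of_mem_open (mem_univ (0 : unitInterval)) isOpen_univ
    exact ⟨v, hv⟩
  obtain ⟨O, hO⟩ := hbc.exists_eq_range hbne
  have hOopen : ∀ k, IsOpen (O k) := fun k => hb.isOpen (hO ▸ mem_range_self k)
  -- For each basic open set meeting `P`, an atomless probability on the closure of its trace on
  -- `P`. Their weighted sum is an atomless measure carried by `P` which charges every open interval
  -- meeting `P`.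
  have hν : ∀ k, ∃ ν : MeasureTheory.Measure unitInterval, ν univ ≤ 1 ∧ (∀ x, ν {x} = 0) ∧
      ν Pᶜ = 0 ∧ ((O k ∩ P).Nonempty → ν (closure (O k)) ≠ 0) := by
    intro k
    by_cases hk : (O k ∩ P).Nonempty
    · obtain ⟨x, hxO, hxP⟩ := hk
      obtain ⟨hC, hCne⟩ := hP.closure_nhds_inter x hxP hxO (hOopen k)
      obtain ⟨ν, h1, h2, h3⟩ := exists_noAtoms_of_perfect hC hCne
      refine ⟨ν, h1.le, h2, MeasureTheory.measure_mono_null (compl_subset_compl.2 ?_) h3, fun _ h0 => ?_⟩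
      · exact closure_minimal inter_subset_right hP.closed
      · have h4 : ν (closure (O k ∩ P)) = 0 :=
          MeasureTheory.measure_mono_null (closure_mono inter_subset_left) h0
        have := MeasureTheory.measure_union_null h4 h3
        rw [union_compl_self, h1] at this
        exact one_ne_zero this
    · exact ⟨0, by simp, by simp, by simp, fun h => absurd h hk⟩
  choose ν hν1 hν2 hν3 hν4 using hν
  set μ : MeasureTheory.Measure unitInterval :=
    MeasureTheory.Measure.sum fun k => ((2 : ENNReal)⁻¹ ^ (k + 1)) • ν k with hμ
  have hμle : μ univ ≤ 1 := by
    rw [hμ, MeasureTheory.Measure.sum_apply _ MeasurableSet.univ]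
    calc ∑' k, ((2 : ENNReal)⁻¹ ^ (k + 1) • ν k) univ ≤ ∑' k : ℕ, (2 : ENNReal)⁻¹ ^ (k + 1) := by
          refine ENNReal.tsum_le_tsum fun k => ?_
          rw [MeasureTheory.Measure.smul_apply, smul_eq_mul]
          exact mul_le_of_le_one_right' (hν1 k)
      _ = 1 := by
          rw [ENNReal.tsum_geometric_add_one, ENNReal.one_sub_inv_two, inv_inv]
          exact ENNReal.inv_mul_cancel two_ne_zero ENNReal.ofNat_ne_top
  have : MeasureTheory.IsFiniteMeasure μ := ⟨hμle.trans_lt ENNReal.one_lt_top⟩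
  have hatom : ∀ x, μ {x} = 0 := by
    intro x
    rw [hμ, MeasureTheory.Measure.sum_apply _ (measurableSet_singleton x), ENNReal.tsum_eq_zero]
    intro k
    simp [hν2 k x]
  have hmem : ∀ x, μ.real (Iic x) ∈ unitInterval := fun x =>
    ⟨MeasureTheory.measureReal_nonneg, by
      have h1 : μ (Iic x) ≤ 1 := (MeasureTheory.measure_mono (subset_univ _)).trans hμle
      exact ENNReal.toReal_mono ENNReal.one_ne_top h1⟩
  refine ⟨fun x => ⟨μ.real (Iic x), hmem x⟩, ?_, ?_, ?_⟩
  · refine Continuous.subtype_mk ?_ _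
    -- Continuity is dominated convergence for the indicators of `Iic x`, which converge off the
    -- null set `{x}`.
    have : (fun x => μ.real (Iic x)) = fun x => ∫ t, (Iic x).indicator (fun _ => (1 : ℝ)) t ∂μ := by
      funext x
      rw [MeasureTheory.integral_indicator measurableSet_Iic]
      simp
    rw [this, continuous_iff_continuousAt]
    intro x
    refine MeasureTheory.continuousAt_of_dominated (bound := fun _ => 1) ?_ ?_ ?_ ?_
    · exact Eventually.of_forall fun y =>
        (measurable_const.indicator measurableSet_Iic).aestronglyMeasurable
    · refine Eventually.of_forall fun y => Eventually.of_forall fun t => ?_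
      by_cases h : t ∈ Iic y <;> simp [h]
    · exact MeasureTheory.integrable_const _
    · have : ∀ᵐ t ∂μ, t ≠ x := by
        rw [MeasureTheory.ae_iff]
        simpa using hatom x
      filter_upwards [this] with t ht
      rcases lt_or_gt_of_ne ht with hlt | hlt
      · refine (continuousAt_const (y := (1 : ℝ))).congr ?_
        filter_upwards [Ioi_mem_nhds hlt] with y hy
        rw [indicator_of_mem (show t ∈ Iic y from mem_Iic.2 (mem_Ioi.1 hy).le)]
      · refine (continuousAt_const (y := (0 : ℝ))).congr ?_
        filter_upwards [Iio_mem_nhds hlt] with y hy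
        rw [indicator_of_notMem (show t ∉ Iic y from notMem_Iic.2 hy)]
  · intro x y hxy
    exact MeasureTheory.measureReal_mono (Iic_subset_Iic.2 hxy)
  · intro x y hxy
    have hsplit : μ.real (Iic y) = μ.real (Iic x) + μ.real (Ioc x y) := by
      rw [← Iic_union_Ioc_eq_Iic hxy, MeasureTheory.measureReal_union _ measurableSet_Ioc]
      exact (Iic_disjoint_Ioi le_rfl).mono_right Ioc_subset_Ioi_self
    have h1 : (⟨μ.real (Iic x), hmem x⟩ : unitInterval) = ⟨μ.real (Iic y), hmem y⟩ ↔
        μ (Ioc x y) = 0 := by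
      rw [Subtype.mk.injEq, hsplit, left_eq_add, MeasureTheory.measureReal_eq_zero_iff]
    rw [h1]
    constructor
    · intro h0
      rw [← not_nonempty_iff_eq_empty]
      rintro ⟨z, hz, hzP⟩
      obtain ⟨v, hvb, hzv, hvs⟩ := hb.exists_closure_subset (isOpen_Ioo.mem_nhds hz)
      obtain ⟨k, rfl⟩ : v ∈ range O := hO ▸ hvb
      refine hν4 k ⟨z, hzv, hzP⟩ ?_
      have h2 : μ (closure (O k)) = 0 :=
        MeasureTheory.measure_mono_null (hvs.trans Ioo_subset_Ioc_self) h0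
      rw [hμ, MeasureTheory.Measure.sum_apply _ isClosed_closure.measurableSet,
        ENNReal.tsum_eq_zero] at h2
      have h3 := h2 k
      rw [MeasureTheory.Measure.smul_apply, smul_eq_mul, mul_eq_zero] at h3
      refine h3.resolve_left (pow_ne_zero _ (by simp))
    · intro hemp
      have hPc : μ Pᶜ = 0 := by
        rw [hμ, MeasureTheory.Measure.sum_apply _ hP.closed.measurableSet.compl,
          ENNReal.tsum_eq_zero]
        intro k
        rw [MeasureTheory.Measure.smul_apply, hν3 k, smul_zero]
      refine MeasureTheory.measure_mono_null (t := Pᶜ ∪ {y}) ?_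
        (MeasureTheory.measure_union_null hPc (hatom y))
      intro t ht
      rcases ht.2.lt_or_eq with hlt | rfl
      · exact Or.inl fun htP => (hemp.subset ⟨⟨ht.1, hlt⟩, htP⟩ : t ∈ (∅ : Set unitInterval))
      · exact Or.inr rfl


/-! ### The factor map and transitivity. -/

/-- A continuous monotone map `φ` collapsing exactly the gaps of the basic set `B` inside `M`,
together with the factor `g` of `f` on `φ '' M`. -/
structure IsFactor (f : unitInterval → unitInterval) (M B : Set unitInterval)
    (φ g : unitInterval → unitInterval) : Prop where
  cont : Continuous φ
  mono : Monotone φ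
  eq_iff : ∀ x y, x ≤ y → (φ x = φ y ↔ Ioo x y ∩ B = ∅ ∧ Ioo x y ⊆ M)
  cont_g : ContinuousOn g (φ '' M)
  semiconj : ∀ x ∈ M, φ (f x) = g (φ x)

/-- Adjoining the closure of `Mᶜ` prevents the map from collapsing gaps between the components of
`M`: only gaps of `B` inside `M` remain to be collapsed. -/
theorem perfect_union_closure_compl {M B : Set unitInterval} (hM : IsClosed M) (hB : Perfect B) :
    Perfect (B ∪ closure Mᶜ) := by
  have h1 : Preperfect (Mᶜ) := by
    rw [preperfect_iff_nhds]
    intro x hx U hU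
    have : (𝓝[≠] x).NeBot := by
      rcases lt_or_ge x 1 with h | h
      · have := nhdsGT_neBot_of_exists_gt ⟨1, h⟩
        exact NeBot.mono this (nhdsWithin_mono _ fun y hy => ne_of_gt hy)
      · have h0 : (0 : unitInterval) < x := zero_lt_one.trans_le h
        have := nhdsLT_neBot_of_exists_lt ⟨0, h0⟩
        exact NeBot.mono this (nhdsWithin_mono _ fun y hy => ne_of_lt hy)
    have h2 : U ∩ Mᶜ ∈ 𝓝[≠] x := mem_nhdsWithin_of_mem_nhds (inter_mem hU (hM.isOpen_compl.mem_nhds hx))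
    obtain ⟨y, hy, hne⟩ := (this.nonempty_of_mem (inter_mem h2 self_mem_nhdsWithin))
    exact ⟨y, hy, hne⟩
  have h2 := h1.perfect_closure
  refine ⟨hB.closed.union h2.closed, preperfect_iff_nhds.2 ?_⟩
  rintro x (hx | hx) U hU
  · obtain ⟨y, hy, hne⟩ := preperfect_iff_nhds.1 hB.acc x hx U hU
    exact ⟨y, ⟨hy.1, Or.inl hy.2⟩, hne⟩
  · obtain ⟨y, hy, hne⟩ := preperfect_iff_nhds.1 h2.acc x hx U hU
    exact ⟨y, ⟨hy.1, Or.inr hy.2⟩, hne⟩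

theorem encard_le_two_of_not_between {S : Set unitInterval}
    (h : ∀ a ∈ S, ∀ b ∈ S, ∀ c ∈ S, a < b → ¬ b < c) : S.encard ≤ 2 := by
  have hsub : S ⊆ {sInf S, sSup S} := by
    intro b hb
    by_contra hne
    simp only [mem_insert_iff, mem_singleton_iff, not_or] at hne
    obtain ⟨a, ha, hab⟩ := sInf_lt_iff.1 (lt_of_le_of_ne (sInf_le hb) (Ne.symm hne.1))
    obtain ⟨c, hc, hbc⟩ := lt_sSup_iff.1 (lt_of_le_of_ne (le_sSup hb) hne.2)
    exact h a ha b hb c hc hab hbc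
  exact (encard_le_encard hsub).trans ((encard_insert_le _ _).trans (by rw [encard_singleton]; norm_num))

namespace IntervalCycle

variable {f : unitInterval → unitInterval} {M B : Set unitInterval}

/-- Two points of `M` with the same value bound a gap of `B` inside `M`, and `image_gap` puts their
images into one gap again. So `φ ∘ f` is constant on the fibres. Its factor `g` is continuous
because preimages of closed sets are `φ`-images of compact sets. -/
theorem exists_isFactor (h : IntervalCycle f M B) : ∃ φ g, IsFactor f M B φ g := by
  obtain ⟨φ, hφ, hmono, heq⟩ := exists_monotone_collapse
    (perfect_union_closure_compl h.closed h.perfect_basic)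
  have heq' : ∀ x y, x ≤ y → (φ x = φ y ↔ Ioo x y ∩ B = ∅ ∧ Ioo x y ⊆ M) := by
    intro x y hxy
    rw [heq x y hxy, inter_union_distrib_left, union_empty_iff, and_congr_right_iff]
    rintro -
    rw [← disjoint_iff_inter_eq_empty, ← disjoint_compl_right_iff_subset]
    exact ⟨fun hd => hd.mono_right subset_closure, fun hd => hd.closure_right isOpen_Ioo⟩
  have hfib : ∀ x ∈ M, ∀ y ∈ M, x ≤ y → φ x = φ y → φ (f x) = φ (f y) := by
    intro x hx y hy hxy he
    obtain ⟨h1, h2⟩ := (heq' x y hxy).1 he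
    have hsub : Icc x y ⊆ M := by
      intro t ht
      rcases ht.1.eq_or_lt with rfl | h3
      · exact hx
      rcases ht.2.eq_or_lt with rfl | h4
      · exact hy
      exact h2 ⟨h3, h4⟩
    have hxm : f x ∈ f '' Icc x y := mem_image_of_mem _ (left_mem_Icc.2 hxy)
    have hym : f y ∈ f '' Icc x y := mem_image_of_mem _ (right_mem_Icc.2 hxy)
    have hoc := (isPreconnected_Icc.image f h.cont.continuousOn : IsPreconnected (f '' Icc x y)).ordConnected
    have hsubM : f '' Icc x y ⊆ M := by
      rintro _ ⟨t, ht, rfl⟩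
      exact h.mapsTo (hsub ht)
    rcases le_total (f x) (f y) with h3 | h3
    · exact (heq' _ _ h3).2 ⟨h.image_gap hxy hsub h1 hxm hym,
        (Ioo_subset_Icc_self.trans (hoc.out hxm hym)).trans hsubM⟩
    · exact ((heq' _ _ h3).2 ⟨h.image_gap hxy hsub h1 hym hxm,
        (Ioo_subset_Icc_self.trans (hoc.out hym hxm)).trans hsubM⟩).symm
  set g : unitInterval → unitInterval := fun y => φ (f (Function.invFunOn φ M y)) with hg
  have hsemi : ∀ x ∈ M, φ (f x) = g (φ x) := by
    intro x hx
    have hex : ∃ a ∈ M, φ a = φ x := ⟨x, hx, rfl⟩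
    have h1 := Function.invFunOn_mem hex
    have h2 := Function.invFunOn_eq hex
    rcases le_total x (Function.invFunOn φ M (φ x)) with h3 | h3
    · exact hfib _ hx _ h1 h3 h2.symm
    · exact (hfib _ h1 _ hx h3 h2).symm
  refine ⟨φ, g, hφ, hmono, heq', ?_, hsemi⟩
  rw [continuousOn_iff_isClosed]
  intro Z hZ
  refine ⟨φ '' (M ∩ (φ ∘ f) ⁻¹' Z), ?_, ?_⟩
  · exact ((h.closed.inter (hZ.preimage (hφ.comp h.cont))).isCompact.image hφ).isClosed
  · ext y
    constructor
    · rintro ⟨hyZ, x, hx, rfl⟩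
      refine ⟨⟨x, ⟨hx, ?_⟩, rfl⟩, mem_image_of_mem _ hx⟩
      rw [mem_preimage, Function.comp_apply, hsemi x hx]
      exact hyZ
    · rintro ⟨⟨x, ⟨hx, hxZ⟩, rfl⟩, -⟩
      refine ⟨?_, mem_image_of_mem _ hx⟩
      rw [mem_preimage, ← hsemi x hx]
      exact hxZ

end IntervalCycle

namespace IsFactor

variable {f : unitInterval → unitInterval} {M B : Set unitInterval}
  {φ g : unitInterval → unitInterval}

theorem semiconj_iterate (F : IsFactor f M B φ g) (h : IntervalCycle f M B) {x : unitInterval}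
    (hx : x ∈ M) (i : ℕ) : φ (f^[i] x) = g^[i] (φ x) := by
  induction i with
  | zero => rfl
  | succ i ih =>
    rw [Function.iterate_succ_apply', Function.iterate_succ_apply',
      F.semiconj _ (h.mapsTo.iterate i hx), ih]

theorem mapsTo_g (F : IsFactor f M B φ g) (h : IntervalCycle f M B) :
    MapsTo g (φ '' M) (φ '' M) := by
  rintro _ ⟨x, hx, rfl⟩
  rw [← F.semiconj x hx]
  exact mem_image_of_mem _ (h.mapsTo hx)

theorem lt_of_infinite (F : IsFactor f M B φ g) {u v : unitInterval} (huv : u ≤ v)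
    (hinf : (B ∩ Icc u v).Infinite) : φ u < φ v := by
  refine lt_of_le_of_ne (F.mono huv) fun he => hinf ((toFinite {u, v}).subset ?_)
  rintro x ⟨hxB, hx⟩
  by_contra hne
  simp only [mem_insert_iff, mem_singleton_iff, not_or] at hne
  exact (((F.eq_iff u v huv).1 he).1.subset
    ⟨⟨lt_of_le_of_ne hx.1 (Ne.symm hne.1), lt_of_le_of_ne hx.2 hne.2⟩, hxB⟩ :
      x ∈ (∅ : Set unitInterval))

/-- Every neighbourhood of a point of the basic set contains a saturated interval. -/
theorem exists_saturated (F : IsFactor f M B φ g) (h : IntervalCycle f M B) {x : unitInterval}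
    (hx : x ∈ B) {U : Set unitInterval} (hU : U ∈ 𝓝 x) :
    ∃ u v, u < v ∧ Icc u v ⊆ M ∩ U ∧ φ u < φ v ∧ Icc (φ u) (φ v) ⊆ φ '' M ∧
      ∀ y, φ y ∈ Ioo (φ u) (φ v) → y ∈ Icc u v := by
  obtain ⟨u, v, huv, -, hsub, hnhds⟩ := h.exists_Icc_nhds (h.subset hx) hU
  refine ⟨u, v, huv, hsub, F.lt_of_infinite huv.le (h.inter_Icc_infinite huv
    (fun t ht => (hsub ht).1) (h.denseOrb_of_mem_nhdsWithin hx hnhds)), ?_, ?_⟩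
  · exact (intermediate_value_Icc huv.le F.cont.continuousOn).trans
      (image_mono fun t ht => (hsub ht).1)
  · exact fun y hy => ⟨(F.mono.reflect_lt hy.1).le, (F.mono.reflect_lt hy.2).le⟩

/-- Over a small interval, the last point `t` of a fibre is a limit of points of `B` from the right,
since `φ` increases immediately after `t`; hence `t ∈ B`. Density of the orbit of this interval and
compactness of `φ '' B` spread the conclusion over `M`. -/
theorem image_basic (F : IsFactor f M B φ g) (h : IntervalCycle f M B) : φ '' B = φ '' M := by
  refine Subset.antisymm (image_mono h.subset) ?_
  have hcl : IsClosed (φ '' B) := (h.isClosed_basic.isCompact.image F.cont).isClosed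
  obtain ⟨b, hb⟩ := h.infinite.nonempty
  obtain ⟨u, v, huv, -, hsub, hnhds⟩ := h.exists_Icc_nhds (h.subset hb) univ_mem
  have hd := h.denseOrb_of_mem_nhdsWithin hb hnhds
  have hlt : φ u < φ v := F.lt_of_infinite huv.le (h.inter_Icc_infinite huv
    (fun t ht => (hsub ht).1) hd)
  have h1 : Ioo (φ u) (φ v) ⊆ φ '' B := by
    intro y hy
    obtain ⟨x, hx, rfl⟩ := intermediate_value_Icc huv.le F.cont.continuousOn
      (Ioo_subset_Icc_self hy)
    have hK : IsCompact (Icc u v ∩ φ ⁻¹' {φ x}) :=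
      (isClosed_Icc.inter (isClosed_singleton.preimage F.cont)).isCompact
    obtain ⟨t, ⟨ht, htx⟩, htmax⟩ := hK.exists_isGreatest ⟨x, hx, rfl⟩
    rw [mem_preimage, mem_singleton_iff] at htx
    refine ⟨t, ?_, htx⟩
    have htv : t < v := lt_of_le_of_ne ht.2 (by rintro rfl; exact hy.2.ne htx.symm)
    rw [← h.isClosed_basic.closure_eq, mem_closure_iff_nhds]
    intro W hW
    obtain ⟨w, hw, hwW⟩ := exists_Ico_subset_of_mem_nhds' hW htv
    obtain ⟨w', hw1, hw2⟩ := exists_between hw.1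
    have hne : φ t ≠ φ w' := by
      intro he
      exact (htmax ⟨⟨ht.1.trans hw1.le, hw2.le.trans hw.2⟩, he.symm.trans htx⟩).not_gt hw1
    have := mt (F.eq_iff t w' hw1.le).2 hne
    rw [not_and'] at this
    obtain ⟨z, hz, hzB⟩ := nonempty_iff_ne_empty.2 <| this fun s hs => (hsub ⟨ht.1.trans hs.1.le,
      (hs.2.trans hw2).le.trans hw.2⟩).1
    exact ⟨z, hwW ⟨hz.1.le, hz.2.trans hw2⟩, hzB⟩
  have h2 : φ '' Icc u v ⊆ φ '' B := by
    refine Subset.trans ?_ (closure_minimal h1 hcl)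
    rw [closure_Ioo hlt.ne]
    rintro _ ⟨x, hx, rfl⟩
    exact ⟨F.mono hx.1, F.mono hx.2⟩
  have h3 : φ '' orb f (Icc u v) ⊆ φ '' B := by
    rintro _ ⟨_, hx, rfl⟩
    obtain ⟨i, t, ht, rfl⟩ := mem_orb.1 hx
    obtain ⟨b, hb, hbt⟩ := h2 (mem_image_of_mem φ ht)
    refine ⟨f^[i] b, h.mapsTo_basic.iterate i hb, ?_⟩
    rw [F.semiconj_iterate h (h.subset hb), hbt, F.semiconj_iterate h (hsub ht).1]
  calc φ '' M ⊆ φ '' closure (orb f (Icc u v)) := image_mono hd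
    _ ⊆ closure (φ '' orb f (Icc u v)) := image_closure_subset_closure_image F.cont
    _ ⊆ φ '' B := closure_minimal h3 hcl

theorem exists_basic_of_saturated (F : IsFactor f M B φ g) (h : IntervalCycle f M B)
    {u v y : unitInterval} (hsub : Icc (φ u) (φ v) ⊆ φ '' M)
    (hsat : ∀ y, φ y ∈ Ioo (φ u) (φ v) → y ∈ Icc u v) (hy : y ∈ Ioo (φ u) (φ v)) :
    ∃ b ∈ B, φ b = y ∧ b ∈ Icc u v := by
  have := hsub (Ioo_subset_Icc_self hy)
  rw [← F.image_basic h] at this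
  obtain ⟨b, hb, rfl⟩ := this
  exact ⟨b, hb, rfl, hsat b hy⟩

theorem fibre_encard_le (F : IsFactor f M B φ g) (y : unitInterval) :
    (B ∩ φ ⁻¹' {y}).encard ≤ 2 := by
  refine encard_le_two_of_not_between ?_
  rintro a ⟨haB, ha⟩ b ⟨hbB, hb⟩ c ⟨hcB, hc⟩ hab hbc
  exact (((F.eq_iff a c (hab.trans hbc).le).1 (Eq.trans ha (Eq.symm hc))).1.subset ⟨⟨hab, hbc⟩, hbB⟩ :
    b ∈ (∅ : Set unitInterval))

theorem interior_fibre_inter (F : IsFactor f M B φ g) (h : IntervalCycle f M B)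
    (y : unitInterval) : interior (M ∩ φ ⁻¹' {y}) ∩ B = ∅ := by
  rw [← not_nonempty_iff_eq_empty]
  rintro ⟨x, hx, hxB⟩
  obtain ⟨u, v, huv, hsub, hlt, -⟩ := F.exists_saturated h hxB (isOpen_interior.mem_nhds hx)
  have h1 := (interior_subset (hsub (left_mem_Icc.2 huv.le)).2).2
  have h2 := (interior_subset (hsub (right_mem_Icc.2 huv.le)).2).2
  rw [mem_preimage, mem_singleton_iff] at h1 h2
  exact hlt.ne (h1.trans h2.symm)

theorem fibre_ordConnected (F : IsFactor f M B φ g) (y : unitInterval) :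
    (M ∩ φ ⁻¹' {y}).OrdConnected := by
  refine ⟨fun a ha b hb t ht => ?_⟩
  have ha' : φ a = y := ha.2
  have hb' : φ b = y := hb.2
  have h1 := ((F.eq_iff a b (ht.1.trans ht.2)).1 (ha'.trans hb'.symm)).2
  have ht' : φ t = y := le_antisymm (hb' ▸ F.mono ht.2) (ha' ▸ F.mono ht.1)
  refine ⟨?_, ht'⟩
  rcases ht.1.eq_or_lt with rfl | h3
  · exact ha.1
  rcases ht.2.eq_or_lt with rfl | h4
  · exact hb.1
  exact h1 ⟨h3, h4⟩

theorem isTransitiveOn_image (F : IsFactor f M B φ g) (h : IntervalCycle f M B) :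
    IsTransitiveOn g (φ '' M) := by
  refine ⟨F.mapsTo_g h, ?_⟩
  rintro U V hU hV ⟨y, hyU, hyM⟩ ⟨_, hzV, z, hz, rfl⟩
  rw [← F.image_basic h] at hyM
  obtain ⟨b, hb, rfl⟩ := hyM
  have hd : DenseOrb f M (φ ⁻¹' U ∩ M) := h.denseOrb_of_mem_nhdsWithin hb
    (inter_mem (mem_nhdsWithin_of_mem_nhds (F.cont.continuousAt (hU.mem_nhds hyU)))
      self_mem_nhdsWithin)
  obtain ⟨i, -, _, ⟨x, ⟨hxU, hxM⟩, rfl⟩, hxV⟩ :=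
    h.exists_iterate_inter hd (hV.preimage F.cont) ⟨z, hzV, hz⟩ 0
  refine ⟨i, g^[i] (φ x), mem_image_of_mem _ ⟨hxU, mem_image_of_mem _ hxM⟩, ?_⟩
  rw [← F.semiconj_iterate h hxM]
  exact hxV

/-- Each open set meeting `B` contains an interval which includes the whole preimage of an open
interval of values. Such values are attained on `B`, so a transition of `g` lifts to one of `f`
between points of the right places. -/
theorem isTransitiveOn_basic (F : IsFactor f M B φ g) (h : IntervalCycle f M B) :
    IsTransitiveOn f B := by
  refine ⟨h.mapsTo_basic, ?_⟩
  rintro U V hU hV ⟨x, hxU, hx⟩ ⟨y, hyV, hy⟩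
  obtain ⟨u, v, huv, hsub, hlt, hIm, hsat⟩ := F.exists_saturated h hx (hU.mem_nhds hxU)
  obtain ⟨u', v', huv', hsub', hlt', hIm', hsat'⟩ := F.exists_saturated h hy (hV.mem_nhds hyV)
  obtain ⟨w, hw⟩ := exists_between hlt
  obtain ⟨w', hw'⟩ := exists_between hlt'
  obtain ⟨m, _, ⟨t, ⟨ht, -⟩, rfl⟩, htV⟩ := (F.isTransitiveOn_image h).2 _ _
    (isOpen_Ioo (a := φ u) (b := φ v)) (isOpen_Ioo (a := φ u') (b := φ v'))
    ⟨w, hw, hIm (Ioo_subset_Icc_self hw)⟩ ⟨w', hw', hIm' (Ioo_subset_Icc_self hw')⟩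
  obtain ⟨b, hb, rfl, hbuv⟩ := F.exists_basic_of_saturated h hIm hsat ht
  refine ⟨m, f^[m] b, mem_image_of_mem _ ⟨(hsub hbuv).2, hb⟩, ?_⟩
  rw [← F.semiconj_iterate h (h.subset hb)] at htV
  exact (hsub' (hsat' _ htV)).2

end IsFactor

/-! ### The cycle generated by a periodic interval. -/

namespace IsPeriodicInterval

variable {f : unitInterval → unitInterval} {n : ℕ} {I : Set unitInterval}

theorem image_add (hI : IsPeriodicInterval f n I) (i k : ℕ) :
    f^[i + n * k] '' I = f^[i] '' I := by
  induction k with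
  | zero => simp
  | succ k ih =>
    rw [← ih, show i + n * (k + 1) = (i + n * k) + n by ring, ← iterate_image_comp, hI.image_eq]

theorem image_mod (hI : IsPeriodicInterval f n I) (i : ℕ) :
    f^[i % n] '' I = f^[i] '' I := by
  rw [← hI.image_add (i % n) (i / n), Nat.mod_add_div]

theorem disjoint_of_mod_ne (hI : IsPeriodicInterval f n I) {i j : ℕ} (hij : i % n ≠ j % n) :
    Disjoint (f^[i] '' I) (f^[j] '' I) := by
  rw [← hI.image_mod i, ← hI.image_mod j]
  rcases lt_or_gt_of_ne hij with h | h
  · exact hI.disjoint _ _ h (Nat.mod_lt _ hI.pos)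
  · exact (hI.disjoint _ _ h (Nat.mod_lt _ hI.pos)).symm

theorem mod_eq_of_mem (hI : IsPeriodicInterval f n I) {i j : ℕ} {x : unitInterval}
    (hi : x ∈ f^[i] '' I) (hj : x ∈ f^[j] '' I) : i % n = j % n := by
  by_contra hne
  exact (hI.disjoint_of_mod_ne hne).le_bot ⟨hi, hj⟩

theorem orb_eq (hI : IsPeriodicInterval f n I) : orb f I = ⋃ i ∈ Finset.range n, f^[i] '' I := by
  apply Subset.antisymm
  · refine iUnion_subset fun i => ?_
    rw [← hI.image_mod i]
    exact subset_biUnion_of_mem (u := fun i => f^[i] '' I)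
      (Finset.mem_coe.2 (Finset.mem_range.2 (Nat.mod_lt _ hI.pos)))
  · exact iUnion₂_subset fun i _ => image_iterate_subset_orb i

theorem isCompact_iterate (hf : Continuous f) (hI : IsPeriodicInterval f n I) (i : ℕ) :
    IsCompact (f^[i] '' I) := by
  obtain ⟨a, b, -, rfl⟩ := hI.interval
  exact isCompact_Icc.image (hf.iterate i)

theorem exists_iterate_eq_Icc (hf : Continuous f) (hI : IsPeriodicInterval f n I) (i : ℕ) :
    ∃ a b, a < b ∧ f^[i] '' I = Icc a b := by
  obtain ⟨a, b, hab, hIab⟩ := hI.interval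
  have hconn : IsConnected (f^[i] '' I) := by
    rw [hIab]
    exact (isConnected_Icc hab.le).image _ (hf.iterate i).continuousOn
  have heq := eq_Icc_of_connected_compact hconn (hI.isCompact_iterate hf i)
  refine ⟨_, _, lt_of_not_ge fun hle => ?_, heq⟩
  have hsub : (f^[i] '' I).Subsingleton := by
    rw [heq]
    exact subsingleton_Icc_of_ge hle
  -- Another `n * i - i` steps complete a multiple of the period and recover the non-degenerate `I`.
  have hI' : f^[n * i - i] '' (f^[i] '' I) = I := by
    rw [iterate_image_comp, Nat.sub_add_cancel (Nat.le_mul_of_pos_left i hI.pos)]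
    simpa using hI.image_add 0 i
  have := hsub.image f^[n * i - i]
  rw [hI', hIab] at this
  exact hab.ne (this (left_mem_Icc.2 hab.le) (right_mem_Icc.2 hab.le))

/-- Each member of the cycle is relatively clopen in the orbit, so a connected subset of the orbit
stays in one member. -/
theorem exists_nhds (hf : Continuous f) (hI : IsPeriodicInterval f n I) (i : ℕ) :
    ∃ A, IsClosed A ∧ Disjoint (f^[i] '' I) A ∧ orb f I = f^[i] '' I ∪ A := by
  refine ⟨⋃ j ∈ {j | j < n ∧ j ≠ i % n}, f^[j] '' I, ?_, ?_, ?_⟩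
  · exact ((finite_lt_nat n).subset fun j hj => hj.1).isClosed_biUnion fun j _ =>
      (hI.isCompact_iterate hf j).isClosed
  · rw [disjoint_iUnion₂_right]
    rintro j ⟨hjn, hj⟩
    exact hI.disjoint_of_mod_ne (by rw [Nat.mod_eq_of_lt hjn]; exact hj.symm)
  · apply Subset.antisymm
    · rw [hI.orb_eq]
      refine iUnion₂_subset fun j hj => ?_
      by_cases hji : j = i % n
      · rw [hji, hI.image_mod]
        exact subset_union_left
      · exact Subset.trans (subset_biUnion_of_mem (u := fun j => f^[j] '' I)
          (show j ∈ {j | j < n ∧ j ≠ i % n} from ⟨Finset.mem_range.1 hj, hji⟩)) subset_union_right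
    · exact union_subset (image_iterate_subset_orb i)
        (iUnion₂_subset fun j _ => image_iterate_subset_orb j)

theorem subset_of_isPreconnected (hf : Continuous f) (hI : IsPeriodicInterval f n I)
    {K : Set unitInterval} (hK : IsPreconnected K) (hKM : K ⊆ orb f I) {i : ℕ} {x : unitInterval}
    (hx : x ∈ K) (hxi : x ∈ f^[i] '' I) : K ⊆ f^[i] '' I := by
  obtain ⟨A, hA, hd, heq⟩ := hI.exists_nhds hf i
  rcases isPreconnected_iff_subset_of_disjoint_closed.1 hK _ _
    (hI.isCompact_iterate hf i).isClosed hA (heq ▸ hKM)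
    (by rw [hd.inter_eq, inter_empty]) with h | h
  · exact h
  · exact absurd ⟨hxi, h hx⟩ fun hc => hd.le_bot hc

theorem iterate_mem_nhdsWithin (hf : Continuous f) (hI : IsPeriodicInterval f n I) {i : ℕ}
    {x : unitInterval} (hxi : x ∈ f^[i] '' I) : f^[i] '' I ∈ 𝓝[orb f I] x := by
  obtain ⟨A, hA, hd, heq⟩ := hI.exists_nhds hf i
  rw [mem_nhdsWithin]
  refine ⟨Aᶜ, hA.isOpen_compl, fun hxA => hd.le_bot ⟨hxi, hxA⟩, ?_⟩
  rintro y ⟨hyA, hyM⟩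
  rw [heq] at hyM
  exact hyM.resolve_right hyA

theorem intervalCycle (hf : Continuous f) (hI : IsPeriodicInterval f n I)
    (hinf : (basicSet f (orb f I)).Infinite) :
    IntervalCycle f (orb f I) (basicSet f (orb f I)) where
  cont := hf
  closed := by
    rw [hI.orb_eq]
    exact (Finset.finite_toSet _).isClosed_biUnion fun i _ => (hI.isCompact_iterate hf i).isClosed
  image_eq := by
    refine Subset.antisymm mapsTo_orb.image_subset ?_
    refine iUnion_subset fun i => ?_
    -- The index `i + n - 1` stands for the predecessor of `i` in the cycle and makes sense also for
    -- `i = 0`.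
    have : f^[i] '' I = f '' (f^[i + n - 1] '' I) := by
      rw [← hI.image_add i 1]
      have := iterate_image_comp f 1 (i + n - 1) I
      rw [Function.iterate_one] at this
      rw [this]
      congr 2
      have := hI.pos
      omega
    rw [this]
    exact image_mono (image_iterate_subset_orb _)
  loc := by
    intro x hx
    obtain ⟨i, hi⟩ := mem_iUnion.1 hx
    obtain ⟨a, b, hab, heq⟩ := hI.exists_iterate_eq_Icc hf i
    exact ⟨a, b, hab, heq ▸ hi, heq ▸ image_iterate_subset_orb i,
      heq ▸ hI.iterate_mem_nhdsWithin hf hi⟩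
  lift := by
    intro c d hcd hsub
    obtain ⟨i, hi⟩ := mem_iUnion.1 (hsub (left_mem_Icc.2 hcd))
    have h1 := hI.subset_of_isPreconnected hf isPreconnected_Icc hsub (left_mem_Icc.2 hcd) hi
    obtain ⟨a, b, hab, heq⟩ := hI.exists_iterate_eq_Icc hf (i + n - 1)
    have h2 : f^[i] '' I = f '' (f^[i + n - 1] '' I) := by
      rw [← hI.image_add i 1]
      have := iterate_image_comp f 1 (i + n - 1) I
      rw [Function.iterate_one] at this
      rw [this]
      congr 2
      have := hI.pos
      omega
    rw [h2, heq] at h1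
    obtain ⟨u, v, huv, huvab, himg⟩ := exists_Icc_image_eq hf.continuousOn hcd h1
    exact ⟨u, v, huv, huvab.trans (heq ▸ image_iterate_subset_orb _), himg⟩
  eq_basicSet := rfl
  infinite := hinf

end IsPeriodicInterval

variable {f : unitInterval → unitInterval} {n : ℕ} {I M B : Set unitInterval}
  {φ g : unitInterval → unitInterval}

/-- Points of `B` have preimages in `B`, and disjointness of the cycle forces an `i`-step preimage
of a point of `f^[i] '' I` to lie in `I`. -/
theorem basic_inter_iterate (hI : IsPeriodicInterval f n I)
    (h : IntervalCycle f (orb f I) B) (i : ℕ) :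
    B ∩ f^[i] '' I = f^[i] '' (B ∩ I) := by
  apply Subset.antisymm
  · rintro y ⟨hyB, hy⟩
    rw [← h.iterate_image_basic i] at hyB
    obtain ⟨x, hx, rfl⟩ := hyB
    obtain ⟨j, hj⟩ := mem_iUnion.1 (h.subset hx)
    refine ⟨x, ⟨hx, ?_⟩, rfl⟩
    have h1 : f^[i] x ∈ f^[i + j] '' I := by
      rw [← iterate_image_comp]
      exact mem_image_of_mem _ hj
    have h2 := hI.mod_eq_of_mem h1 hy
    have h3 : j % n = 0 % n := by
      have : i + j ≡ i + 0 [MOD n] := h2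
      exact Nat.ModEq.add_left_cancel' i this
    rw [← hI.image_mod, h3, hI.image_mod] at hj
    simpa using hj
  · rintro _ ⟨x, ⟨hxB, hx⟩, rfl⟩
    exact ⟨h.mapsTo_basic.iterate i hxB, mem_image_of_mem _ hx⟩

theorem basic_eq_biUnion (hI : IsPeriodicInterval f n I) (h : IntervalCycle f (orb f I) B) :
    B = ⋃ i ∈ Finset.range n, f^[i] '' (B ∩ I) := by
  calc B = B ∩ orb f I := (inter_eq_left.2 h.subset).symm
    _ = _ := by
      rw [hI.orb_eq, inter_iUnion₂]
      simp only [basic_inter_iterate hI h]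

theorem basic_inter_infinite (hI : IsPeriodicInterval f n I) (h : IntervalCycle f (orb f I) B) :
    (B ∩ I).Infinite := by
  intro hfin
  refine h.infinite ?_
  rw [basic_eq_biUnion hI h]
  exact (Finset.finite_toSet _).biUnion fun i _ => hfin.image _

namespace IsFactor

theorem image_iterate (F : IsFactor f (orb f I) B φ g) (h : IntervalCycle f (orb f I) B) {A : Set unitInterval}
    (hA : A ⊆ orb f I) (i : ℕ) : g^[i] '' (φ '' A) = φ '' (f^[i] '' A) := by
  ext y
  constructor
  · rintro ⟨_, ⟨x, hx, rfl⟩, rfl⟩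
    exact ⟨f^[i] x, mem_image_of_mem _ hx, F.semiconj_iterate h (hA hx) i⟩
  · rintro ⟨_, ⟨x, hx, rfl⟩, rfl⟩
    exact ⟨φ x, mem_image_of_mem _ hx, (F.semiconj_iterate h (hA hx) i).symm⟩

theorem orb_image (F : IsFactor f (orb f I) B φ g) (h : IntervalCycle f (orb f I) B) :
    orb g (φ '' I) = φ '' orb f I := by
  rw [orb, orb, image_iUnion]
  exact iUnion_congr fun i => F.image_iterate h subset_orb i

theorem isPeriodicInterval (F : IsFactor f (orb f I) B φ g) (h : IntervalCycle f (orb f I) B)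
    (hI : IsPeriodicInterval f n I) : IsPeriodicInterval g n (φ '' I) where
  pos := hI.pos
  interval := by
    have hinf := basic_inter_infinite hI h
    obtain ⟨a, b, hab, rfl⟩ := hI.interval
    refine ⟨φ a, φ b, F.lt_of_infinite hab.le hinf, Subset.antisymm ?_
      (intermediate_value_Icc hab.le F.cont.continuousOn)⟩
    rintro _ ⟨x, hx, rfl⟩
    exact ⟨F.mono hx.1, F.mono hx.2⟩
  disjoint := by
    intro i j hij hjn
    rw [F.image_iterate h subset_orb, F.image_iterate h subset_orb, Set.disjoint_left]
    rintro _ ⟨x, hx, rfl⟩ ⟨y, hy, hyx⟩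
    have hpre := (F.fibre_ordConnected (φ x)).isPreconnected
    have hxm : x ∈ orb f I ∩ φ ⁻¹' {φ x} := ⟨image_iterate_subset_orb i hx, rfl⟩
    have hym : y ∈ orb f I ∩ φ ⁻¹' {φ x} := ⟨image_iterate_subset_orb j hy, hyx⟩
    have := hI.subset_of_isPreconnected h.cont hpre inter_subset_left hxm hx hym
    exact (hI.disjoint i j hij hjn).le_bot ⟨this, hy⟩
  image_eq := by rw [F.image_iterate h subset_orb, hI.image_eq]

theorem almostConjugates (F : IsFactor f M B φ g) (h : IntervalCycle f M B) :
    AlmostConjugates φ f M B g (φ '' M) where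
  subset := h.subset
  mapsTo_domain := h.mapsTo
  mapsTo_subset := h.mapsTo_basic
  continuousOn := F.cont.continuousOn
  monotoneOn := F.mono.monotoneOn _
  mapsTo := mapsTo_image _ _
  semiconj := F.semiconj
  image_eq := F.image_basic h
  fibre_connected := by
    rintro _ ⟨x, hx, rfl⟩
    exact ⟨⟨x, hx, rfl⟩, (F.fibre_ordConnected _).isPreconnected⟩
  fibre_interior := fun y _ => F.interior_fibre_inter h y
  fibre_card := by
    intro y hy
    rw [← F.image_basic h] at hy
    obtain ⟨b, hb, rfl⟩ := hy
    exact ⟨one_le_encard_iff_nonempty.2 ⟨b, hb, rfl⟩, F.fibre_encard_le _⟩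

end IsFactor

/-- Baire's theorem in the compact space `B`: the points visiting a given basic open set that meets
`B` after time `N` form a dense open set. A point common to all of these has a limit set containing
`B`, and maximality gives equality. -/
theorem IntervalCycle.exists_omegaSet_eq (h : IntervalCycle f M B) (ht : IsTransitiveOn f B) :
    ∃ x ∈ B, omegaSet f x = B := by
  obtain ⟨b, hbc, -, hb⟩ := TopologicalSpace.exists_countable_basis unitInterval
  have : Countable b := hbc
  have : CompactSpace B := isCompact_iff_compactSpace.1 h.isClosed_basic.isCompact
  have : Nonempty B := h.infinite.nonempty.to_subtype
  let G : b × ℕ → Set B := fun p =>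
    {x | ((p.1 : Set unitInterval) ∩ B).Nonempty → ∃ m ≥ p.2, f^[m] x ∈ (p.1 : Set unitInterval)}
  have hGo : ∀ p, IsOpen (G p) := by
    rintro ⟨⟨V, hV⟩, N⟩
    by_cases hne : (V ∩ B).Nonempty
    · have : G ⟨⟨V, hV⟩, N⟩ = ⋃ m ∈ {m | N ≤ m}, (fun x : B => f^[m] x) ⁻¹' V := by
        ext x
        simp [G, hne]
      rw [this]
      exact isOpen_biUnion fun m _ =>
        (hb.isOpen hV).preimage ((h.cont.iterate m).comp continuous_subtype_val)
    · have : G ⟨⟨V, hV⟩, N⟩ = univ := by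
        ext x
        simp [G, hne]
      rw [this]
      exact isOpen_univ
  have hGd : ∀ p, Dense (G p) := by
    rintro ⟨⟨V, hV⟩, N⟩
    rw [dense_iff_inter_open]
    rintro U hU ⟨x, hx⟩
    by_cases hne : (V ∩ B).Nonempty
    · obtain ⟨W, hW, rfl⟩ := isOpen_induced_iff.1 hU
      obtain ⟨y, hyV, hy⟩ := hne
      have hy0 := hy
      rw [← h.iterate_image_basic N] at hy
      obtain ⟨z, hz, rfl⟩ := hy
      obtain ⟨m, _, ⟨t, ⟨htW, htB⟩, rfl⟩, htV⟩ := ht.2 W (f^[N] ⁻¹' V) hW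
        ((hb.isOpen hV).preimage (h.cont.iterate N)) ⟨x, hx, x.2⟩ ⟨z, hyV, hz⟩
      refine ⟨⟨t, htB⟩, htW, fun _ => ⟨N + m, by simp, ?_⟩⟩
      rw [Function.iterate_add_apply]
      exact htV
    · exact ⟨x, hx, fun hc => absurd hc hne⟩
  obtain ⟨⟨x, hxB⟩, hx⟩ := (dense_iInter_of_isOpen hGo hGd).nonempty
  refine ⟨x, hxB, h.omegaSet_eq_of_subset fun y hy => ?_⟩
  refine (mem_omegaLimit_iff_frequently _ _ _ _).2 fun U hU => ?_
  obtain ⟨V, hV, hyV, hVU⟩ := hb.mem_nhds_iff.1 hU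
  rw [frequently_atTop]
  intro N
  obtain ⟨m, hm, hmV⟩ := mem_iInter.1 hx ⟨⟨V, hV⟩, N⟩ ⟨y, hyV, hy⟩
  exact ⟨m, hm, x, rfl, hVU hmV⟩


/-! ### Transitive maps of the unit interval: mixing or exchange of halves. -/

theorem exists_Icc_subset_of_isOpen {O : Set unitInterval} (hO : IsOpen O) {x : unitInterval}
    (hx : x ∈ O) : ∃ u v, u < v ∧ x ∈ Icc u v ∧ Icc u v ⊆ O := by
  obtain ⟨u, v, huv, hxuv, hsub, -⟩ := exists_Icc_subset_of_mem_nhds (a := 0) (b := 1) zero_lt_one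
    ⟨unitInterval.nonneg', unitInterval.le_one'⟩ (hO.mem_nhds hx)
  exact ⟨u, v, huv, hxuv, fun t ht => (hsub ht).2⟩

namespace IsTransitiveOn

variable {G : unitInterval → unitInterval}

theorem exists_iterate (h : IsTransitiveOn G univ) {U V : Set unitInterval} (hU : IsOpen U)
    (hV : IsOpen V) (hUne : U.Nonempty) (hVne : V.Nonempty) : ∃ m, ∃ x ∈ U, G^[m] x ∈ V := by
  obtain ⟨m, _, ⟨x, hx, rfl⟩, hxV⟩ := h.2 U V hU hV (by simpa using hUne) (by simpa using hVne)
  exact ⟨m, x, hx.1, hxV⟩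

theorem of_exists_iterate (h : ∀ U V : Set unitInterval, IsOpen U → IsOpen V → U.Nonempty →
    V.Nonempty → ∃ m, ∃ x ∈ U, G^[m] x ∈ V) : IsTransitiveOn G univ := by
  refine ⟨mapsTo_univ _ _, fun U V hU hV hUne hVne => ?_⟩
  obtain ⟨m, x, hx, hxV⟩ := h U V hU hV (by simpa using hUne) (by simpa using hVne)
  exact ⟨m, _, mem_image_of_mem _ ⟨hx, mem_univ x⟩, hxV⟩

theorem eq_univ_of_mapsTo (h : IsTransitiveOn G univ) {A : Set unitInterval} (hA : IsClosed A)
    (hGA : MapsTo G A A) (hint : (interior A).Nonempty) : A = univ := by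
  by_contra hne
  obtain ⟨m, x, hx, hxA⟩ := h.exists_iterate isOpen_interior hA.isOpen_compl hint
    (nonempty_compl.2 hne)
  exact hxA (hGA.iterate m (interior_subset hx))

theorem eq_zero_one_of_mapsTo (h : IsTransitiveOn G univ) {a b : unitInterval} (hab : a < b)
    (hGA : MapsTo G (Icc a b) (Icc a b)) : a = 0 ∧ b = 1 := by
  have := h.eq_univ_of_mapsTo isClosed_Icc hGA (interior_Icc_nonempty hab)
  have h0 : (0 : unitInterval) ∈ Icc a b := this ▸ mem_univ _
  have h1 : (1 : unitInterval) ∈ Icc a b := this ▸ mem_univ _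
  exact ⟨le_antisymm h0.1 unitInterval.nonneg', le_antisymm unitInterval.le_one' h1.2⟩

theorem surjective (h : IsTransitiveOn G univ) (hG : Continuous G) : Function.Surjective G := by
  rw [← range_eq_univ, ← (isCompact_range hG).isClosed.closure_eq, ← dense_iff_closure_eq,
    dense_iff_inter_open]
  rintro V hV ⟨x, hx⟩
  obtain ⟨y, hy⟩ : ∃ y : unitInterval, y ≠ x := exists_ne x
  obtain ⟨U, W, hU, hW, hyU, hxW, hd⟩ := t2_separation hy
  obtain ⟨m, t, ht, htV⟩ := h.exists_iterate hU (hV.inter hW) ⟨y, hyU⟩ ⟨x, hx, hxW⟩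
  cases m with
  | zero => exact absurd ⟨ht, htV.2⟩ fun hc => hd.le_bot hc
  | succ m =>
    rw [Function.iterate_succ_apply'] at htV
    exact ⟨_, htV.1, mem_range_self _⟩

theorem exists_periodic (h : IsTransitiveOn G univ) (hG : Continuous G) {O : Set unitInterval}
    (hO : IsOpen O) (hne : O.Nonempty) : ∃ p ∈ O, ∃ r > 0, G^[r] p = p := by
  obtain ⟨x, hx⟩ := hne
  obtain ⟨u, v, huv, -, hsub⟩ := exists_Icc_subset_of_isOpen hO hx
  obtain ⟨w, hw1, hw2⟩ := exists_between huv
  have key : ∀ V V' : Set unitInterval, Disjoint V V' → IsOpen V → IsOpen V' → V.Nonempty →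
      V'.Nonempty → ∃ m > 0, ∃ t ∈ V, G^[m] t ∈ V' := by
    intro V V' hd hV hV' hne hne'
    obtain ⟨m, t, htV, htV'⟩ := h.exists_iterate hV hV' hne hne'
    refine ⟨m, Nat.pos_of_ne_zero ?_, t, htV, htV'⟩
    rintro rfl
    exact hd.le_bot ⟨htV, htV'⟩
  have hdis : Disjoint (Ioo u w) (Ioo w v) := by
    rw [Set.disjoint_left]
    exact fun t ht ht' => lt_asymm ht.2 ht'.1
  obtain ⟨m, hm, t, ht, ht'⟩ := key _ _ hdis isOpen_Ioo isOpen_Ioo (nonempty_Ioo.2 hw1)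
    (nonempty_Ioo.2 hw2)
  obtain ⟨k, hk, s, hs, hs'⟩ := key _ _ hdis.symm isOpen_Ioo isOpen_Ioo (nonempty_Ioo.2 hw2)
    (nonempty_Ioo.2 hw1)
  obtain ⟨z, hz, r, hr, hrz⟩ := exists_periodic_of_returns hG (ordConnected_Icc (a := u) (b := v))
    hm hk ⟨ht.1.le, (ht.2.trans hw2).le⟩ ⟨(hw1.trans ht'.1).le, ht'.2.le⟩ (ht.2.trans ht'.1)
    ⟨(hw1.trans hs.1).le, hs.2.le⟩ ⟨hs'.1.le, (hs'.2.trans hw2).le⟩ (hs'.2.trans hs.1)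
  exact ⟨z, hsub hz, r, hr, hrz⟩

/-- If an iterate collapsed an open set to `y`, a periodic point in that set would make `y`
periodic. From time `j` on, the set would visit only the finite orbit of `y`, against transitivity.
-/
theorem exists_iterate_ne (h : IsTransitiveOn G univ) (hG : Continuous G) {O : Set unitInterval}
    (hO : IsOpen O) (hne : O.Nonempty) (j : ℕ) (y : unitInterval) : ∃ x ∈ O, G^[j] x ≠ y := by
  by_contra! hcon
  obtain ⟨p, hp, r, hr, hrp⟩ := h.exists_periodic hG hO hne
  have hper : G^[r] y = y := by
    rw [← hcon p hp, ← Function.iterate_add_apply, add_comm, Function.iterate_add_apply, hrp]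
  have hfin : (range fun i => G^[i] y).Finite := by
    refine ((finite_Iio r).image fun i => G^[i] y).subset ?_
    rintro _ ⟨i, rfl⟩
    refine ⟨i % r, Nat.mod_lt _ hr, ?_⟩
    have hq : ∀ q, G^[r * q] y = y := fun q => by
      rw [Function.iterate_mul]
      exact Function.iterate_fixed hper q
    change G^[i % r] y = G^[i] y
    conv_rhs => rw [← Nat.mod_add_div i r, Function.iterate_add_apply, hq]
  have hVne : (range fun i => G^[i] y)ᶜ.Nonempty := by
    rw [nonempty_compl]
    intro hc
    exact (Icc_infinite (zero_lt_one (α := unitInterval))) (hfin.subset (hc ▸ subset_univ _))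
  obtain ⟨z, hz⟩ := hVne
  obtain ⟨w, rfl⟩ := (h.surjective hG).iterate j z
  obtain ⟨m, x, hx, hxV⟩ := h.exists_iterate hO
    (hfin.isClosed.isOpen_compl.preimage (hG.iterate j)) hne ⟨w, hz⟩
  refine hxV ⟨m, ?_⟩
  change G^[m] y = _
  rw [← hcon x hx, ← Function.iterate_add_apply, ← Function.iterate_add_apply, add_comm]

theorem exists_mem_ne (h : IsTransitiveOn G univ) (hG : Continuous G) {u v : unitInterval}
    (huv : u < v) (j : ℕ) (y : unitInterval) : ∃ x ∈ Ioo u v, G^[j] x ≠ y :=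
  h.exists_iterate_ne hG isOpen_Ioo (nonempty_Ioo.2 huv) j y

/-- A totally transitive interval map is mixing. -/
theorem isMixing (h : ∀ k > 0, IsTransitiveOn G^[k] univ) (hG : Continuous G) : IsMixing G := by
  intro U V hU hV hUne hVne
  have h1 : IsTransitiveOn G univ := h 1 one_pos
  obtain ⟨p, hp, r, hr, hrp⟩ := h1.exists_periodic hG hU hUne
  have hV' : (V ∩ Ioo 0 1).Nonempty := by
    obtain ⟨x, hx⟩ := hVne
    obtain ⟨u, v, huv, -, hsub⟩ := exists_Icc_subset_of_isOpen hV hx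
    obtain ⟨w, hw1, hw2⟩ := exists_between huv
    exact ⟨w, hsub ⟨hw1.le, hw2.le⟩, unitInterval.nonneg'.trans_lt hw1,
      hw2.trans_le unitInterval.le_one'⟩
  obtain ⟨q, ⟨hqV, hq0, hq1⟩, r', hr', hrq⟩ := h1.exists_periodic hG (hV.inter isOpen_Ioo) hV'
  obtain ⟨u, v, huv, hpuv, hsub⟩ := exists_Icc_subset_of_isOpen hU hp
  set k := r * r' with hk
  have hkpos : 0 < k := Nat.mul_pos hr hr'
  have hkp : ∀ s, G^[k * s] p = p := fun s => by
    rw [hk, mul_assoc, Function.iterate_mul]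
    exact Function.iterate_fixed hrp _
  have hkq : ∀ s, G^[k * s] q = q := fun s => by
    rw [hk, mul_comm r, mul_assoc, Function.iterate_mul]
    exact Function.iterate_fixed hrq _
  -- The images at the times `k * s + i` share the point `G^[i] p`, and their union is dense because
  -- `G^[k]` is transitive. A dense connected set contains the interior point `q`.
  have key : ∀ i, ∃ s, q ∈ G^[k * s + i] '' Icc u v := by
    intro i
    have hpre : IsPreconnected (⋃ s : ℕ, G^[k * s + i] '' Icc u v) := by
      refine isPreconnected_iUnion ⟨G^[i] p, mem_iInter.2 fun s => ⟨p, hpuv, ?_⟩⟩ fun s =>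
        isPreconnected_Icc.image _ (hG.iterate _).continuousOn
      rw [add_comm, Function.iterate_add_apply, hkp]
    have hdense : ∀ W : Set unitInterval, IsOpen W → W.Nonempty →
        ∃ y ∈ ⋃ s : ℕ, G^[k * s + i] '' Icc u v, y ∈ W := by
      rintro W hW ⟨w, hw⟩
      obtain ⟨t, rfl⟩ := (h1.surjective hG).iterate i w
      obtain ⟨s, x, hx, hxW⟩ := (h k hkpos).exists_iterate isOpen_Ioo
        (hW.preimage (hG.iterate i)) (nonempty_Ioo.2 huv) ⟨t, hw⟩
      refine ⟨_, mem_iUnion.2 ⟨s, x, Ioo_subset_Icc_self hx, rfl⟩, ?_⟩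
      rw [add_comm, Function.iterate_add_apply, Function.iterate_mul]
      exact hxW
    obtain ⟨y, hy, hyq⟩ := hdense (Iio q) isOpen_Iio ⟨0, hq0⟩
    obtain ⟨y', hy', hyq'⟩ := hdense (Ioi q) isOpen_Ioi ⟨1, hq1⟩
    exact mem_iUnion.1 (hpre.ordConnected.out hy hy' ⟨le_of_lt hyq, le_of_lt hyq'⟩)
  choose s hs using key
  -- Since `G^[k]` fixes `q`, a visit at time `k * s i + i` repeats at every later time of the same
  -- residue. The sum dominates all the `s i`.
  refine ⟨k * ∑ i ∈ Finset.range k, s i, fun m hm => ⟨q, ?_, hqV⟩⟩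
  have h2 : s (m % k) ≤ m / k := by
    refine (Finset.single_le_sum (f := s) (fun _ _ => Nat.zero_le _)
      (Finset.mem_range.2 (Nat.mod_lt m hkpos))).trans ?_
    rw [Nat.le_div_iff_mul_le hkpos, mul_comm]
    exact hm
  obtain ⟨t, ht, hq⟩ := hs (m % k)
  refine ⟨t, hsub ht, ?_⟩
  obtain ⟨d, hd⟩ := Nat.exists_eq_add_of_le' h2
  have : m = k * d + (k * s (m % k) + m % k) := by
    conv_lhs => rw [← Nat.div_add_mod m k, hd]
    ring
  rw [this, Function.iterate_add_apply]
  have h3 := hq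
  rw [h3, hkq]

/-- The dichotomy for transitive interval maps: either all iterates are transitive, or the two
halves determined by some fixed point are exchanged. -/
theorem totally_or_swap (h : IsTransitiveOn G univ) (hG : Continuous G) :
    (∀ k > 0, IsTransitiveOn G^[k] univ) ∨
    ∃ c, 0 < c ∧ c < 1 ∧ G c = c ∧ (∀ x ≤ c, c ≤ G x) ∧ (∀ x, c ≤ x → G x ≤ c) := by
  by_contra! hcon
  obtain ⟨⟨k, hk, hnt⟩, hnoswap⟩ := hcon
  obtain ⟨U, V, hU, hV, hUne, hVne, hUV⟩ : ∃ U V : Set unitInterval, IsOpen U ∧ IsOpen V ∧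
      U.Nonempty ∧ V.Nonempty ∧ ∀ m, ∀ x ∈ U, (G^[k])^[m] x ∉ V := by
    by_contra! hc
    exact hnt (of_exists_iterate hc)
  obtain ⟨p, hp, r, hr, hrp⟩ := h.exists_periodic hG hU hUne
  obtain ⟨u, v, huv, hpuv, hsub⟩ := exists_Icc_subset_of_isOpen hU hp
  set K := k * r with hK
  have hKpos : 0 < K := Nat.mul_pos hk hr
  -- The images share the periodic point `p`, so `S` is connected; it is `G^[K]`-invariant and
  -- misses `V`. The images `L j` of its closure are closed intervals, carried by `G` from one to
  -- the next, and they cover the unit interval.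
  set S := ⋃ s : ℕ, G^[K * s] '' Icc u v with hS
  have hSpre : IsPreconnected S := by
    refine isPreconnected_iUnion ⟨p, mem_iInter.2 fun s => ⟨p, hpuv, ?_⟩⟩ fun s =>
      isPreconnected_Icc.image _ (hG.iterate _).continuousOn
    rw [hK, mul_comm k, mul_assoc, Function.iterate_mul]
    exact Function.iterate_fixed hrp _
  have hSV : Disjoint (closure S) V := by
    refine Disjoint.closure_left ?_ hV
    rw [Set.disjoint_left]
    intro x hx hxV
    obtain ⟨s, t, ht, rfl⟩ := mem_iUnion.1 hx
    rw [hK, mul_assoc, Function.iterate_mul] at hxV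
    exact hUV _ t (hsub ht) hxV
  have hSK : MapsTo G^[K] S S := by
    intro x hx
    obtain ⟨s, t, ht, rfl⟩ := mem_iUnion.1 hx
    refine mem_iUnion.2 ⟨s + 1, t, ht, ?_⟩
    rw [mul_add, mul_one, add_comm, Function.iterate_add_apply]
  set L : ℕ → Set unitInterval := fun j => G^[j] '' closure S with hL
  have hLcl : ∀ j, IsClosed (L j) := fun j =>
    (isClosed_closure.isCompact.image (hG.iterate j)).isClosed
  have hLoc : ∀ j, (L j).OrdConnected := fun j =>
    (hSpre.closure.image _ (hG.iterate j).continuousOn).ordConnected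
  have hLs : ∀ j, ∀ x ∈ L j, G x ∈ L (j + 1) := by
    rintro j _ ⟨x, hx, rfl⟩
    exact ⟨x, hx, Function.iterate_succ_apply' _ _ _⟩
  have hLK : ∀ j q, L (j + K * q) ⊆ L j := by
    intro j q
    induction q with
    | zero => simp
    | succ q ih =>
      refine Subset.trans ?_ ih
      rintro _ ⟨x, hx, rfl⟩
      refine ⟨G^[K] x, hSK.closure (hG.iterate K) hx, ?_⟩
      rw [show j + K * (q + 1) = j + K * q + K by ring, Function.iterate_add_apply _ (j + K * q)]
  have hL0 : Icc u v ⊆ L 0 := by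
    intro x hx
    refine ⟨x, subset_closure (mem_iUnion.2 ⟨0, x, hx, ?_⟩), rfl⟩
    simp
  have hcover : ∀ x, ∃ j, x ∈ L j := by
    have h1 : (⋃ j ∈ Finset.range K, L j) = univ := by
      refine h.eq_univ_of_mapsTo ((Finset.finite_toSet _).isClosed_biUnion fun j _ => hLcl j) ?_ ?_
      · intro x hx
        obtain ⟨j, hj, hxj⟩ := mem_iUnion₂.1 hx
        rcases Nat.lt_or_ge (j + 1) K with hlt | hge
        · exact mem_iUnion₂.2 ⟨j + 1, Finset.mem_range.2 hlt, hLs j x hxj⟩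
        · have : j + 1 = 0 + K * 1 := by
            have := Finset.mem_range.1 hj
            omega
          exact mem_iUnion₂.2 ⟨0, Finset.mem_range.2 hKpos, hLK 0 1 (this ▸ hLs j x hxj)⟩
      · refine (interior_Icc_nonempty huv).mono (interior_mono (hL0.trans ?_))
        exact subset_biUnion_of_mem (u := L) (Finset.mem_coe.2 (Finset.mem_range.2 hKpos))
    intro x
    obtain ⟨j, -, hj⟩ := mem_iUnion₂.1 (h1.symm.subset (mem_univ x))
    exact ⟨j, hj⟩
  obtain ⟨c, -, hc⟩ := exists_mem_Icc_isFixedPt (a := 0) (b := 1) hG.continuousOn zero_le_one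
    unitInterval.nonneg' unitInterval.le_one'
  have hcL : ∀ j, c ∈ L j := by
    intro j
    obtain ⟨j₀, hj₀⟩ := hcover c
    have h1 : ∀ i, c ∈ L (j₀ + i) := by
      intro i
      induction i with
      | zero => exact hj₀
      | succ i ih =>
        have := hLs _ _ ih
        rwa [hc] at this
    refine hLK j j₀ ?_
    have h2 : j₀ ≤ j + K * j₀ := (Nat.le_mul_of_pos_left j₀ hKpos).trans (Nat.le_add_left _ _)
    obtain ⟨d, hd⟩ := Nat.exists_eq_add_of_le h2
    rw [hd]
    exact h1 d
  have hLne : ∀ j, ∃ x ∈ L j, x ≠ c := by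
    intro j
    obtain ⟨x, hx, hxc⟩ := h.exists_mem_ne hG huv j c
    obtain ⟨y, hy, hyx⟩ := hL0 (Ioo_subset_Icc_self hx)
    have hyx' : y = x := hyx
    exact ⟨_, ⟨x, hyx' ▸ hy, rfl⟩, hxc⟩
  -- The intersection of the `L j` is closed, invariant and proper, so it has empty interior. As all
  -- `L j` contain the fixed point `c`, some `L i` must lie to the right of `c` and some `L j` to
  -- the left.
  have hE : (⋂ j ∈ Finset.range K, L j) ≠ univ := by
    intro hc
    obtain ⟨w, hw⟩ := hVne
    have : w ∈ L 0 := mem_iInter₂.1 (hc.symm.subset (mem_univ w)) 0 (Finset.mem_range.2 hKpos)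
    obtain ⟨y, hy, hyw⟩ := this
    have hyw' : y = w := hyw
    exact hSV.le_bot ⟨hy, hyw' ▸ hw⟩
  have hEmaps : MapsTo G (⋂ j ∈ Finset.range K, L j) (⋂ j ∈ Finset.range K, L j) := by
    intro x hx
    refine mem_iInter₂.2 fun j hj => ?_
    cases j with
    | zero =>
      have h1 := hLs _ _ (mem_iInter₂.1 hx (K - 1) (Finset.mem_range.2 (by omega)))
      rw [show K - 1 + 1 = 0 + K * 1 by omega] at h1
      exact hLK 0 1 h1
    | succ j =>
      exact hLs _ _ (mem_iInter₂.1 hx j (Finset.mem_range.2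
        ((Nat.lt_succ_self j).trans (Finset.mem_range.1 hj))))
  have hEcl : IsClosed (⋂ j ∈ Finset.range K, L j) := isClosed_biInter fun j _ => hLcl j
  obtain ⟨i, hi⟩ : ∃ i, ∀ x ∈ L i, c ≤ x := by
    by_contra! hcon
    obtain ⟨y, -, hyc⟩ := hcon 0
    have hmem : (⋂ j ∈ Finset.range K, L j) ∈ 𝓝[<] c := by
      refine (Filter.biInter_finset_mem _).2 fun j _ => ?_
      obtain ⟨x, hx, hxc⟩ := hcon j
      exact mem_of_superset (Ioo_mem_nhdsLT hxc) fun t ht =>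
        (hLoc j).out hx (hcL j) ⟨ht.1.le, ht.2.le⟩
    obtain ⟨l, hl, hlE⟩ := (mem_nhdsLT_iff_exists_Ioo_subset' hyc).1 hmem
    obtain ⟨w, hw⟩ := exists_between (mem_Iio.1 hl)
    exact hE (h.eq_univ_of_mapsTo hEcl hEmaps ⟨w, mem_interior.2 ⟨_, hlE, isOpen_Ioo, hw⟩⟩)
  obtain ⟨j, hj⟩ : ∃ j, ∀ x ∈ L j, x ≤ c := by
    by_contra! hcon
    obtain ⟨y, -, hyc⟩ := hcon 0
    have hmem : (⋂ j ∈ Finset.range K, L j) ∈ 𝓝[>] c := by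
      refine (Filter.biInter_finset_mem _).2 fun j _ => ?_
      obtain ⟨x, hx, hxc⟩ := hcon j
      exact mem_of_superset (Ioo_mem_nhdsGT hxc) fun t ht =>
        (hLoc j).out (hcL j) hx ⟨ht.1.le, ht.2.le⟩
    obtain ⟨l, hl, hlE⟩ := (mem_nhdsGT_iff_exists_Ioo_subset' hyc).1 hmem
    obtain ⟨w, hw⟩ := exists_between (mem_Ioi.1 hl)
    exact hE (h.eq_univ_of_mapsTo hEcl hEmaps ⟨w, mem_interior.2 ⟨_, hlE, isOpen_Ioo, hw⟩⟩)
  obtain ⟨xi, hxi, hxic⟩ := hLne i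
  obtain ⟨xj, hxj, hxjc⟩ := hLne j
  have hxi' : c < xi := lt_of_le_of_ne (hi xi hxi) (Ne.symm hxic)
  have hxj' : xj < c := lt_of_le_of_ne (hj xj hxj) hxjc
  -- Near `c` the map must change sides: otherwise points to the right of `c` would persist along
  -- all later sets, including those contained in the left-hand `L j`.
  obtain ⟨ε, hε, hεG⟩ : ∃ ε > c, ∀ s ∈ Icc c ε, G s ≤ c := by
    by_contra! hcon
    have hstep : ∀ m, ∃ x ∈ L (i + m), c < x := by
      intro m
      induction m with
      | zero => exact ⟨xi, hxi, hxi'⟩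
      | succ m ih =>
        obtain ⟨x, hx, hxc⟩ := ih
        obtain ⟨s, hs, hsc⟩ := hcon x hxc
        exact ⟨G s, hLs _ _ ((hLoc _).out (hcL _) hx hs), hsc⟩
    have h2 : i ≤ j + K * i := (Nat.le_mul_of_pos_left i hKpos).trans (Nat.le_add_left _ _)
    obtain ⟨d, hd⟩ := Nat.exists_eq_add_of_le h2
    obtain ⟨x, hx, hxc⟩ := hstep d
    exact (hj x (hLK j i (hd ▸ hx))).not_gt hxc
  obtain ⟨δ, hδ, hδG⟩ : ∃ δ < c, ∀ s ∈ Icc δ c, c ≤ G s := by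
    by_contra! hcon
    have hstep : ∀ m, ∃ x ∈ L (j + m), x < c := by
      intro m
      induction m with
      | zero => exact ⟨xj, hxj, hxj'⟩
      | succ m ih =>
        obtain ⟨x, hx, hxc⟩ := ih
        obtain ⟨s, hs, hsc⟩ := hcon x hxc
        exact ⟨G s, hLs _ _ ((hLoc _).out hx (hcL _) hs), hsc⟩
    have h2 : j ≤ i + K * j := (Nat.le_mul_of_pos_left j hKpos).trans (Nat.le_add_left _ _)
    obtain ⟨d, hd⟩ := Nat.exists_eq_add_of_le h2
    obtain ⟨x, hx, hxc⟩ := hstep d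
    exact (hi x (hLK i j (hd ▸ hx))).not_gt hxc
  have hRL : ∀ m, (∃ x ∈ L m, c < x) → ∃ x ∈ L (m + 1), x < c := by
    rintro m ⟨x, hx, hxc⟩
    obtain ⟨s, hs, hsc⟩ := h.exists_mem_ne hG (lt_min hxc hε) 1 c
    rw [Function.iterate_one] at hsc
    have hs1 := hs.2.trans_le (min_le_left _ _)
    have hs2 := hs.2.trans_le (min_le_right _ _)
    exact ⟨G s, hLs _ _ ((hLoc _).out (hcL _) hx ⟨hs.1.le, hs1.le⟩),
      lt_of_le_of_ne (hεG s ⟨hs.1.le, hs2.le⟩) hsc⟩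
  have hLR : ∀ m, (∃ x ∈ L m, x < c) → ∃ x ∈ L (m + 1), c < x := by
    rintro m ⟨x, hx, hxc⟩
    obtain ⟨s, hs, hsc⟩ := h.exists_mem_ne hG (max_lt hxc hδ) 1 c
    rw [Function.iterate_one] at hsc
    have hs1 := (le_max_left _ _).trans_lt hs.1
    have hs2 := (le_max_right _ _).trans_lt hs.1
    exact ⟨G s, hLs _ _ ((hLoc _).out hx (hcL _) ⟨hs1.le, hs.2.le⟩),
      lt_of_le_of_ne (hδG s ⟨hs2.le, hs.2.le⟩) hsc.symm⟩
  -- A set with points on both sides of `c` would have only such successors, yet some of these lie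
  -- inside the one-sided `L i`.
  have hboth : ∀ m, (∃ x ∈ L m, c < x) → ¬ ∃ x ∈ L m, x < c := by
    intro m hR hLm
    have hstep : ∀ d, (∃ x ∈ L (m + d), c < x) ∧ ∃ x ∈ L (m + d), x < c := by
      intro d
      induction d with
      | zero => exact ⟨hR, hLm⟩
      | succ d ih => exact ⟨hLR _ ih.2, hRL _ ih.1⟩
    have h2 : m ≤ i + K * m := (Nat.le_mul_of_pos_left m hKpos).trans (Nat.le_add_left _ _)
    obtain ⟨d, hd⟩ := Nat.exists_eq_add_of_le h2
    obtain ⟨x, hx, hxc⟩ := (hstep d).2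
    exact (hi x (hLK i m (hd ▸ hx))).not_gt hxc
  -- If the exchange fails, some point and its image are on the same side of `c`. The next set
  -- contains this image and, by the local change of sides, a point on the other side.
  obtain ⟨x, hx, hGx, hxc⟩ | ⟨x, hx, hGx⟩ :
      (∃ x ≤ c, G x < c ∧ x < c) ∨ ∃ x, c < x ∧ c < G x := by
    by_contra! hcon
    obtain ⟨h1, h2⟩ := hcon
    obtain ⟨x, hx, hx'⟩ := hnoswap c (unitInterval.nonneg'.trans_lt hxj')
      (hxi'.trans_le unitInterval.le_one') hc (fun x hx => by
        rcases hx.lt_or_eq with hlt | rfl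
        · by_contra hcc
          exact hlt.not_ge (h1 x hx (not_le.1 hcc))
        · exact le_of_eq (Eq.symm hc))
    rcases hx.lt_or_eq with hlt | rfl
    · exact (h2 x hlt).not_gt hx'
    · exact hx'.ne (Eq.symm hc)
  · obtain ⟨m, hm⟩ := hcover x
    exact hboth (m + 1) (hLR m ⟨x, hm, hxc⟩) ⟨G x, hLs _ _ hm, hGx⟩
  · obtain ⟨m, hm⟩ := hcover x
    exact hboth (m + 1) ⟨G x, hLs _ _ hm, hGx⟩ (hRL m ⟨x, hm, hx⟩)


/-! ### Horseshoes of transitive maps. -/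

variable {G H : unitInterval → unitInterval}

/-- Otherwise a fixed point `c` of `G` is the only fixed point of `G ∘ G`, and both maps move points
towards `c`'s side: up below `c`, down above it. This yields a proper invariant interval, which
transitivity forbids. -/
theorem exists_two_fixed_sq (h : IsTransitiveOn G univ) (hG : Continuous G) :
    ∃ z z', z < z' ∧ G (G z) = z ∧ G (G z') = z' := by
  by_contra! hcon
  obtain ⟨c, -, hc⟩ := exists_mem_Icc_isFixedPt (a := 0) (b := 1) hG.continuousOn zero_le_one
    unitInterval.nonneg' unitInterval.le_one'
  have hc' : G c = c := hc
  have huniq : ∀ z, G (G z) = z → z = c := by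
    intro z hz
    rcases lt_trichotomy z c with hlt | rfl | hlt
    · exact absurd (by rw [hc', hc']) (hcon z c hlt hz)
    · rfl
    · exact absurd hz (hcon c z hlt (by rw [hc', hc']))
  have hlow : ∀ K : unitInterval → unitInterval, Continuous K → (∀ z, K z = z → z = c) →
      ∀ s < c, s < K s := by
    intro K hK hKu s hs
    by_contra hle
    obtain ⟨z, hz, hzf⟩ := exists_mem_Icc_isFixedPt (a := 0) (b := s) hK.continuousOn
      unitInterval.nonneg' unitInterval.nonneg' (not_lt.1 hle)
    exact (hz.2.trans_lt hs).ne (hKu z hzf)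
  have hhigh : ∀ K : unitInterval → unitInterval, Continuous K → (∀ z, K z = z → z = c) →
      ∀ s, c < s → K s < s := by
    intro K hK hKu s hs
    by_contra hle
    obtain ⟨z, hz, hzf⟩ := exists_mem_Icc_isFixedPt (a := s) (b := 1) hK.continuousOn
      unitInterval.le_one' (not_lt.1 hle) unitInterval.le_one'
    exact (hs.trans_le hz.1).ne' (hKu z hzf)
  have hu1 : ∀ z, G z = z → z = c := fun z hz => huniq z (by rw [hz, hz])
  rcases (unitInterval.nonneg' : 0 ≤ c).eq_or_lt with rfl | hcpos
  · obtain ⟨s, hs0, hs1⟩ := exists_between (zero_lt_one (α := unitInterval))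
    have := h.eq_zero_one_of_mapsTo hs0 (fun x hx => by
      rcases hx.1.eq_or_lt with rfl | hx0
      · exact ⟨unitInterval.nonneg', by rw [hc']; exact hs0.le⟩
      · exact ⟨unitInterval.nonneg', (hhigh G hG hu1 x hx0).le.trans hx.2⟩)
    exact hs1.ne this.2
  · obtain ⟨s, hs0, hsc⟩ := exists_between hcpos
    -- The invariant interval runs from `s` to the maximum of `G` on `Icc s c`. A point above `c` in
    -- it is the image of some point of `Icc s c`, so its own image is controlled by `G ∘ G`.
    obtain ⟨t, ht, hmax⟩ := isCompact_Icc.exists_isMaxOn (nonempty_Icc.2 hsc.le) hG.continuousOn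
    have hmax' : ∀ x ∈ Icc s c, G x ≤ G t := fun x hx => hmax hx
    have hcv : c ≤ G t := hc'.symm.trans_le (hmax' c (right_mem_Icc.2 hsc.le))
    have := h.eq_zero_one_of_mapsTo (hsc.trans_le hcv) (fun x hx => by
      rcases lt_trichotomy x c with hxc | rfl | hxc
      · exact ⟨hx.1.trans (hlow G hG hu1 x hxc).le, hmax' x ⟨hx.1, hxc.le⟩⟩
      · rw [hc']
        exact ⟨hx.1, hx.2⟩
      · refine ⟨?_, (hhigh G hG hu1 x hxc).le.trans hx.2⟩
        obtain ⟨y, hy, rfl⟩ := intermediate_value_Icc' ht.2 hG.continuousOn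
          (show x ∈ Icc (G c) (G t) from ⟨by rw [hc']; exact hxc.le, hx.2⟩)
        rcases hy.2.lt_or_eq with hlt | rfl
        · exact (ht.1.trans hy.1).trans (hlow (G ∘ G) (hG.comp hG) huniq y hlt).le
        · rw [hc', hc']
          exact hsc.le)
    exact hs0.ne' this.1

/-- The fixed point `a` is the last point up to `t` that does not move right, and `b` is the first
later point sent to `a`. Transitivity supplies both `b` and `c`, since without them there would be a
proper invariant interval or a failure of surjectivity. -/
theorem exists_turbulent_right (h : IsTransitiveOn H univ) (hH : Continuous H)
    {z₁ t : unitInterval} (hz : H z₁ = z₁) (hzt : z₁ < t) (ht : t < H t) :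
    ∃ a c b, a < c ∧ c < b ∧ H a = a ∧ H b = a ∧ b ≤ H c := by
  have hK : IsCompact (Icc z₁ t ∩ {s | H s ≤ s}) :=
    (isClosed_Icc.inter (isClosed_le hH continuous_id)).isCompact
  obtain ⟨z, ⟨hzI, hzle⟩, hzmax⟩ := hK.exists_isGreatest ⟨z₁, left_mem_Icc.2 hzt.le, hz.le⟩
  change H z ≤ z at hzle
  have hzt' : z < t := lt_of_le_of_ne hzI.2 (by rintro rfl; exact hzle.not_gt ht)
  have hup : ∀ s, z < s → s ≤ t → s < H s := by
    intro s hs hst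
    by_contra hle
    exact (hzmax ⟨⟨hzI.1.trans hs.le, hst⟩, not_lt.1 hle⟩).not_gt hs
  have hzfix : H z = z := by
    refine le_antisymm hzle ?_
    obtain ⟨w, hw, hwf⟩ := exists_mem_Icc_isFixedPt (a := z) (b := z) hH.continuousOn le_rfl
      (by
        by_contra hlt
        rw [not_le] at hlt
        have hn : ∀ᶠ s in 𝓝[>] z, H s < s := nhdsWithin_le_nhds
          ((isOpen_lt hH continuous_id).mem_nhds hlt)
        obtain ⟨l, hl, hls⟩ := (mem_nhdsGT_iff_exists_Ioo_subset' hzt').1 hn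
        obtain ⟨w, hw1, hw2⟩ := exists_between (lt_min hl hzt')
        exact lt_asymm (hup w hw1 (hw2.le.trans (min_le_right _ _)))
          (hls ⟨hw1, hw2.trans_le (min_le_left _ _)⟩)) hzle
    have : w = z := le_antisymm hw.2 hw.1
    exact (this ▸ hwf : H z = z).ge
  have ht1 : t < 1 := ht.trans_le unitInterval.le_one'
  -- Otherwise `Icc z 1` is invariant. For `z = 0` this is no contradiction, and the left end is
  -- raised to `min (H m) t`, with `H m > 0` the minimum on `Icc t 1`.
  have hret : ∃ t₁, t < t₁ ∧ H t₁ ≤ z := by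
    by_contra! hcon
    have hpos : ∀ s, z < s → z < H s := by
      intro s hs
      rcases le_or_gt s t with hst | hst
      · exact hs.trans (hup s hs hst)
      · exact hcon s hst
    rcases (unitInterval.nonneg' : 0 ≤ z).eq_or_lt with rfl | hz0
    · obtain ⟨m, hm, hmin⟩ := isCompact_Icc.exists_isMinOn (nonempty_Icc.2 ht1.le) hH.continuousOn
      have hmin' : ∀ x ∈ Icc t 1, H m ≤ H x := fun x hx => hmin hx
      have hm0 : 0 < H m := hpos m (hzt'.trans_le hm.1)
      have := h.eq_zero_one_of_mapsTo (a := min (H m) t) (b := 1)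
        ((min_le_right _ _).trans_lt ht1) (fun x hx => by
          refine ⟨?_, unitInterval.le_one'⟩
          rcases le_or_gt x t with hxt | hxt
          · exact hx.1.trans (hup x ((lt_min hm0 hzt').trans_le hx.1) hxt).le
          · exact (min_le_left _ _).trans (hmin' x ⟨hxt.le, hx.2⟩))
      exact (lt_min hm0 hzt').ne' this.1
    · have := h.eq_zero_one_of_mapsTo (a := z) (b := 1) (hzt'.trans ht1) (fun x hx => by
        refine ⟨?_, unitInterval.le_one'⟩
        rcases hx.1.eq_or_lt with rfl | hlt
        · exact hzfix.ge
        · exact (hpos x hlt).le)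
      exact hz0.ne' this.1
  obtain ⟨t₁, htt₁, hHt₁⟩ := hret
  have hK' : IsCompact (Icc t t₁ ∩ {s | H s ≤ z}) :=
    (isClosed_Icc.inter (isClosed_le hH continuous_const)).isCompact
  obtain ⟨b, ⟨hbI, hble⟩, hbmin⟩ := hK'.exists_isLeast ⟨t₁, right_mem_Icc.2 htt₁.le, hHt₁⟩
  change H b ≤ z at hble
  have hbt : t < b := lt_of_le_of_ne hbI.1 (by
    rintro rfl
    exact (hzt'.trans ht).not_ge hble)
  have hge : ∀ s, z ≤ s → s < b → z ≤ H s := by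
    intro s hs hsb
    rcases hs.eq_or_lt with rfl | hs
    · exact hzfix.ge
    rcases le_or_gt s t with hst | hst
    · exact (hs.trans (hup s hs hst)).le
    · by_contra hle
      exact (hbmin ⟨⟨hst.le, hsb.le.trans hbI.2⟩, (not_le.1 hle).le⟩).not_gt hsb
  have hbz : H b = z := by
    refine le_antisymm hble ?_
    by_contra hlt
    rw [not_le] at hlt
    have hn : ∀ᶠ s in 𝓝[<] b, H s < z := nhdsWithin_le_nhds
      ((isOpen_lt hH continuous_const).mem_nhds hlt)
    obtain ⟨l, hl, hls⟩ := (mem_nhdsLT_iff_exists_Ioo_subset' hbt).1 hn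
    obtain ⟨w, hw1, hw2⟩ := exists_between (max_lt hl hbt)
    have h1 : H w < z := hls ⟨(le_max_left _ _).trans_lt hw1, hw2⟩
    exact h1.not_ge (hge w (hzt'.trans ((le_max_right _ _).trans_lt hw1)).le hw2)
  have hzb : z < b := hzt'.trans hbt
  obtain ⟨c, hc, hcb⟩ : ∃ c ∈ Icc z b, b ≤ H c := by
    by_contra! hcon
    obtain ⟨h0, h1⟩ := h.eq_zero_one_of_mapsTo hzb (fun x hx => by
      refine ⟨?_, (hcon x hx).le⟩
      rcases hx.2.lt_or_eq with hlt | rfl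
      · exact hge x hx.1 hlt
      · exact hbz.ge)
    obtain ⟨x, hx⟩ := h.surjective hH 1
    have := hcon x ⟨h0.trans_le unitInterval.nonneg', unitInterval.le_one'.trans_eq h1.symm⟩
    rw [hx, h1] at this
    exact lt_irrefl _ this
  refine ⟨z, c, b, lt_of_le_of_ne hc.1 ?_, lt_of_le_of_ne hc.2 ?_, hzfix, hbz, hcb⟩
  · rintro rfl
    rw [hzfix] at hcb
    exact hzb.not_ge hcb
  · rintro rfl
    rw [hbz] at hcb
    exact hzb.not_ge hcb

theorem conj_symm (h : IsTransitiveOn H univ) :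
    IsTransitiveOn (fun x => unitInterval.symm (H (unitInterval.symm x))) univ := by
  have hit : ∀ m x, (fun x => unitInterval.symm (H (unitInterval.symm x)))^[m] x =
      unitInterval.symm (H^[m] (unitInterval.symm x)) := by
    intro m x
    induction m with
    | zero => simp
    | succ m ih =>
      rw [Function.iterate_succ_apply', Function.iterate_succ_apply', ih, unitInterval.symm_symm]
  refine of_exists_iterate ?_
  rintro U V hU hV ⟨x, hx⟩ ⟨y, hy⟩
  obtain ⟨m, w, hw, hwV⟩ := h.exists_iterate (hU.preimage unitInterval.continuous_symm)
    (hV.preimage unitInterval.continuous_symm)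
    ⟨unitInterval.symm x, by rwa [mem_preimage, unitInterval.symm_symm]⟩
    ⟨unitInterval.symm y, by rwa [mem_preimage, unitInterval.symm_symm]⟩
  refine ⟨m, unitInterval.symm w, hw, ?_⟩
  rw [hit, unitInterval.symm_symm]
  exact hwV

/-- A transitive interval map with two fixed points has a horseshoe: two intervals with one common
point, each covering both of them. -/
theorem exists_horseshoe (h : IsTransitiveOn H univ) (hH : Continuous H) {z z' : unitInterval}
    (hzz : z < z') (hz : H z = z) (hz' : H z' = z') :
    ∃ x c y, x < c ∧ c < y ∧ Icc x y ⊆ H '' Icc x c ∧ Icc x y ⊆ H '' Icc c y ∧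
      (H c ≤ x ∨ y ≤ H c) := by
  obtain ⟨t, ht, htne⟩ : ∃ t ∈ Ioo z z', H t ≠ t := by
    by_contra! hcon
    obtain ⟨s, hs1, hs2⟩ := exists_between hzz
    obtain ⟨s', hs1', hs2'⟩ := exists_between hs2
    have := h.eq_zero_one_of_mapsTo hs1' (fun x hx => by
      rw [hcon x ⟨hs1.trans_le hx.1, hx.2.trans_lt hs2'⟩]
      exact hx)
    exact (unitInterval.nonneg'.trans_lt hs1).ne' this.1
  rcases lt_or_gt_of_ne htne with hlt | hlt
  · have hlt' : unitInterval.symm t < unitInterval.symm (H (unitInterval.symm (unitInterval.symm t))) := by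
      rw [unitInterval.symm_symm]
      exact unitInterval.symm_lt_symm.2 hlt
    obtain ⟨a, c, b, hac, hcb, ha, hb, hc⟩ := exists_turbulent_right h.conj_symm
      (unitInterval.continuous_symm.comp (hH.comp unitInterval.continuous_symm))
      (z₁ := unitInterval.symm z') (t := unitInterval.symm t) (by
        rw [unitInterval.symm_symm, hz'])
      (unitInterval.symm_lt_symm.2 ht.2) hlt'
    have ha' : H (unitInterval.symm a) = unitInterval.symm a := by
      rw [← unitInterval.symm_inj, ha, unitInterval.symm_symm]
    have hb' : H (unitInterval.symm b) = unitInterval.symm a := by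
      rw [← unitInterval.symm_inj, hb, unitInterval.symm_symm]
    have hc' : H (unitInterval.symm c) ≤ unitInterval.symm b := by
      rw [← unitInterval.symm_le_symm, unitInterval.symm_symm]
      exact hc
    have h1 := unitInterval.symm_lt_symm.2 hac
    have h2 := unitInterval.symm_lt_symm.2 hcb
    refine ⟨unitInterval.symm b, unitInterval.symm c, unitInterval.symm a, h2, h1, ?_, ?_,
      Or.inl hc'⟩
    · refine Subset.trans ?_ (intermediate_value_Icc' h2.le hH.continuousOn)
      exact Icc_subset_Icc hc' hb'.ge
    · refine Subset.trans ?_ (intermediate_value_Icc h1.le hH.continuousOn)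
      exact Icc_subset_Icc hc' ha'.ge
  · obtain ⟨a, c, b, hac, hcb, ha, hb, hc⟩ := h.exists_turbulent_right hH hz ht.1 hlt
    refine ⟨a, c, b, hac, hcb, ?_, ?_, Or.inr hc⟩
    · refine Subset.trans ?_ (intermediate_value_Icc hac.le hH.continuousOn)
      exact Icc_subset_Icc ha.le hc
    · refine Subset.trans ?_ (intermediate_value_Icc' hcb.le hH.continuousOn)
      exact Icc_subset_Icc hb.le hc

end IsTransitiveOn

/-! ### Counting itineraries: entropy from a horseshoe. -/

/-- A horseshoe of `H` yields, for `H^[m]`, about `2 ^ m / 4` disjoint closed intervals each of which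
covers all of them. -/
theorem exists_disjoint_horseshoe {H : unitInterval → unitInterval} (hH : Continuous H)
    {x c y : unitInterval} (hxc : x < c) (hcy : c < y) (h1 : Icc x y ⊆ H '' Icc x c)
    (h2 : Icc x y ⊆ H '' Icc c y) (hc : H c ≤ x ∨ y ≤ H c) (m : ℕ) :
    ∃ (ι : Type) (_ : Fintype ι) (C : ι → Set unitInterval), 2 ^ m + 1 ≤ Fintype.card ι ∧
      (∀ i, ∃ u v, u ≤ v ∧ C i = Icc u v) ∧ (∀ i, C i ⊆ Icc x y) ∧
      (∀ i, Icc x y ⊆ H^[m + 2] '' C i) ∧ ∀ i j, i ≠ j → Disjoint (C i) (C j) := by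
  have hpull : ∀ a b, Icc x y ⊆ H '' Icc a b → ∀ C : Set unitInterval,
      (∃ u v, u ≤ v ∧ C = Icc u v) → C ⊆ Icc x y → ∃ C', (∃ u v, u ≤ v ∧ C' = Icc u v) ∧
        C' ⊆ Icc a b ∧ H '' C' = C := by
    rintro a b hab _ ⟨u, v, huv, rfl⟩ hsub
    obtain ⟨u', v', huv', hsub', himg⟩ := exists_Icc_image_eq hH.continuousOn huv (hsub.trans hab)
    exact ⟨_, ⟨u', v', huv', rfl⟩, hsub', himg⟩
  have hdisj : ∀ A A' C C' : Set unitInterval, A ⊆ Icc x c → A' ⊆ Icc c y → H '' A = C →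
      H '' A' = C' → ¬ (H c ∈ C ∧ H c ∈ C') → Disjoint A A' := by
    rintro A A' C C' hA hA' rfl rfl hn
    rw [Set.disjoint_left]
    intro t ht ht'
    have : t = c := le_antisymm (hA ht).2 (hA' ht').1
    subst this
    exact hn ⟨mem_image_of_mem _ ht, mem_image_of_mem _ ht'⟩
  have hl : Icc x c ⊆ Icc x y := Icc_subset_Icc_right hcy.le
  have hr : Icc c y ⊆ Icc x y := Icc_subset_Icc_left hxc.le
  have hcov : ∀ k, ∀ A C : Set unitInterval, H '' A = C → Icc x y ⊆ H^[k] '' C →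
      Icc x y ⊆ H^[k + 1] '' A := by
    rintro k A _ rfl h
    rwa [← iterate_image_comp, Function.iterate_one]
  induction m with
  | zero =>
    -- By `hc`, one of the two halves misses `H c`. Its preimages in the two halves then avoid the
    -- common endpoint `c` and are disjoint.
    obtain ⟨C₀, hC₀, hC₀s, hC₀c, hcC₀⟩ : ∃ C₀ : Set unitInterval, (∃ u v, u ≤ v ∧ C₀ = Icc u v) ∧
        C₀ ⊆ Icc x y ∧ Icc x y ⊆ H '' C₀ ∧ H c ∉ C₀ := by
      rcases hc with hc | hc
      · exact ⟨Icc c y, ⟨c, y, hcy.le, rfl⟩, hr, h2, fun hm => (hc.trans_lt hxc).not_ge hm.1⟩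
      · exact ⟨Icc x c, ⟨x, c, hxc.le, rfl⟩, hl, h1, fun hm => (hcy.trans_le hc).not_ge hm.2⟩
    obtain ⟨A, hA, hAs, hAC⟩ := hpull x c h1 C₀ hC₀ hC₀s
    obtain ⟨A', hA', hAs', hAC'⟩ := hpull c y h2 C₀ hC₀ hC₀s
    have hd := hdisj A A' _ _ hAs hAs' hAC hAC' fun hn => hcC₀ hn.1
    have hC₀c' : Icc x y ⊆ H^[1] '' C₀ := by rwa [Function.iterate_one]
    refine ⟨Bool, inferInstance, fun b => cond b A A', by simp, ?_, ?_, ?_, ?_⟩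
    · rintro (_ | _)
      exacts [hA', hA]
    · rintro (_ | _)
      exacts [hAs'.trans hr, hAs.trans hl]
    · rintro (_ | _)
      exacts [hcov 1 _ _ hAC' hC₀c', hcov 1 _ _ hAC hC₀c']
    · rintro (_ | _) (_ | _) hij
      exacts [absurd rfl hij, hd.symm, hd, absurd rfl hij]
  | succ m ih =>
    obtain ⟨ι, _, C, hcard, hC, hCs, hCc, hCd⟩ := ih
    choose A hA hAs hAC using fun i => hpull x c h1 (C i) (hC i) (hCs i)
    choose A' hA' hAs' hAC' using fun i => hpull c y h2 (C i) (hC i) (hCs i)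
    classical
    have himg : ∀ (D D' : Set unitInterval) (i j : ι), H '' D = C i → H '' D' = C j → i ≠ j →
        Disjoint D D' := by
      intro D D' i j hD hD' hij
      exact Disjoint.of_image (f := H) (by rw [hD, hD']; exact hCd i j hij)
    -- Every `C i` is pulled back into both halves, except that the right-hand copy is dropped for
    -- the at most one index with `H c ∈ C i`. So `N` intervals become at least `2 * N - 1`, which
    -- preserves the bound `2 ^ m + 1`.
    refine ⟨ι ⊕ {i // H c ∉ C i}, inferInstance, Sum.elim A fun i => A' i.1, ?_, ?_, ?_, ?_, ?_⟩
    · have hsub : Fintype.card {i // H c ∈ C i} ≤ 1 := by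
        rw [Fintype.card_le_one_iff_subsingleton]
        refine ⟨fun i j => Subtype.ext ?_⟩
        by_contra hne
        exact (hCd i j hne).le_bot ⟨i.2, j.2⟩
      have hcompl := Fintype.card_subtype_compl (fun i => H c ∈ C i)
      rw [Fintype.card_sum, pow_succ]
      omega
    · rintro (i | i)
      exacts [hA i, hA' i]
    · rintro (i | i)
      exacts [(hAs i).trans hl, (hAs' i).trans hr]
    · rintro (i | i)
      exacts [hcov _ _ _ (hAC i) (hCc i), hcov _ _ _ (hAC' i) (hCc i)]
    · rintro (i | i) (j | j) hij
      · exact himg _ _ i j (hAC i) (hAC j) fun he => hij (by rw [he])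
      · exact hdisj _ _ _ _ (hAs i) (hAs' j) (hAC i) (hAC' j) fun hn => j.2 hn.2
      · exact (hdisj _ _ _ _ (hAs j) (hAs' i) (hAC j) (hAC' i) fun hn => i.2 hn.2).symm
      · exact himg _ _ i j (hAC' i) (hAC' j) fun he => hij (by rw [Subtype.ext he])

theorem exists_itinerary {ι : Type} {R : unitInterval → unitInterval} {D : Set unitInterval}
    (hD : D.Nonempty) {C : ι → Set unitInterval} (hCD : ∀ i, C i ⊆ D)
    (hR : ∀ i, D ⊆ R '' C i) (l : ℕ) (w : ℕ → ι) :
    ∃ y ∈ D, ∀ s < l, R^[s] y ∈ C (w s) := by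
  induction l generalizing w with
  | zero =>
    obtain ⟨y, hy⟩ := hD
    exact ⟨y, hy, fun s hs => absurd hs (Nat.not_lt_zero s)⟩
  | succ l ih =>
    obtain ⟨y, hy, hys⟩ := ih fun s => w (s + 1)
    obtain ⟨t, ht, rfl⟩ := hR (w 0) hy
    refine ⟨t, hCD _ ht, fun s hs => ?_⟩
    cases s with
    | zero => exact ht
    | succ s => exact hys s (by omega)


/-- Disjoint closed sets whose itineraries along multiples of `p` are all realised in `F` bound the
topological entropy from below. -/
theorem log_card_div_le_coverEntropy {X : Type*} [UniformSpace X] [CompactSpace X] {T : X → X}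
    {F : Set X} {ι : Type*} [Fintype ι] {E : ι → Set X} {p N : ℕ} (hp : 0 < p) (hN : 0 < N)
    (hcard : N ≤ Fintype.card ι) (hE : ∀ i, IsClosed (E i))
    (hd : ∀ i j, i ≠ j → Disjoint (E i) (E j))
    (hit : ∀ (l : ℕ) (w : ℕ → ι), ∃ x ∈ F, ∀ s < l, T^[p * s] x ∈ E (w s)) :
    ((Real.log N / p : ℝ) : EReal) ≤ Dynamics.coverEntropy T F := by
  classical
  -- Pairs of points in different sets `E i` form a closed set off the diagonal, so its complement
  -- is an entourage.
  let K : Set (X × X) := ⋃ q ∈ {q : ι × ι | q.1 ≠ q.2}, E q.1 ×ˢ E q.2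
  have hK : IsClosed K := (toFinite _).isClosed_biUnion fun q _ => (hE _).prod (hE _)
  have hKu : Kᶜ ∈ uniformity X := by
    rw [compactSpace_uniformity, mem_iSup]
    intro x
    refine hK.isOpen_compl.mem_nhds fun hx => ?_
    obtain ⟨q, hq, hx⟩ := mem_iUnion₂.1 hx
    exact (hd _ _ hq).le_bot ⟨hx.1, hx.2⟩
  obtain ⟨V, hV, hVs, hVK⟩ := comp_symm_mem_uniformity_sets hKu
  -- The growth rate is a limit superior, so it is enough to count at the times `p * l`.
  refine le_trans (Frequently.le_expGrowthSup ?_) (Dynamics.netEntropyEntourage_le_coverEntropy T F hV)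
  rw [frequently_atTop]
  intro l
  refine ⟨p * l, Nat.le_mul_of_pos_left l hp, ?_⟩
  have i₀ : ι := (Fintype.card_pos_iff.1 (hN.trans_le hcard)).some
  choose x hxF hx using fun w : Fin l → ι =>
    hit l fun s => if hs : s < l then w ⟨s, hs⟩ else i₀
  have hx' : ∀ (w : Fin l → ι) (s : Fin l), T^[p * s] (x w) ∈ E (w s) := by
    intro w s
    have := hx w s s.2
    rwa [dif_pos s.2] at this
  have hinj : Function.Injective x := by
    intro w w' hww
    funext s
    by_contra hne
    exact (hd _ _ hne).le_bot ⟨hx' w s, hww ▸ hx' w' s⟩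
  -- A point common to the dynamical balls of two of the chosen points would, as `V ○ V` avoids `K`,
  -- keep their orbits out of different sets `E i` at every multiple of `p`, although their
  -- itineraries differ.
  have hnet : Dynamics.IsDynNetIn T F V (p * l) (Finset.univ.image x : Finset X) := by
    constructor
    · intro y hy
      obtain ⟨w, -, rfl⟩ := Finset.mem_image.1 (Finset.mem_coe.1 hy)
      exact hxF w
    · intro y hy y' hy' hne
      obtain ⟨w, -, rfl⟩ := Finset.mem_image.1 (Finset.mem_coe.1 hy)
      obtain ⟨w', -, rfl⟩ := Finset.mem_image.1 (Finset.mem_coe.1 hy')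
      obtain ⟨s, hs⟩ := Function.ne_iff.1 fun hww : w = w' => hne (by rw [hww])
      rw [Function.onFun, Set.disjoint_left]
      intro t ht ht'
      have hlt : p * (s : ℕ) < p * l := Nat.mul_lt_mul_of_pos_left s.2 hp
      have h1 := Dynamics.mem_dynEntourage.1 ht _ hlt
      have h2 := Dynamics.mem_dynEntourage.1 ht' _ hlt
      have h3 : (T^[p * s] (x w), T^[p * s] (x w')) ∈ K :=
        mem_iUnion₂.2 ⟨(w s, w' s), hs, ⟨hx' w s, hx' w' s⟩⟩
      exact hVK ⟨_, h1, hVs.symm _ _ h2⟩ h3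
  have hle := hnet.card_le_netMaxcard
  rw [Finset.card_image_of_injective _ hinj, Finset.card_univ, Fintype.card_fun,
    Fintype.card_fin] at hle
  have hle' : ((N ^ l : ℕ) : ENat) ≤ Dynamics.netMaxcard T F V (p * l) :=
    le_trans (by exact_mod_cast Nat.pow_le_pow_left hcard l) hle
  have hle'' := ENat.toENNReal_mono hle'
  refine le_trans (le_of_eq ?_) hle''
  have hexp : (Real.log N / p : ℝ) * ((p * l : ℕ) : ℝ) = Real.log N * l := by
    have : (p : ℝ) ≠ 0 := by positivity
    push_cast
    field_simp
  have hcast : ((Real.log N / p : ℝ) : EReal) * ((p * l : ℕ) : EReal) =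
      ((Real.log N * l : ℝ) : EReal) := by
    rw [← hexp, EReal.coe_mul]
    rfl
  rw [hcast, EReal.exp_coe, mul_comm, Real.exp_nat_mul, Real.exp_log (by exact_mod_cast hN)]
  simp [ENNReal.ofReal_pow]

/-- A horseshoe in a factor of an iterate bounds the topological entropy from below. -/
theorem log_two_div_le_coverEntropy {f ψ H : unitInterval → unitInterval} {J B S : Set unitInterval}
    {k : ℕ} (hk : 0 < k) (hH : Continuous H) (hψ : Continuous ψ) (hJ : IsClosed J)
    (hJm : MapsTo f^[k] J J) (hs : ∀ x ∈ J, ψ (f^[k] x) = H (ψ x)) (hSB : S ⊆ B) (hSJ : S ⊆ J)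
    (hSψ : ψ '' S = univ)
    (hhs : ∃ x c y, x < c ∧ c < y ∧ Icc x y ⊆ H '' Icc x c ∧ Icc x y ⊆ H '' Icc c y ∧
      (H c ≤ x ∨ y ≤ H c)) :
    ((Real.log 2 / (k : ℝ) : ℝ) : EReal) ≤ Dynamics.coverEntropy f B := by
  obtain ⟨x, c, y, hxc, hcy, h1, h2, hc⟩ := hhs
  have hit : ∀ s, ∀ x ∈ J, ψ (f^[k * s] x) = H^[s] (ψ x) := by
    intro s x hx
    rw [Function.iterate_mul]
    induction s with
    | zero => rfl
    | succ s ih => rw [Function.iterate_succ_apply', Function.iterate_succ_apply', ← ih,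
        hs _ (hJm.iterate s hx)]
  -- There are at least `2 ^ m` disjoint sets for `k * (m + 2)` steps; the loss factor `m / (m + 2)`
  -- disappears as `m` grows.
  have key : ∀ m : ℕ, ((m / (m + 2) * (Real.log 2 / k) : ℝ) : EReal) ≤
      Dynamics.coverEntropy f B := by
    intro m
    obtain ⟨ι, _, C, hcard, hC, hCs, hCc, hCd⟩ := exists_disjoint_horseshoe hH hxc hcy h1 h2 hc m
    have := log_card_div_le_coverEntropy (T := f) (F := B) (E := fun i => J ∩ ψ ⁻¹' C i)
      (p := k * (m + 2)) (N := 2 ^ m) (by positivity) (by positivity) (by omega)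
      (fun i => by
        obtain ⟨u, v, -, huv⟩ := hC i
        exact hJ.inter ((huv ▸ isClosed_Icc).preimage hψ))
      (fun i j hij => ((hCd i j hij).preimage ψ).mono inter_subset_right inter_subset_right)
      (fun l w => by
        obtain ⟨t, -, ht⟩ := exists_itinerary (nonempty_Icc.2 (hxc.trans hcy).le) hCs hCc l w
        obtain ⟨z, hz, rfl⟩ := hSψ.ge (mem_univ t)
        refine ⟨z, hSB hz, fun s hsl => ⟨?_, ?_⟩⟩
        · rw [mul_assoc, Function.iterate_mul]
          exact hJm.iterate _ (hSJ hz)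
        · rw [mem_preimage, mul_assoc, hit _ _ (hSJ hz), Function.iterate_mul]
          exact ht s hsl)
    convert this using 2
    have : (k : ℝ) ≠ 0 := by positivity
    push_cast
    rw [Real.log_pow]
    field_simp
  have hlim : Tendsto (fun m : ℕ => (m / (m + 2) * (Real.log 2 / k) : ℝ)) atTop
      (𝓝 (1 * (Real.log 2 / k))) :=
    (tendsto_natCast_div_add_atTop (2 : ℝ)).mul_const _
  rw [one_mul] at hlim
  exact le_of_tendsto' ((continuous_coe_real_ereal.tendsto _).comp hlim) key


/-! ### Rescaling an invariant interval to the unit interval. -/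

/-- `α` is a continuous monotone map whose restriction to `Icc p q` is an isomorphism onto the unit
interval, with inverse `β`. -/
structure IsRescaling (p q : unitInterval) (α β : unitInterval → unitInterval) : Prop where
  cont : Continuous α
  cont_inv : Continuous β
  mono : Monotone α
  mem : ∀ s, β s ∈ Icc p q
  left_inv : ∀ t ∈ Icc p q, β (α t) = t
  right_inv : ∀ s, α (β s) = s

theorem exists_isRescaling {p q : unitInterval} (hpq : p < q) : ∃ α β, IsRescaling p q α β := by
  have hpq' : (p : ℝ) < q := hpq
  have hpos : 0 < (q : ℝ) - p := sub_pos.2 hpq'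
  have hmem : ∀ s : unitInterval, (p : ℝ) + s * (q - p) ∈ Icc (p : ℝ) q := by
    intro s
    have h0 := s.2.1
    have h1 := s.2.2
    constructor <;> nlinarith
  refine ⟨fun t => projIcc 0 1 zero_le_one (((t : ℝ) - p) / (q - p)),
    fun s => ⟨p + s * (q - p), p.2.1.trans (hmem s).1, (hmem s).2.trans q.2.2⟩, ?_, ?_, ?_, hmem,
    ?_, ?_⟩
  · exact continuous_projIcc.comp (by fun_prop)
  · exact Continuous.subtype_mk (by fun_prop) _
  · refine (monotone_projIcc _).comp fun s t hst => ?_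
    have : (s : ℝ) ≤ t := hst
    gcongr
  · intro t ht
    have h1 : (p : ℝ) ≤ t := ht.1
    have h2 : (t : ℝ) ≤ q := ht.2
    have hm : ((t : ℝ) - p) / (q - p) ∈ Icc (0 : ℝ) 1 :=
      ⟨div_nonneg (by linarith) hpos.le, (div_le_one hpos).2 (by linarith)⟩
    rw [Subtype.ext_iff]
    simp only [projIcc_of_mem _ hm]
    field_simp
    ring
  · intro s
    have : ((p : ℝ) + s * (q - p) - p) / (q - p) = s := by
      field_simp
      ring
    simp only [this]
    exact projIcc_val _ s

namespace IsRescaling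

variable {p q : unitInterval} {α β K : unitInterval → unitInterval}

theorem iterate (R : IsRescaling p q α β) (hK : MapsTo K (Icc p q) (Icc p q)) (m : ℕ)
    (s : unitInterval) : (α ∘ K ∘ β)^[m] s = α (K^[m] (β s)) := by
  induction m with
  | zero => exact (R.right_inv s).symm
  | succ m ih =>
    rw [Function.iterate_succ_apply', Function.iterate_succ_apply', ih, Function.comp_apply,
      Function.comp_apply, R.left_inv _ (hK.iterate m (R.mem s))]

theorem continuous_conj (R : IsRescaling p q α β) (hK : ContinuousOn K (Icc p q)) :
    Continuous (α ∘ K ∘ β) :=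
  R.cont.comp (hK.comp_continuous R.cont_inv R.mem)

theorem isTransitiveOn (R : IsRescaling p q α β) (hpq : p < q)
    (hK : MapsTo K (Icc p q) (Icc p q))
    (ht : ∀ U V : Set unitInterval, IsOpen U → IsOpen V → U ⊆ Ioo p q → V ⊆ Ioo p q →
      U.Nonempty → V.Nonempty → ∃ m, ∃ x ∈ U, K^[m] x ∈ V) :
    IsTransitiveOn (α ∘ K ∘ β) univ := by
  have hne : ∀ U : Set unitInterval, IsOpen U → U.Nonempty → (α ⁻¹' U ∩ Ioo p q).Nonempty := by
    rintro U hU ⟨s, hs⟩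
    have h1 : β s ∈ closure (Ioo p q) := by
      rw [closure_Ioo hpq.ne]
      exact R.mem s
    exact mem_closure_iff.1 h1 _ (hU.preimage R.cont) (by rwa [mem_preimage, R.right_inv])
  refine IsTransitiveOn.of_exists_iterate fun U V hU hV hUne hVne => ?_
  obtain ⟨m, x, ⟨hxU, hxI⟩, hxV⟩ := ht _ _ ((hU.preimage R.cont).inter isOpen_Ioo)
    ((hV.preimage R.cont).inter isOpen_Ioo) inter_subset_right inter_subset_right
    (hne U hU hUne) (hne V hV hVne)
  refine ⟨m, α x, hxU, ?_⟩
  rw [R.iterate hK, R.left_inv _ (Ioo_subset_Icc_self hxI)]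
  exact hxV.1

theorem apply_left (R : IsRescaling p q α β) : α p = 0 := by
  refine le_antisymm ?_ unitInterval.nonneg'
  calc α p ≤ α (β 0) := R.mono (R.mem 0).1
    _ = 0 := R.right_inv 0

theorem inv_zero (R : IsRescaling p q α β) (hpq : p ≤ q) : β 0 = p := by
  rw [← R.apply_left, R.left_inv _ (left_mem_Icc.2 hpq)]

theorem injOn (R : IsRescaling p q α β) : InjOn α (Icc p q) := fun s hs t ht hst => by
  rw [← R.left_inv s hs, hst, R.left_inv t ht]

theorem image_Icc (R : IsRescaling p q α β) : α '' Icc p q = univ :=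
  eq_univ_of_forall fun s => ⟨β s, R.mem s, R.right_inv s⟩

end IsRescaling

namespace IsFactor

variable {f φ g α β : unitInterval → unitInterval} {M B J S : Set unitInterval}
  {p q : unitInterval} {k : ℕ}

theorem continuousOn_iterate (F : IsFactor f M B φ g) (h : IntervalCycle f M B) (i : ℕ) :
    ContinuousOn g^[i] (φ '' M) :=
  F.cont_g.iterate (F.mapsTo_g h) i

/-- On `J` the values of `φ` lie in `Icc p q`, where `α` is injective, so the fibres of `α ∘ φ` are
those of `φ`. -/
theorem almostConjugates_rescaling (F : IsFactor f M B φ g) (h : IntervalCycle f M B)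
    (R : IsRescaling p q α β) (hJM : J ⊆ M) (hJ : J.OrdConnected) (hJm : MapsTo f^[k] J J)
    (hSm : MapsTo f^[k] S S) (hSB : S ⊆ B) (hSJ : S ⊆ J) (hJφ : φ '' J = Icc p q)
    (hSφ : φ '' S = Icc p q) :
    AlmostConjugates (α ∘ φ) f^[k] J S (α ∘ g^[k] ∘ β) univ := by
  have hJp : ∀ x ∈ J, φ x ∈ Icc p q := fun x hx => hJφ ▸ mem_image_of_mem φ hx
  have hfib : ∀ y, J ∩ (α ∘ φ) ⁻¹' {y} = J ∩ φ ⁻¹' {β y} := by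
    intro y
    ext x
    refine and_congr_right fun hx => ⟨?_, ?_⟩
    · rintro rfl
      exact (R.left_inv _ (hJp x hx)).symm
    · intro hxy
      have : φ x = β y := hxy
      rw [mem_preimage, Function.comp_apply, this, R.right_inv]
      rfl
  have hfibS : ∀ y, S ∩ (α ∘ φ) ⁻¹' {y} = S ∩ φ ⁻¹' {β y} := by
    intro y
    rw [← inter_eq_left.2 hSJ, inter_assoc, hfib, ← inter_assoc]
  have hSne : ∀ y, (S ∩ φ ⁻¹' {β y}).Nonempty := by
    intro y
    obtain ⟨x, hx, hxy⟩ := hSφ.ge (R.mem y)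
    exact ⟨x, hx, hxy⟩
  refine ⟨hSJ, hJm, hSm, (R.cont.comp F.cont).continuousOn, (R.mono.comp F.mono).monotoneOn _,
    mapsTo_univ _ _, ?_, ?_, ?_, ?_, ?_⟩
  · intro x hx
    simp only [Function.comp_apply]
    rw [F.semiconj_iterate h (hJM hx), R.left_inv _ (hJp x hx)]
  · rw [image_comp, hSφ, R.image_Icc]
  · intro y _
    rw [hfib]
    refine ⟨(hSne y).mono (inter_subset_inter_left _ hSJ), ?_⟩
    exact (hJ.inter (ordConnected_singleton.preimage_mono F.mono)).isPreconnected
  · intro y _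
    rw [hfib]
    refine subset_eq_empty ?_ (F.interior_fibre_inter h (β y))
    exact inter_subset_inter (interior_mono (inter_subset_inter_left _ hJM)) hSB
  · intro y _
    rw [hfibS]
    exact ⟨one_le_encard_iff_nonempty.2 (hSne y),
      (encard_le_encard (inter_subset_inter_left _ hSB)).trans (F.fibre_encard_le _)⟩

end IsFactor


/-! ### The return map on `I` and the totally transitive case. -/

variable {f φ g α β : unitInterval → unitInterval} {I B : Set unitInterval}
  {p q : unitInterval} {n : ℕ}

theorem IsPeriodicInterval.exists_nhds_inter_subset (hI : IsPeriodicInterval f n I)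
    (hf : Continuous f) {x : unitInterval} (hx : x ∈ I) {U : Set unitInterval} (hU : U ∈ 𝓝 x) :
    ∃ W ∈ 𝓝 x, W ⊆ U ∧ W ∩ orb f I ⊆ I := by
  have h1 := hI.iterate_mem_nhdsWithin hf (i := 0) (x := x) (by simpa using hx)
  obtain ⟨W, hW, hWs⟩ := mem_nhdsWithin_iff_exists_mem_nhds_inter.1 h1
  exact ⟨W ∩ U, inter_mem hW hU, inter_subset_right, fun t ht => by
    simpa using hWs ⟨ht.1.1, ht.2⟩⟩

namespace IsFactor

/-- Since `φ '' I` is `n`-periodic for `g`, a transition between two of its subsets takes a multiple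
of `n` steps. -/
theorem exists_iterate_mul_mem (F : IsFactor f (orb f I) B φ g)
    (h : IntervalCycle f (orb f I) B) (hI : IsPeriodicInterval f n I)
    (himg : φ '' I = Icc p q) {U V : Set unitInterval} (hU : IsOpen U)
    (hV : IsOpen V) (hUs : U ⊆ Icc p q) (hVs : V ⊆ Icc p q) (hUne : U.Nonempty)
    (hVne : V.Nonempty) : ∃ j, ∃ x ∈ U, g^[n * j] x ∈ V := by
  have hsub : Icc p q ⊆ φ '' orb f I := himg ▸ image_mono subset_orb
  obtain ⟨m, _, ⟨x, ⟨hxU, -⟩, rfl⟩, hxV⟩ := (F.isTransitiveOn_image h).2 U V hU hV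
    (hUne.mono fun x hx => ⟨hx, hsub (hUs hx)⟩) (hVne.mono fun x hx => ⟨hx, hsub (hVs hx)⟩)
  have hI' := F.isPeriodicInterval h hI
  have h1 : g^[m] x ∈ g^[m] '' (φ '' I) := mem_image_of_mem _ (himg ▸ hUs hxU)
  have h2 : g^[m] x ∈ g^[0] '' (φ '' I) := by
    rw [himg]
    exact ⟨_, hVs hxV, rfl⟩
  have h3 := hI'.mod_eq_of_mem h1 h2
  obtain ⟨j, rfl⟩ := Nat.dvd_of_mod_eq_zero (h3.trans (Nat.zero_mod n))
  exact ⟨j, x, hxU, hxV⟩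

theorem image_basic_inter (F : IsFactor f (orb f I) B φ g)
    (h : IntervalCycle f (orb f I) B) (hI : IsPeriodicInterval f n I) :
    φ '' (B ∩ I) = φ '' I := by
  refine Subset.antisymm (image_mono inter_subset_right) ?_
  rintro _ ⟨x, hx, rfl⟩
  have h1 := mem_image_of_mem φ (subset_orb (f := f) hx)
  rw [← F.image_basic h] at h1
  obtain ⟨b, hb, hbx⟩ := h1
  have hpre := (F.fibre_ordConnected (φ x)).isPreconnected
  have := hI.subset_of_isPreconnected h.cont hpre inter_subset_left (i := 0)
    (show x ∈ orb f I ∩ φ ⁻¹' {φ x} from ⟨subset_orb hx, rfl⟩) (by simpa using hx)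
    (show b ∈ orb f I ∩ φ ⁻¹' {φ x} from ⟨h.subset hb, hbx⟩)
  exact ⟨b, ⟨hb, by simpa using this⟩, hbx⟩

theorem mapsTo_g_Icc (F : IsFactor f (orb f I) B φ g)
    (h : IntervalCycle f (orb f I) B) (hI : IsPeriodicInterval f n I)
    (himg : φ '' I = Icc p q) : MapsTo g^[n] (Icc p q) (Icc p q) := by
  have := (F.isPeriodicInterval h hI).image_eq
  rw [himg] at this
  exact mapsTo_iff_image_subset.2 this.subset

/-- Infinitely many points of `B` accumulate at `x`, but only two can lie over `y`. -/
theorem exists_basic_apply_ne (F : IsFactor f (orb f I) B φ g)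
    (h : IntervalCycle f (orb f I) B) (hI : IsPeriodicInterval f n I)
    {x : unitInterval} (hx : x ∈ B ∩ I) {U : Set unitInterval}
    (hU : U ∈ 𝓝 x) (y : unitInterval) : ∃ z ∈ B ∩ I ∩ U, φ z ≠ y := by
  obtain ⟨W, hW, hWU, hWI⟩ := hI.exists_nhds_inter_subset h.cont hx.2 hU
  have hfin : (B ∩ φ ⁻¹' {y}).Finite :=
    finite_of_encard_le_coe (k := 2) (by exact_mod_cast F.fibre_encard_le y)
  obtain ⟨z, hz, hzn⟩ := ((h.inter_nhds_infinite hx.1 hW).sdiff hfin).nonempty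
  exact ⟨z, ⟨⟨hz.1, hWI ⟨hz.2, h.subset hz.1⟩⟩, hWU hz.2⟩, fun hc => hzn ⟨hz.1, hc⟩⟩

end IsFactor

theorem IsPeriodicInterval.closure_interior_inter (hI : IsPeriodicInterval f n I)
    (h : IntervalCycle f (orb f I) B) : closure (interior I ∩ B) = B ∩ I := by
  have hIc : IsClosed I := by simpa using (hI.isCompact_iterate h.cont 0).isClosed
  refine Subset.antisymm (closure_minimal (fun x hx => ⟨hx.2, interior_subset hx.1⟩)
    (h.isClosed_basic.inter hIc)) ?_
  rintro x ⟨hxB, hxI⟩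
  rw [mem_closure_iff_nhds]
  intro U hU
  obtain ⟨W, hW, hWU, hWI⟩ := hI.exists_nhds_inter_subset h.cont hxI hU
  have hinf := h.inter_nhds_infinite hxB hW
  obtain ⟨a, b, hab, rfl⟩ := hI.interval
  obtain ⟨z, hz, hzn⟩ := (hinf.sdiff (toFinite {a, b})).nonempty
  have hzI : z ∈ Icc a b := hWI ⟨hz.2, h.subset hz.1⟩
  simp only [mem_insert_iff, mem_singleton_iff, not_or] at hzn
  exact ⟨z, hWU hz.2, interior_maximal Ioo_subset_Icc_self isOpen_Ioo
    ⟨lt_of_le_of_ne hzI.1 (Ne.symm hzn.1), lt_of_le_of_ne hzI.2 hzn.2⟩, hz.1⟩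

/-- The conclusion of the theorem on the decomposition of a basic set into pieces on which an
iterate of the map is almost mixing. -/
def HasMixingDecomposition (f : unitInterval → unitInterval) (n : ℕ) (I B : Set unitInterval) :
    Prop :=
  ∃ (J : Set unitInterval) (k : ℕ) (S : Set unitInterval), IsClosedInterval J ∧ J ⊆ I ∧
    (k = n ∨ k = 2 * n) ∧ (k = n → J = I) ∧ S = closure (interior J ∩ B) ∧
    f^[k] '' J = J ∧ f^[k] '' S = S ∧
    (∀ i j : ℕ, i < j → j < k → (f^[i] '' S ∩ f^[j] '' S).Subsingleton) ∧
    (⋃ i ∈ Finset.range k, f^[i] '' S) = B ∧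
    ∃ g φ : unitInterval → unitInterval, Continuous g ∧ IsMixing g ∧
      AlmostConjugates φ f^[k] J S g univ

/-- The pieces are those of the cycle itself. For the entropy, the return map may have a single
fixed point; its square has two and is transitive by hypothesis, and this accounts for the factor
two. -/
theorem IsFactor.decomposition_of_totally (F : IsFactor f (orb f I) B φ g)
    (h : IntervalCycle f (orb f I) B) (hI : IsPeriodicInterval f n I)
    (himg : φ '' I = Icc p q) (R : IsRescaling p q α β)
    (ht : ∀ k > 0, IsTransitiveOn (α ∘ g^[n] ∘ β)^[k] univ) :
    ((Real.log 2 / ((2 * n : ℕ) : ℝ) : ℝ) : EReal) ≤ Dynamics.coverEntropy f B ∧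
      HasMixingDecomposition f n I B := by
  have hsub : Icc p q ⊆ φ '' orb f I := himg ▸ image_mono subset_orb
  have hcont : Continuous (α ∘ g^[n] ∘ β) :=
    R.continuous_conj ((F.continuousOn_iterate h n).mono hsub)
  have hIc : IsClosed I := by simpa using (hI.isCompact_iterate h.cont 0).isClosed
  have hIm : MapsTo f^[n] I I := mapsTo_iff_image_subset.2 hI.image_eq.subset
  have hSm : f^[n] '' (B ∩ I) = B ∩ I := by rw [← basic_inter_iterate hI h, hI.image_eq]
  have hSφ : φ '' (B ∩ I) = Icc p q := by rw [F.image_basic_inter h hI, himg]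
  have hIord : I.OrdConnected := by
    obtain ⟨a, b, -, rfl⟩ := hI.interval
    exact ordConnected_Icc
  have hconj := F.almostConjugates_rescaling h R subset_orb hIord hIm
    (mapsTo_iff_image_subset.2 hSm.subset) inter_subset_left inter_subset_right himg hSφ
  constructor
  · have h1 : IsTransitiveOn (α ∘ g^[n] ∘ β) univ := ht 1 one_pos
    obtain ⟨z, z', hzz, hz, hz'⟩ := h1.exists_two_fixed_sq hcont
    have hhs := (ht 2 two_pos).exists_horseshoe (hcont.iterate 2) hzz hz hz'
    refine log_two_div_le_coverEntropy (Nat.mul_pos two_pos hI.pos) (hcont.iterate 2)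
      (R.cont.comp F.cont) hIc ?_ ?_ inter_subset_left inter_subset_right hconj.image_eq hhs
    · rw [mul_comm, Function.iterate_mul]
      exact hIm.iterate 2
    · intro x hx
      rw [mul_comm, Function.iterate_mul]
      exact (hconj.semiconj _ (hIm hx)).trans
        (congrArg (α ∘ g^[n] ∘ β) (hconj.semiconj x hx))
  · refine ⟨I, n, B ∩ I, hI.interval, Subset.rfl, Or.inl rfl, fun _ => rfl,
      (hI.closure_interior_inter h).symm, hI.image_eq, hSm, ?_, (basic_eq_biUnion hI h).symm,
      _, _, hcont, IsTransitiveOn.isMixing ht hcont, hconj⟩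
    intro i j hij hj x hx
    exact absurd ⟨image_mono inter_subset_right hx.1, image_mono inter_subset_right hx.2⟩
      fun hc => (hI.disjoint i j hij hj).le_bot hc


/-! ### The case of exchanged halves. -/

variable {f φ g α β : unitInterval → unitInterval} {I B : Set unitInterval}
  {p c q : unitInterval} {n : ℕ}

/-- The factor `g` has the interval `Icc p q` as the image of `I`, and `g^[n]` exchanges the two
halves `Icc p c` and `Icc c q` of this interval. -/
structure IsSwapped (f : unitInterval → unitInterval) (n : ℕ) (I B : Set unitInterval)
    (φ g : unitInterval → unitInterval) (p c q : unitInterval) : Prop where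
  cyc : IntervalCycle f (orb f I) B
  per : IsPeriodicInterval f n I
  fac : IsFactor f (orb f I) B φ g
  image_I : φ '' I = Icc p q
  lt_left : p < c
  lt_right : c < q
  fixed : g^[n] c = c
  left : MapsTo g^[n] (Icc p c) (Icc c q)
  right : MapsTo g^[n] (Icc c q) (Icc p c)
  ne : ∀ u v, u < v → Icc u v ⊆ Icc p q → ∃ s ∈ Icc u v, g^[n] (g^[n] s) ≠ c

/-- The points of `B ∩ I` which `φ` maps to the right of `c`. -/
def rightPart (I B : Set unitInterval) (φ : unitInterval → unitInterval) (c : unitInterval) :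
    Set unitInterval :=
  {x ∈ B ∩ I | c < φ x}

namespace IsSwapped

theorem apply_mem (D : IsSwapped f n I B φ g p c q) {x : unitInterval} (hx : x ∈ I) :
    φ x ∈ Icc p q := D.image_I ▸ mem_image_of_mem φ hx

theorem mapsTo_iterate (D : IsSwapped f n I B φ g p c q) : MapsTo f^[n] I I :=
  mapsTo_iff_image_subset.2 D.per.image_eq.subset

theorem semiconj (D : IsSwapped f n I B φ g p c q) {x : unitInterval} (hx : x ∈ I) :
    φ (f^[n] x) = g^[n] (φ x) :=
  D.fac.semiconj_iterate D.cyc (subset_orb hx) n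

theorem semiconj_two (D : IsSwapped f n I B φ g p c q) {x : unitInterval} (hx : x ∈ I) :
    φ (f^[n] (f^[n] x)) = g^[n] (g^[n] (φ x)) := by
  rw [D.semiconj (D.mapsTo_iterate hx), D.semiconj hx]

theorem image_basic_inter (D : IsSwapped f n I B φ g p c q) : f^[n] '' (B ∩ I) = B ∩ I := by
  rw [← basic_inter_iterate D.per D.cyc, D.per.image_eq]

theorem Icc_subset (D : IsSwapped f n I B φ g p c q) : Icc p q ⊆ φ '' orb f I :=
  D.image_I ▸ image_mono subset_orb

theorem isClosed_I (D : IsSwapped f n I B φ g p c q) : IsClosed I := by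
  simpa using (D.per.isCompact_iterate D.cyc.cont 0).isClosed

theorem iterate_two_mul (x : unitInterval) (K : unitInterval → unitInterval) :
    K^[2 * n] x = K^[n] (K^[n] x) := by
  rw [two_mul, Function.iterate_add_apply]

theorem exists_left_preimage (D : IsSwapped f n I B φ g p c q) {x : unitInterval}
    (hx : x ∈ rightPart I B φ c) : ∃ y ∈ B ∩ I, φ y < c ∧ f^[n] y = x := by
  obtain ⟨y, hy, rfl⟩ := D.image_basic_inter.ge hx.1
  refine ⟨y, hy, not_le.1 fun hle => ?_, rfl⟩
  have := D.right ⟨hle, (D.apply_mem hy.2).2⟩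
  rw [← D.semiconj hy.2] at this
  exact this.2.not_gt hx.2

theorem exists_right_preimage (D : IsSwapped f n I B φ g p c q) {x : unitInterval}
    (hx : x ∈ B ∩ I) (hxc : φ x < c) : ∃ y ∈ rightPart I B φ c, f^[n] y = x := by
  obtain ⟨y, hy, rfl⟩ := D.image_basic_inter.ge hx
  refine ⟨y, ⟨hy, not_le.1 fun hle => ?_⟩, rfl⟩
  have := D.left ⟨(D.apply_mem hy.2).1, hle⟩
  rw [← D.semiconj hy.2] at this
  exact this.1.not_gt hxc

theorem rightPart_subset_image (D : IsSwapped f n I B φ g p c q) :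
    rightPart I B φ c ⊆ f^[2 * n] '' rightPart I B φ c := by
  intro x hx
  obtain ⟨y, hy, hyc, rfl⟩ := D.exists_left_preimage hx
  obtain ⟨z, hz, rfl⟩ := D.exists_right_preimage hy hyc
  exact ⟨z, hz, iterate_two_mul z f⟩

/-- Points over values sent to `c` by two returns may leave the right part. By the field `ne` they
can be avoided arbitrarily close to any point of it. -/
theorem exists_rightPart_ne (D : IsSwapped f n I B φ g p c q) {x : unitInterval}
    (hx : x ∈ rightPart I B φ c) {U : Set unitInterval} (hU : U ∈ 𝓝 x) :
    ∃ y ∈ rightPart I B φ c ∩ U, g^[n] (g^[n] (φ y)) ≠ c := by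
  obtain ⟨W, hW, hWU, hWI⟩ := D.per.exists_nhds_inter_subset D.cyc.cont hx.1.2 hU
  have hW' : W ∩ φ ⁻¹' Ioi c ∈ 𝓝 x :=
    inter_mem hW ((isOpen_Ioi.preimage D.fac.cont).mem_nhds hx.2)
  obtain ⟨u, v, huv, hsub, hlt, himg, hsat⟩ := D.fac.exists_saturated D.cyc hx.1.1 hW'
  obtain ⟨u', hu', hu''⟩ := exists_between hlt
  obtain ⟨v', hv', hv''⟩ := exists_between hu''
  have hI : ∀ t ∈ Icc u v, t ∈ I := fun t ht => hWI ⟨(hsub ht).2.1, (hsub ht).1⟩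
  obtain ⟨s, hs, hsc⟩ := D.ne u' v' hv' fun t ht =>
    ⟨(D.apply_mem (hI u (left_mem_Icc.2 huv.le))).1.trans (hu'.le.trans ht.1),
      (ht.2.trans hv''.le).trans (D.apply_mem (hI v (right_mem_Icc.2 huv.le))).2⟩
  obtain ⟨b, hb, rfl, hbuv⟩ := D.fac.exists_basic_of_saturated D.cyc himg hsat
    ⟨hu'.trans_le hs.1, hs.2.trans_lt hv''⟩
  exact ⟨b, ⟨⟨⟨hb, hI b hbuv⟩, (hsub hbuv).2.2⟩, hWU (hsub hbuv).2.1⟩, hsc⟩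

theorem exists_closure_ne (D : IsSwapped f n I B φ g p c q) {x : unitInterval}
    (hx : x ∈ closure (rightPart I B φ c)) {U : Set unitInterval} (hU : U ∈ 𝓝 x) :
    ∃ y ∈ rightPart I B φ c ∩ U, g^[n] (g^[n] (φ y)) ≠ c := by
  obtain ⟨O, hOU, hO, hxO⟩ := mem_nhds_iff.1 hU
  obtain ⟨z, hzO, hz⟩ := mem_closure_iff.1 hx O hO hxO
  obtain ⟨y, hy, hyc⟩ := D.exists_rightPart_ne hz (hO.mem_nhds hzO)
  exact ⟨y, ⟨hy.1, hOU hy.2⟩, hyc⟩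

theorem closure_rightPart_subset (D : IsSwapped f n I B φ g p c q) :
    closure (rightPart I B φ c) ⊆ B ∩ I ∩ φ ⁻¹' Ici c :=
  closure_minimal (fun _ hx => ⟨hx.1, hx.2.le⟩)
    ((D.cyc.isClosed_basic.inter D.isClosed_I).inter (isClosed_Ici.preimage D.fac.cont))

/-- Points which two returns do not send over `c` are dense in the right part and go back into it;
closing up deals with the others. In the other direction, each point of the right part has a
preimage on the left and this has one on the right. -/
theorem image_closure_rightPart (D : IsSwapped f n I B φ g p c q) :
    f^[2 * n] '' closure (rightPart I B φ c) = closure (rightPart I B φ c) := by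
  have hcont := D.cyc.cont.iterate (2 * n)
  apply Subset.antisymm
  · rintro _ ⟨x, hx, rfl⟩
    rw [mem_closure_iff_nhds]
    intro U hU
    obtain ⟨y, ⟨hy, hyU⟩, hyc⟩ := D.exists_closure_ne hx (hcont.continuousAt.preimage_mem_nhds hU)
    refine ⟨f^[2 * n] y, hyU, ⟨D.cyc.mapsTo_basic.iterate _ hy.1.1, ?_⟩, ?_⟩
    · rw [iterate_two_mul]
      exact D.mapsTo_iterate (D.mapsTo_iterate hy.1.2)
    · rw [iterate_two_mul, D.semiconj_two hy.1.2]
      exact lt_of_le_of_ne (D.left (D.right ⟨hy.2.le, (D.apply_mem hy.1.2).2⟩)).1 hyc.symm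
  · exact closure_minimal (D.rightPart_subset_image.trans (image_mono subset_closure))
      (isClosed_closure.isCompact.image hcont).isClosed

theorem subset_union (D : IsSwapped f n I B φ g p c q) :
    B ∩ I ⊆ closure (rightPart I B φ c) ∪ f^[n] '' closure (rightPart I B φ c) := by
  have hclosed : IsClosed
      (closure (rightPart I B φ c) ∪ f^[n] '' closure (rightPart I B φ c)) :=
    isClosed_closure.union (isClosed_closure.isCompact.image (D.cyc.cont.iterate n)).isClosed
  have hne : ∀ x ∈ B ∩ I, φ x ≠ c →
      x ∈ closure (rightPart I B φ c) ∪ f^[n] '' closure (rightPart I B φ c) := by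
    intro x hx hxc
    rcases hxc.lt_or_gt with hlt | hlt
    · obtain ⟨y, hy, rfl⟩ := D.exists_right_preimage hx hlt
      exact Or.inr (mem_image_of_mem _ (subset_closure hy))
    · exact Or.inl (subset_closure ⟨hx, hlt⟩)
  intro x hx
  rw [← hclosed.closure_eq, mem_closure_iff_nhds]
  intro U hU
  obtain ⟨z, hz, hzc⟩ := D.fac.exists_basic_apply_ne D.cyc D.per hx hU c
  exact ⟨z, hz.2, hne z hz.1 hzc⟩

theorem biUnion_image (D : IsSwapped f n I B φ g p c q) :
    ⋃ i ∈ Finset.range (2 * n), f^[i] '' closure (rightPart I B φ c) = B := by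
  have hSB : closure (rightPart I B φ c) ⊆ B := fun x hx => (D.closure_rightPart_subset hx).1.1
  apply Subset.antisymm
  · exact iUnion₂_subset fun i _ => (image_mono hSB).trans (D.cyc.iterate_image_basic i).subset
  · intro x hx
    rw [basic_eq_biUnion D.per D.cyc] at hx
    obtain ⟨i, hi, y, hy, rfl⟩ := mem_iUnion₂.1 hx
    have hi' := Finset.mem_range.1 hi
    rcases D.subset_union hy with h | ⟨z, hz, rfl⟩
    · exact mem_iUnion₂.2 ⟨i, Finset.mem_range.2 (by omega), mem_image_of_mem _ h⟩
    · refine mem_iUnion₂.2 ⟨i + n, Finset.mem_range.2 (by omega), z, hz, ?_⟩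
      rw [Function.iterate_add_apply]

theorem image_phi (D : IsSwapped f n I B φ g p c q) :
    φ '' closure (rightPart I B φ c) = Icc c q := by
  apply Subset.antisymm
  · rintro _ ⟨x, hx, rfl⟩
    have := D.closure_rightPart_subset hx
    exact ⟨this.2, (D.apply_mem this.1.2).2⟩
  · rw [← closure_Ioc D.lt_right.ne]
    refine closure_minimal ?_ (isClosed_closure.isCompact.image D.fac.cont).isClosed
    intro t ht
    have h1 : t ∈ φ '' I := by
      rw [D.image_I]
      exact ⟨D.lt_left.le.trans ht.1.le, ht.2⟩
    rw [← D.fac.image_basic_inter D.cyc D.per] at h1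
    obtain ⟨x, hx, rfl⟩ := h1
    exact mem_image_of_mem _ (subset_closure ⟨hx, ht.1⟩)

/-- The images of the two halves under `g^[i]` have no common non-degenerate interval. -/
theorem not_Icc_subset (D : IsSwapped f n I B φ g p c q) {i : ℕ} (hi : i < n)
    {t₀ t₁ : unitInterval} (ht : t₀ < t₁) (h1 : Icc t₀ t₁ ⊆ g^[i] '' Icc c q)
    (h2 : Icc t₀ t₁ ⊆ g^[i] '' Icc p c) : False := by
  obtain ⟨t, htt⟩ := exists_between ht
  obtain ⟨s₀, hs₀, rfl⟩ := h1 ⟨htt.1.le, htt.2.le⟩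
  have hcq : Icc c q ⊆ Icc p q := Icc_subset_Icc_left D.lt_left.le
  have hcont : ContinuousOn g^[i] (Icc c q) :=
    (D.fac.continuousOn_iterate D.cyc i).mono (hcq.trans D.Icc_subset)
  obtain ⟨U, hU, hUs⟩ := mem_nhdsWithin_iff_exists_mem_nhds_inter.1
    ((hcont s₀ hs₀).preimage_mem_nhdsWithin (Ioo_mem_nhds htt.1 htt.2))
  obtain ⟨u, v, huv, -, hsub, -⟩ := exists_Icc_subset_of_mem_nhds D.lt_right hs₀ hU
  obtain ⟨s, hs, hsc⟩ := D.ne u v huv fun t ht => hcq (hsub ht).1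
  obtain ⟨l, hl, hls⟩ := h2 (Ioo_subset_Icc_self (hUs ⟨(hsub hs).2, (hsub hs).1⟩))
  -- A value common to a right point `s` and a left point `l` persists up to time `n`, when the
  -- sides have been exchanged, so it is then `c`. The choice of `s` by the field `ne` excludes
  -- this.
  have hn : g^[n] s = g^[n] l := by
    obtain ⟨j, rfl⟩ := Nat.exists_eq_add_of_le hi.le
    rw [add_comm, Function.iterate_add_apply, Function.iterate_add_apply, hls]
  have hc : g^[n] s = c := le_antisymm (D.right (hsub hs).1).2 (hn ▸ (D.left hl).1)
  exact hsc (by rw [hc, D.fixed])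

theorem iterate_left (D : IsSwapped f n I B φ g p c q) : Icc p c ⊆ Icc p q :=
  Icc_subset_Icc_right D.lt_right.le

/-- Both images are intervals containing `g^[i] c`; points of both below it would give them a common
non-degenerate interval. -/
theorem not_mem_images (D : IsSwapped f n I B φ g p c q) {i : ℕ} (hi : i < n)
    {u u' : unitInterval} (hu : u < g^[i] c) (hu' : u' < g^[i] c) (h1 : u ∈ g^[i] '' Icc c q)
    (h2 : u' ∈ g^[i] '' Icc p c) : False := by
  have hord : ∀ A ⊆ Icc p q, A.OrdConnected → (g^[i] '' A).OrdConnected := fun A hA hAo =>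
    (hAo.isPreconnected.image _ ((D.fac.continuousOn_iterate D.cyc i).mono
      (hA.trans D.Icc_subset))).ordConnected
  have o1 := hord _ (Icc_subset_Icc_left D.lt_left.le) (ordConnected_Icc (a := c) (b := q))
  have o2 := hord _ D.iterate_left (ordConnected_Icc (a := p) (b := c))
  have hc1 : g^[i] c ∈ g^[i] '' Icc c q := mem_image_of_mem _ (left_mem_Icc.2 D.lt_right.le)
  have hc2 : g^[i] c ∈ g^[i] '' Icc p c := mem_image_of_mem _ (right_mem_Icc.2 D.lt_left.le)
  exact D.not_Icc_subset hi (max_lt hu hu')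
    ((Icc_subset_Icc_left (le_max_left _ _)).trans (o1.out h1 hc1))
    ((Icc_subset_Icc_left (le_max_right _ _)).trans (o2.out h2 hc2))

theorem not_mem_images' (D : IsSwapped f n I B φ g p c q) {i : ℕ} (hi : i < n)
    {u u' : unitInterval} (hu : g^[i] c < u) (hu' : g^[i] c < u') (h1 : u ∈ g^[i] '' Icc c q)
    (h2 : u' ∈ g^[i] '' Icc p c) : False := by
  have hord : ∀ A ⊆ Icc p q, A.OrdConnected → (g^[i] '' A).OrdConnected := fun A hA hAo =>
    (hAo.isPreconnected.image _ ((D.fac.continuousOn_iterate D.cyc i).mono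
      (hA.trans D.Icc_subset))).ordConnected
  have o1 := hord _ (Icc_subset_Icc_left D.lt_left.le) (ordConnected_Icc (a := c) (b := q))
  have o2 := hord _ D.iterate_left (ordConnected_Icc (a := p) (b := c))
  have hc1 : g^[i] c ∈ g^[i] '' Icc c q := mem_image_of_mem _ (left_mem_Icc.2 D.lt_right.le)
  have hc2 : g^[i] c ∈ g^[i] '' Icc p c := mem_image_of_mem _ (right_mem_Icc.2 D.lt_left.le)
  exact D.not_Icc_subset hi (lt_min hu hu')
    ((Icc_subset_Icc_right (min_le_left _ _)).trans (o1.out hc1 h1))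
    ((Icc_subset_Icc_right (min_le_right _ _)).trans (o2.out hc2 h2))

theorem iterate_ne (D : IsSwapped f n I B φ g p c q) {i : ℕ} (hi : i < n) {r : unitInterval}
    (hr : g^[n] r ≠ c) : g^[i] r ≠ g^[i] c := by
  intro hc
  obtain ⟨j, rfl⟩ := Nat.exists_eq_add_of_le hi.le
  have h1 := D.fixed
  rw [add_comm, Function.iterate_add_apply] at hr h1
  exact hr (by rw [hc, h1])

/-- Common points can lie only over `g^[i] c`. If `y < y'` were two of them, both pieces would
contain points left of `y'` not over `g^[i] c`, hence over smaller values, against `not_mem_images`.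
-/
theorem subsingleton_inter (D : IsSwapped f n I B φ g p c q) {i : ℕ} (hi : i < n) :
    (f^[i] '' closure (rightPart I B φ c) ∩
      f^[i + n] '' closure (rightPart I B φ c)).Subsingleton := by
  have hmemR : ∀ x ∈ closure (rightPart I B φ c), φ (f^[i] x) ∈ g^[i] '' Icc c q := by
    intro x hx
    have hx' := D.closure_rightPart_subset hx
    rw [D.fac.semiconj_iterate D.cyc (subset_orb hx'.1.2)]
    exact mem_image_of_mem _ ⟨hx'.2, (D.apply_mem hx'.1.2).2⟩
  have heq : ∀ x ∈ closure (rightPart I B φ c), φ (f^[i + n] x) = g^[i] (g^[n] (φ x)) := by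
    intro x hx
    rw [D.fac.semiconj_iterate D.cyc (subset_orb (D.closure_rightPart_subset hx).1.2),
      Function.iterate_add_apply]
  have hmemL : ∀ x ∈ closure (rightPart I B φ c), φ (f^[i + n] x) ∈ g^[i] '' Icc p c := by
    intro x hx
    have hx' := D.closure_rightPart_subset hx
    rw [heq x hx]
    exact mem_image_of_mem _ (D.right ⟨hx'.2, (D.apply_mem hx'.1.2).2⟩)
  have hφ : ∀ y ∈ f^[i] '' closure (rightPart I B φ c) ∩
      f^[i + n] '' closure (rightPart I B φ c), φ y = g^[i] c := by
    rintro y ⟨⟨x, hx, rfl⟩, x', hx', hxx⟩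
    have h1 := hmemR x hx
    have h2 := hmemL x' hx'
    rw [hxx] at h2
    rcases lt_trichotomy (φ (f^[i] x)) (g^[i] c) with hlt | heq | hlt
    · exact (D.not_mem_images hi hlt hlt h1 h2).elim
    · exact heq
    · exact (D.not_mem_images' hi hlt hlt h1 h2).elim
  have hlt : ∀ y ∈ f^[i] '' closure (rightPart I B φ c) ∩
      f^[i + n] '' closure (rightPart I B φ c), ∀ y' ∈ f^[i] '' closure (rightPart I B φ c) ∩
      f^[i + n] '' closure (rightPart I B φ c), ¬ y < y' := by
    intro y hy y' hy' hyy
    have e := hφ y hy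
    have e' := hφ y' hy'
    have hside : ∀ z < y', φ z ≠ g^[i] c → φ z < g^[i] c := fun z hz hne =>
      lt_of_le_of_ne (e' ▸ D.fac.mono hz.le) hne
    obtain ⟨⟨x, hx, hxy⟩, x', hx', hxy'⟩ := hy
    obtain ⟨r, hr, hrc⟩ := D.exists_closure_ne hx
      ((D.cyc.cont.iterate i).continuousAt.preimage_mem_nhds (hxy ▸ Iio_mem_nhds hyy))
    obtain ⟨r', hr', hrc'⟩ := D.exists_closure_ne hx'
      ((D.cyc.cont.iterate (i + n)).continuousAt.preimage_mem_nhds (hxy' ▸ Iio_mem_nhds hyy))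
    refine D.not_mem_images hi (hside _ hr.2 ?_) (hside _ hr'.2 ?_)
      (hmemR r (subset_closure hr.1)) (hmemL r' (subset_closure hr'.1))
    · rw [D.fac.semiconj_iterate D.cyc (subset_orb hr.1.1.2)]
      exact D.iterate_ne hi fun hc => hrc (by rw [hc, D.fixed])
    · rw [heq r' (subset_closure hr'.1)]
      exact D.iterate_ne hi hrc'
  intro y hy y' hy'
  exact le_antisymm (not_lt.1 (hlt y' hy' y hy)) (not_lt.1 (hlt y hy y' hy'))

end IsSwapped


variable {f φ g α β : unitInterval → unitInterval} {I B : Set unitInterval}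
  {p c q : unitInterval} {n : ℕ}

namespace IsRescaling

theorem strictMonoOn (R : IsRescaling p q α β) : StrictMonoOn α (Icc p q) :=
  fun _ hs _ ht hst => lt_of_le_of_ne (R.mono hst.le) fun he => hst.ne (R.injOn hs ht he)

theorem apply_right (R : IsRescaling p q α β) : α q = 1 := by
  refine le_antisymm unitInterval.le_one' ?_
  calc 1 = α (β 1) := (R.right_inv 1).symm
    _ ≤ α q := R.mono (R.mem 1).2

end IsRescaling

theorem IsFactor.exists_isSwapped (F : IsFactor f (orb f I) B φ g)
    (h : IntervalCycle f (orb f I) B) (hI : IsPeriodicInterval f n I)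
    (himg : φ '' I = Icc p q) (R : IsRescaling p q α β)
    (hcont : Continuous (α ∘ g^[n] ∘ β)) (ht : IsTransitiveOn (α ∘ g^[n] ∘ β) univ)
    {c : unitInterval} (hc0 : 0 < c) (hc1 : c < 1) (hc : (α ∘ g^[n] ∘ β) c = c)
    (hl : ∀ x ≤ c, c ≤ (α ∘ g^[n] ∘ β) x) (hr : ∀ x, c ≤ x → (α ∘ g^[n] ∘ β) x ≤ c) :
    IsSwapped f n I B φ g p (β c) q := by
  have hm := F.mapsTo_g_Icc h hI himg
  have hfix : g^[n] (β c) = β c := by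
    rw [← R.left_inv _ (hm (R.mem c))]
    exact congrArg β hc
  have hp : p < β c := lt_of_le_of_ne (R.mem c).1 fun he => by
    rw [← R.right_inv c, ← he, R.apply_left] at hc0
    exact lt_irrefl _ hc0
  have hq : β c < q := lt_of_le_of_ne (R.mem c).2 fun he => by
    rw [← R.right_inv c, he, R.apply_right] at hc1
    exact lt_irrefl _ hc1
  refine ⟨h, hI, F, himg, hp, hq, hfix, ?_, ?_, ?_⟩
  · intro x hx
    have hx' : x ∈ Icc p q := ⟨hx.1, hx.2.trans hq.le⟩
    refine ⟨(R.strictMonoOn.le_iff_le (R.mem c) (hm hx')).1 ?_, (hm hx').2⟩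
    have := hl (α x) ((R.mono hx.2).trans_eq (R.right_inv c))
    simpa only [Function.comp_apply, R.left_inv x hx', R.right_inv] using this
  · intro x hx
    have hx' : x ∈ Icc p q := ⟨hp.le.trans hx.1, hx.2⟩
    refine ⟨(hm hx').1, (R.strictMonoOn.le_iff_le (hm hx') (R.mem c)).1 ?_⟩
    have := hr (α x) ((R.right_inv c).symm.trans_le (R.mono hx.1))
    simpa only [Function.comp_apply, R.left_inv x hx', R.right_inv] using this
  · intro u v huv hsub
    obtain ⟨w, hw⟩ := exists_between huv
    obtain ⟨s, hs, hsc⟩ := ht.exists_iterate_ne hcont (isOpen_Ioo.preimage R.cont_inv)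
      ⟨α w, show β (α w) ∈ Ioo u v from (R.left_inv w (hsub (Ioo_subset_Icc_self hw))).symm ▸ hw⟩ 2 c
    refine ⟨β s, Ioo_subset_Icc_self hs, fun hsc' => hsc ?_⟩
    rw [R.iterate hm]
    exact (congrArg α hsc').trans (R.right_inv c)

namespace IsSwapped

/-- The part of `I` over values at least `c` is mapped into itself, but perhaps not onto. The hull
of the closed right part is covered by its own image, so its orbit is connected and mapped onto
itself; the closure of that orbit is the required interval. -/
theorem exists_invariant_Icc (D : IsSwapped f n I B φ g p c q) :
    ∃ a b, a < b ∧ Icc a b ⊆ I ∩ φ ⁻¹' Ici c ∧ f^[2 * n] '' Icc a b = Icc a b ∧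
      closure (rightPart I B φ c) ⊆ Icc a b := by
  set S := closure (rightPart I B φ c) with hS
  have hScomp : IsCompact S := isClosed_closure.isCompact
  have hcont := D.cyc.cont.iterate (2 * n)
  have hSφ := D.image_phi
  have hSne : S.Nonempty := by
    rw [← image_nonempty (f := φ), hSφ]
    exact nonempty_Icc.2 D.lt_right.le
  have hSI : S ⊆ I ∩ φ ⁻¹' Ici c := fun x hx =>
    ⟨(D.closure_rightPart_subset hx).1.2, (D.closure_rightPart_subset hx).2⟩
  obtain ⟨s, hs⟩ := hScomp.exists_isLeast hSne
  obtain ⟨t, ht⟩ := hScomp.exists_isGreatest hSne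
  have hst : s ≤ t := hs.2 ht.1
  have hIord : I.OrdConnected := by
    obtain ⟨a, b, -, rfl⟩ := D.per.interval
    exact ordConnected_Icc
  have hJ0 : (I ∩ φ ⁻¹' Ici c).OrdConnected :=
    hIord.inter (ordConnected_Ici.preimage_mono D.fac.mono)
  have hJ0c : IsClosed (I ∩ φ ⁻¹' Ici c) :=
    D.isClosed_I.inter (isClosed_Ici.preimage D.fac.cont)
  have hJ0m : MapsTo f^[2 * n] (I ∩ φ ⁻¹' Ici c) (I ∩ φ ⁻¹' Ici c) := by
    rintro x ⟨hx, hxc⟩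
    rw [iterate_two_mul]
    refine ⟨D.mapsTo_iterate (D.mapsTo_iterate hx), ?_⟩
    rw [mem_preimage, D.semiconj_two hx]
    exact (D.left (D.right ⟨hxc, (D.apply_mem hx).2⟩)).1
  have hstJ : Icc s t ⊆ I ∩ φ ⁻¹' Ici c := hJ0.out (hSI hs.1) (hSI ht.1)
  have hcover : Icc s t ⊆ f^[2 * n] '' Icc s t := by
    have hord : (f^[2 * n] '' Icc s t).OrdConnected :=
      (isPreconnected_Icc.image _ hcont.continuousOn).ordConnected
    have hSs : S ⊆ f^[2 * n] '' Icc s t :=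
      D.image_closure_rightPart.ge.trans (image_mono fun x hx => ⟨hs.2 hx, ht.2 hx⟩)
    exact hord.out (hSs hs.1) (hSs ht.1)
  set O := orb f^[2 * n] (Icc s t) with hO
  have hOm : f^[2 * n] '' O = O := by
    refine Subset.antisymm mapsTo_orb.image_subset (orb_subset ?_ ?_)
    · exact hcover.trans (image_mono subset_orb)
    · rintro _ ⟨x, hx, rfl⟩
      exact ⟨_, mapsTo_orb hx, rfl⟩
  have hOJ : O ⊆ I ∩ φ ⁻¹' Ici c := orb_subset hstJ hJ0m
  have hcov : ∀ i, Icc s t ⊆ (f^[2 * n])^[i] '' Icc s t := by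
    intro i
    induction i with
    | zero => simp
    | succ i ih =>
      refine hcover.trans ((image_mono ih).trans ?_)
      rw [Function.iterate_succ', image_comp]
  have hOconn : IsPreconnected O :=
    isPreconnected_iUnion ⟨s, mem_iInter.2 fun i => hcov i (left_mem_Icc.2 hst)⟩
      fun i => isPreconnected_Icc.image _ (hcont.iterate i).continuousOn
  have hOne : O.Nonempty := ⟨s, subset_orb (left_mem_Icc.2 hst)⟩
  have heq := eq_Icc_of_connected_compact ⟨hOne.closure, hOconn.closure⟩
    isClosed_closure.isCompact
  have hSO : S ⊆ closure O := fun x hx => subset_closure (subset_orb ⟨hs.2 hx, ht.2 hx⟩)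
  have hinv : f^[2 * n] '' closure O = closure O := by
    refine Subset.antisymm ?_ ?_
    · refine (image_closure_subset_closure_image hcont).trans ?_
      rw [hOm]
    · refine closure_minimal ?_ (isClosed_closure.isCompact.image hcont).isClosed
      exact hOm.ge.trans (image_mono subset_closure)
  have hsub : closure O ⊆ I ∩ φ ⁻¹' Ici c := closure_minimal hOJ hJ0c
  rw [heq] at hinv hSO hsub
  refine ⟨_, _, lt_of_not_ge fun hle => ?_, hsub, hinv, hSO⟩
  have h1 := ((subsingleton_Icc_of_ge hle).anti hSO).image φ
  rw [hSφ] at h1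
  exact D.lt_right.ne (h1 (left_mem_Icc.2 D.lt_right.le) (right_mem_Icc.2 D.lt_right.le))

theorem closure_interior_inter (D : IsSwapped f n I B φ g p c q) {a b : unitInterval}
    (hJ : Icc a b ⊆ I ∩ φ ⁻¹' Ici c) (hS : closure (rightPart I B φ c) ⊆ Icc a b) :
    closure (interior (Icc a b) ∩ B) = closure (rightPart I B φ c) := by
  refine Subset.antisymm (closure_minimal ?_ isClosed_closure)
    (closure_minimal ?_ isClosed_closure)
  · rintro x ⟨hx, hxB⟩
    rw [mem_closure_iff_nhds]
    intro U hU
    obtain ⟨z, ⟨hz, hzU⟩, hzc⟩ := D.fac.exists_basic_apply_ne D.cyc D.per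
      ⟨hxB, (hJ (interior_subset hx)).1⟩ (inter_mem hU (isOpen_interior.mem_nhds hx)) c
    have := (hJ (interior_subset hzU.2)).2
    exact ⟨z, hzU.1, hz, lt_of_le_of_ne this hzc.symm⟩
  · intro x hx
    rw [mem_closure_iff_nhds]
    intro U hU
    obtain ⟨W, hW, hWU, hWI⟩ := D.per.exists_nhds_inter_subset D.cyc.cont hx.1.2 hU
    have hinf := D.cyc.inter_nhds_infinite hx.1.1
      (inter_mem hW ((isOpen_Ioi.preimage D.fac.cont).mem_nhds hx.2))
    obtain ⟨z, hz, hzn⟩ := (hinf.sdiff (toFinite {a, b})).nonempty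
    simp only [mem_insert_iff, mem_singleton_iff, not_or] at hzn
    have hzI : z ∈ Icc a b :=
      hS (subset_closure ⟨⟨hz.1, hWI ⟨hz.2.1, D.cyc.subset hz.1⟩⟩, hz.2.2⟩)
    exact ⟨z, hWU hz.2.1, interior_maximal Ioo_subset_Icc_self isOpen_Ioo
      ⟨lt_of_le_of_ne hzI.1 (Ne.symm hzn.1), lt_of_le_of_ne hzI.2 hzn.2⟩, hz.1⟩

theorem mapsTo_two (D : IsSwapped f n I B φ g p c q) :
    MapsTo g^[2 * n] (Icc c q) (Icc c q) := by
  intro x hx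
  rw [iterate_two_mul]
  exact D.left (D.right hx)

/-- After an odd number of returns a point of the right half is in the left half, so transitions
between open subsets of `Ioo c q` use an even number. -/
theorem isTransitiveOn (D : IsSwapped f n I B φ g p c q) (R : IsRescaling c q α β) :
    IsTransitiveOn (α ∘ g^[2 * n] ∘ β) univ := by
  refine R.isTransitiveOn D.lt_right D.mapsTo_two fun U V hU hV hUs hVs hUne hVne => ?_
  have hcq : Ioo c q ⊆ Icc p q :=
    Ioo_subset_Icc_self.trans (Icc_subset_Icc_left D.lt_left.le)
  obtain ⟨j, x, hx, hxV⟩ := D.fac.exists_iterate_mul_mem D.cyc D.per D.image_I hU hV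
    (hUs.trans hcq) (hVs.trans hcq) hUne hVne
  have heven : ∀ i, g^[2 * n * i] x ∈ Icc c q := by
    intro i
    rw [Function.iterate_mul]
    exact D.mapsTo_two.iterate i (Ioo_subset_Icc_self (hUs hx))
  obtain ⟨i, rfl | rfl⟩ := Nat.even_or_odd' j
  · refine ⟨i, x, hx, ?_⟩
    rwa [← Function.iterate_mul, mul_comm 2 n, mul_assoc]
  · exfalso
    have h1 := D.right (heven i)
    rw [← Function.iterate_add_apply, show n + 2 * n * i = n * (2 * i + 1) by ring] at h1
    exact h1.2.not_gt (hVs hxV).1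

/-- The second return map of the right half fixes the end over `c`. It can therefore not exchange
halves, so all its iterates are transitive and it is mixing; no further doubling of the time is
needed for a horseshoe. -/
theorem decomposition (D : IsSwapped f n I B φ g p c q) :
    ((Real.log 2 / ((2 * n : ℕ) : ℝ) : ℝ) : EReal) ≤ Dynamics.coverEntropy f B ∧
      HasMixingDecomposition f n I B := by
  obtain ⟨α, β, R⟩ := exists_isRescaling D.lt_right
  obtain ⟨a, b, hab, hJ, hJm, hSJ⟩ := D.exists_invariant_Icc
  have hSm := D.image_closure_rightPart
  have hSB : closure (rightPart I B φ c) ⊆ B := fun x hx => (D.closure_rightPart_subset hx).1.1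
  have hJφ : φ '' Icc a b = Icc c q := by
    refine Subset.antisymm ?_ (D.image_phi.ge.trans (image_mono hSJ))
    rintro _ ⟨x, hx, rfl⟩
    exact ⟨(hJ hx).2, (D.apply_mem (hJ hx).1).2⟩
  have hconj := D.fac.almostConjugates_rescaling D.cyc R
    (fun x hx => subset_orb (hJ hx).1) ordConnected_Icc (mapsTo_iff_image_subset.2 hJm.subset)
    (mapsTo_iff_image_subset.2 hSm.subset) hSB hSJ hJφ D.image_phi
  have hH := D.isTransitiveOn R
  have hcont : Continuous (α ∘ g^[2 * n] ∘ β) :=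
    R.continuous_conj ((D.fac.continuousOn_iterate D.cyc _).mono
      ((Icc_subset_Icc_left D.lt_left.le).trans D.Icc_subset))
  have h0 : (α ∘ g^[2 * n] ∘ β) 0 = 0 := by
    simp only [Function.comp_apply]
    rw [R.inv_zero D.lt_right.le, iterate_two_mul, D.fixed, D.fixed, R.apply_left]
  have htot : ∀ k > 0, IsTransitiveOn (α ∘ g^[2 * n] ∘ β)^[k] univ := by
    rcases hH.totally_or_swap hcont with ht | ⟨s, hs, -, -, hle, -⟩
    · exact ht
    · exact absurd (hle 0 hs.le) (by rw [h0]; exact hs.not_ge)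
  -- Between a preimage `x` of `1` and the end `1`, the map starts above the diagonal and ends on or
  -- below it; this gives a fixed point other than `0`.
  have hfix : ∃ z, 0 < z ∧ (α ∘ g^[2 * n] ∘ β) z = z := by
    obtain ⟨x, hx⟩ := hH.surjective hcont 1
    have hx0 : 0 < x := lt_of_le_of_ne unitInterval.nonneg' fun he => by
      rw [← he, h0] at hx
      exact zero_ne_one hx
    obtain ⟨z, hz, hzf⟩ := exists_mem_Icc_isFixedPt (a := x) (b := 1) hcont.continuousOn
      unitInterval.le_one' (unitInterval.le_one'.trans_eq hx.symm) unitInterval.le_one'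
    exact ⟨z, hx0.trans_le hz.1, hzf⟩
  obtain ⟨z, hz, hzf⟩ := hfix
  refine ⟨log_two_div_le_coverEntropy (Nat.mul_pos two_pos D.per.pos) hcont (R.cont.comp D.fac.cont)
    isClosed_Icc (mapsTo_iff_image_subset.2 hJm.subset) hconj.semiconj hSB hSJ hconj.image_eq
    (hH.exists_horseshoe hcont hz h0 hzf), ?_⟩
  refine ⟨Icc a b, 2 * n, closure (rightPart I B φ c), ⟨a, b, hab, rfl⟩, fun x hx => (hJ hx).1,
    Or.inr rfl, fun hn => ?_, (D.closure_interior_inter hJ hSJ).symm, hJm, hSm, ?_,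
    D.biUnion_image, _, _, hcont, IsTransitiveOn.isMixing htot hcont, hconj⟩
  · have := D.per.pos
    omega
  · intro i j hij hj
    by_cases hmod : i % n = j % n
    -- Two distinct times below `2 * n` with the same residue differ by exactly `n`.
    · have h1 : j = i + n := by
        obtain ⟨d, rfl⟩ := Nat.exists_eq_add_of_le hij.le
        have h2 : 0 ≡ d [MOD n] := Nat.ModEq.add_left_cancel' i hmod
        obtain ⟨e, rfl⟩ := (Nat.modEq_zero_iff_dvd.1 h2.symm)
        have he : e < 2 := Nat.lt_of_mul_lt_mul_left (a := n) (by linarith)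
        have : e ≠ 0 := by
          rintro rfl
          simp at hij
        have : e = 1 := by omega
        rw [this, mul_one]
      subst h1
      exact D.subsingleton_inter (by omega)
    · intro x hx
      have hSI : closure (rightPart I B φ c) ⊆ I := fun x hx => (hJ (hSJ hx)).1
      exact absurd ⟨image_mono hSI hx.1, image_mono hSI hx.2⟩
        fun hc => (D.per.disjoint_of_mod_ne hmod).le_bot hc

end IsSwapped

/-! ### The two cases combined, and the theorem. -/

theorem IsFactor.decomposition (F : IsFactor f (orb f I) B φ g)
    (h : IntervalCycle f (orb f I) B) (hI : IsPeriodicInterval f n I) :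
    ((Real.log 2 / ((2 * n : ℕ) : ℝ) : ℝ) : EReal) ≤ Dynamics.coverEntropy f B ∧
      HasMixingDecomposition f n I B := by
  obtain ⟨p, q, hpq, himg⟩ := (F.isPeriodicInterval h hI).interval
  obtain ⟨α, β, R⟩ := exists_isRescaling hpq
  have hm := F.mapsTo_g_Icc h hI himg
  have hcont : Continuous (α ∘ g^[n] ∘ β) :=
    R.continuous_conj ((F.continuousOn_iterate h n).mono (himg ▸ image_mono subset_orb))
  have ht : IsTransitiveOn (α ∘ g^[n] ∘ β) univ := by
    refine R.isTransitiveOn hpq hm fun U V hU hV hUs hVs hUne hVne => ?_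
    obtain ⟨j, x, hx, hxV⟩ := F.exists_iterate_mul_mem h hI himg hU hV
      (hUs.trans Ioo_subset_Icc_self) (hVs.trans Ioo_subset_Icc_self) hUne hVne
    exact ⟨j, x, hx, by rwa [← Function.iterate_mul]⟩
  rcases ht.totally_or_swap hcont with htot | ⟨c, hc0, hc1, hc, hl, hr⟩
  · exact F.decomposition_of_totally h hI himg R htot
  · exact (F.exists_isSwapped h hI himg R hcont ht hc0 hc1 hc hl hr).decomposition

end IntervalDynamics

theorem theorem4p1 (f : unitInterval → unitInterval) (hf : Continuous f)
    (n : ℕ) (I : Set unitInterval) (hI : IntervalDynamics.IsPeriodicInterval f n I)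
    (M B : Set unitInterval) (hM : M = IntervalDynamics.orb f I)
    (hB : B = IntervalDynamics.basicSet f M) (hinf : B.Infinite) :
    -- `f|B` is almost conjugate by a monotone map to a transitive map of a cycle of `n` intervals
    (∃ (g φ : unitInterval → unitInterval) (I' : Set unitInterval),
      IntervalDynamics.IsPeriodicInterval g n I' ∧
      ContinuousOn g (IntervalDynamics.orb g I') ∧
      IntervalDynamics.IsTransitiveOn g (IntervalDynamics.orb g I') ∧
      φ '' I = I' ∧
      IntervalDynamics.AlmostConjugates φ f M B g (IntervalDynamics.orb g I')) ∧
    -- closed, invariant, perfect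
    IsClosed B ∧ f '' B = B ∧ Perfect B ∧
    -- transitivity
    IntervalDynamics.IsTransitiveOn f B ∧
    -- a maximal limit set
    (∃ x ∈ B, IntervalDynamics.omegaSet f x = B) ∧
    (∀ z : unitInterval, B ⊆ IntervalDynamics.omegaSet f z →
      IntervalDynamics.omegaSet f z = B) ∧
    -- entropy of `f|B`
    ((Real.log 2 / (2 * (n : ℝ)) : ℝ) : EReal) ≤ Dynamics.coverEntropy f B ∧
    -- density of periodic points
    B ⊆ closure (Function.periodicPts f) ∧
    -- decomposition of `B` into pieces on which an iterate is almost mixing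
    (∃ (J : Set unitInterval) (k : ℕ) (B' : Set unitInterval),
      IntervalDynamics.IsClosedInterval J ∧ J ⊆ I ∧
      (k = n ∨ k = 2 * n) ∧ (k = n → J = I) ∧
      B' = closure (interior J ∩ B) ∧
      f^[k] '' J = J ∧ f^[k] '' B' = B' ∧
      (∀ i j : ℕ, i < j → j < k → (f^[i] '' B' ∩ f^[j] '' B').Subsingleton) ∧
      (⋃ i ∈ Finset.range k, f^[i] '' B') = B ∧
      ∃ g φ : unitInterval → unitInterval, Continuous g ∧ IntervalDynamics.IsMixing g ∧
        IntervalDynamics.AlmostConjugates φ f^[k] J B' g Set.univ) := by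
  subst hM hB
  have h := hI.intervalCycle hf hinf
  obtain ⟨φ, g, F⟩ := h.exists_isFactor
  have ht := F.isTransitiveOn_basic h
  obtain ⟨hent, hdec⟩ := F.decomposition h hI
  refine ⟨⟨g, φ, φ '' I, F.isPeriodicInterval h hI, ?_, ?_, rfl, ?_⟩, h.isClosed_basic,
    h.image_basic, h.perfect_basic, ht, h.exists_omegaSet_eq ht,
    fun z hz => h.omegaSet_eq_of_subset hz, ?_, h.subset_closure_periodicPts ht, hdec⟩
  · rw [F.orb_image h]
    exact F.cont_g
  · rw [F.orb_image h]
    exact F.isTransitiveOn_image h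
  · rw [F.orb_image h]
    exact F.almostConjugates h
  · simpa only [Nat.cast_mul, Nat.cast_ofNat] using hent
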